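/- Let $Q$ be a finite acyclic quiver with $n$ vertices whose underlying undirected graph is a Dynkin diagram of type $A_n$ ($n\ge 1$), $D_n$ ($n\ge 4$), $E_6$ or $E_7$. Let $b_{ij}$ be the number of arrows $i\to j$ minus the number of arrows $j\to i$, and let $(a_{ij})$ be the Cartan matrix with $a_{ii}=2$ and $a_{ij}=-|b_{ij}|$ for $i\neq j$. Let $\alpha_i$ be the simple roots, indexed by the vertices, let $s_i$ be the simple reflections, $s_i(\alpha_j)=\alpha_j-a_{ij}\alpha_i$, and let $\Delta_Q^+$ be the set of positive roots of the root system of $Q$, i.e. the images of simple roots under the Weyl group generated by the $s_i$ whose coefficients are all nonnegative. Write $\le_D$ for the coefficientwise order on $\bigoplus_i\mathbb Z\alpha_i$, and $<_D$ for its strict part. Let $P_Q$ be the set of bijections $\pi$ from $\{1,\dots,n\}$ to the vertices of $Q$ such that there is no arrow $\pi(a)\to\pi(b)$ whenever $a>b$. In $H=\mathbb R\times\mathbb R_{\ge0}$ let $b=(0,0)$, $p_i=(i,1)$ and $\rho_i=\{(i,y): y\ge 1\}$ for $1\le i\le n$. An admissible curve is a smooth map $\gamma:[0,1]\to H$ such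 that $\gamma(0)\in\{p_1,\dots,p_n\}$, $\gamma(1)=b$, $\gamma(x)\notin\{b,p_1,\dots,p_n\}$ for $0<x<1$, and $\gamma$ meets the rays $\rho_i$ transversely at all times in $(0,1]$. It is non-self-crossing if it is injective. Suppose that $\gamma$ starts at $p_{k_0}$ and crosses, for increasing times in $(0,1]$, exactly the rays $\rho_{k_1},\dots,\rho_{k_m}$ in this order (finitely many crossings, $m\ge 0$). For $\pi\in P_Q$ put $v_i=s_{\pi(k_i)}\cdots s_{\pi(k_1)}\alpha_{\pi(k_0)}$ for $0\le i\le m$. The associated root $\alpha_\pi(\gamma)$ is $v_m$ if $v_m$ is positive and $-v_m$ otherwise. The curve $\gamma$ is non-decreasing with respect to $\pi$ if $v_{i-1}\le_D v_i$ for all $1\le i\le m$, and strictly increasing if $v_{i-1}<_D v_i$ for all $1\le i\le m$. Let $\Gamma_{\pi,nd}$ and $\Gamma_{\pi,s}$ be the sets of non-decreasing, respectively strictly increasing, non-self-crossing admissible curves with respect to $\pi$. Then $$\bigcup_{\pi\in P_Q}\{\alpha_\pi(\gamma)\mid\gamma\in\Gamma_{\pi,nd}\}=\Delta_Q^+.$$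 If moreover $Q$ is of type $A$, then also $$\bigcup_{\pi\in P_Q}\{\alpha_\pi(\gamma)\mid\gamma\in\Gamma_{\pi,s}\}=\Delta_Q^+.$$ -/

import Mathlib

open Set
open scoped ContDiff

namespace LeeLee

/-! ### Quivers, Cartan matrices and roots -/

section Roots

variable (V : Type*) [Quiver V]

/-- A quiver is acyclic if it has no oriented cycle of positive length (in particular no loops and
no oriented 2-cycles). -/
def IsAcyclicQuiver : Prop := ∀ (a : V) (p : Quiver.Path a a), p.length = 0

variable {V}

/-- The exchange matrix: `b i j` is the number of arrows `i ⟶ j` minus the number of arrows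
`j ⟶ i` (for a quiver without 2-cycles at most one of the two numbers is nonzero). -/
noncomputable def exchangeMatrix : Matrix V V ℤ :=
  fun i j => (Nat.card (i ⟶ j) : ℤ) - (Nat.card (j ⟶ i) : ℤ)

variable [DecidableEq V]

/-- The generalized Cartan matrix: `a i i = 2` and `a i j = -|b i j|` for `i ≠ j`. -/
noncomputable def cartan : Matrix V V ℤ :=
  fun i j => if i = j then 2 else -|exchangeMatrix i j|

variable (V) in
/-- The underlying graph is the Dynkin diagram `A_m` for some `m ≥ 1` (any labelling). -/
def IsTypeA : Prop :=
  ∃ m : ℕ, 1 ≤ m ∧ ∃ e : V ≃ Fin m, ∀ i j : V, cartan i j = CartanMatrix.A m (e i) (e j)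

variable (V) in
/-- The underlying graph is the Dynkin diagram `D_m` for some `m ≥ 4` (any labelling). -/
def IsTypeD : Prop :=
  ∃ m : ℕ, 4 ≤ m ∧ ∃ e : V ≃ Fin m, ∀ i j : V, cartan i j = CartanMatrix.D m (e i) (e j)

variable (V) in
/-- The underlying graph is the Dynkin diagram `E_6` (any labelling). -/
def IsTypeE6 : Prop :=
  ∃ e : V ≃ Fin 6, ∀ i j : V, cartan i j = CartanMatrix.E₆ (e i) (e j)

variable (V) in
/-- The underlying graph is the Dynkin diagram `E_7` (any labelling). -/
def IsTypeE7 : Prop :=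
  ∃ e : V ≃ Fin 7, ∀ i j : V, cartan i j = CartanMatrix.E₇ (e i) (e j)

/-- The simple root `α_i` in the root lattice `V → ℤ`. -/
def simpleRoot (i : V) : V → ℤ := Pi.single i 1

variable [Fintype V]

/-- The linear form `α_j ↦ a i j` on the root lattice. -/
noncomputable def coroot (i : V) : Module.Dual ℤ (V → ℤ) :=
  (LinearMap.proj i).comp (cartan (V := V)).mulVecLin

theorem coroot_simpleRoot (i j : V) : coroot i (simpleRoot j) = cartan i j := by
  simp [coroot, simpleRoot]

theorem coroot_simpleRoot_self (i : V) : coroot i (simpleRoot i) = 2 := by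
  rw [coroot_simpleRoot]; simp [cartan]

/-- The simple reflection `s_i`, the linear automorphism with `s_i α_j = α_j - a i j α_i`. -/
noncomputable def simpleReflection (i : V) : (V → ℤ) ≃ₗ[ℤ] (V → ℤ) :=
  Module.reflection (coroot_simpleRoot_self i)

theorem simpleReflection_simpleRoot (i j : V) :
    simpleReflection i (simpleRoot j) = simpleRoot j - cartan i j • simpleRoot i := by
  rw [simpleReflection, Module.reflection_apply, coroot_simpleRoot]

variable (V) in
/-- The Weyl group, generated by the simple reflections. -/
noncomputable def weylGroup : Subgroup ((V → ℤ) ≃ₗ[ℤ] (V → ℤ)) :=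
  Subgroup.closure (Set.range simpleReflection)

variable (V) in
/-- The root system of a quiver of finite (ADE) type: the images of the simple roots under the Weyl
group (in finite type every root is real). -/
def rootSystem : Set (V → ℤ) := {β | ∃ g ∈ weylGroup V, ∃ i : V, β = g (simpleRoot i)}

variable (V) in
/-- The positive roots `Δ⁺`: the roots with nonnegative coefficients. The order on `V → ℤ` is the
coefficientwise one, i.e. the standard partial order `≤_D`. -/
def positiveRoots : Set (V → ℤ) := {β | β ∈ rootSystem V ∧ 0 < β}

end Roots

/-! ### Admissible curves in the upper half plane -/

/-- The base point `b = (0, 0)`. -/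
def basePoint : ℝ × ℝ := (0, 0)

/-- The marked points `(1, 1), (2, 1), …, (n, 1)`, indexed by `Fin n = {0, …, n - 1}`. -/
def markedPoint {n : ℕ} (i : Fin n) : ℝ × ℝ := ((i : ℝ) + 1, 1)

/-- The vertical ray going up from the marked point `i`. -/
def ray {n : ℕ} (i : Fin n) : Set (ℝ × ℝ) := {q | q.1 = (i : ℝ) + 1 ∧ 1 ≤ q.2}

/-- An admissible curve: a smooth map `[0,1] → ℝ × ℝ_{≥ 0}` which starts at a marked point, ends at
the base point, meets these points at the times `0` and `1` only, and meets the rays transversely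
at all times in `(0,1]`. Only the values of `toFun` on `[0,1]` are relevant. -/
structure AdmissibleCurve (n : ℕ) where
  toFun : ℝ → ℝ × ℝ
  smooth : ContDiffOn ℝ ∞ toFun (Icc 0 1)
  mem_halfPlane : ∀ x ∈ Icc (0 : ℝ) 1, 0 ≤ (toFun x).2
  start : ∃ i : Fin n, toFun 0 = markedPoint i
  finish : toFun 1 = basePoint
  eq_zero_or_one : ∀ x ∈ Icc (0 : ℝ) 1,
    (toFun x = basePoint ∨ ∃ i : Fin n, toFun x = markedPoint i) → x = 0 ∨ x = 1
  /-- The velocity at a crossing is not tangent to the (vertical) ray. -/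
  transverse : ∀ x ∈ Ioc (0 : ℝ) 1, ∀ i : Fin n, toFun x ∈ ray i →
    (derivWithin toFun (Icc 0 1) x).1 ≠ 0

namespace AdmissibleCurve

variable {n : ℕ} (γ : AdmissibleCurve n)

/-- The curve is injective on `[0,1]`. -/
def NonSelfCrossing : Prop := InjOn γ.toFun (Icc 0 1)

/-- The times in `(0,1]` at which the curve meets a ray. -/
def crossingTimes : Set ℝ := {x | x ∈ Ioc (0 : ℝ) 1 ∧ ∃ i : Fin n, γ.toFun x ∈ ray i}

/-- The curve starts at the marked point `k`, it crosses the rays finitely often, and `w` lists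
the indices of the rays it crosses, in the order of increasing time. -/
def HasWord (k : Fin n) (w : List (Fin n)) : Prop :=
  γ.toFun 0 = markedPoint k ∧
    ∃ t : Fin w.length → ℝ, StrictMono t ∧ Set.range t = γ.crossingTimes ∧
      ∀ j, γ.toFun (t j) ∈ ray (w.get j)

/-- The initial index and the word of a curve are uniquely determined. -/
theorem HasWord.unique {γ : AdmissibleCurve n} {k k' : Fin n} {w w' : List (Fin n)}
    (h : γ.HasWord k w) (h' : γ.HasWord k' w') : k = k' ∧ w = w' := by
  obtain ⟨h0, t, ht, hr, hw⟩ := h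
  obtain ⟨h0', t', ht', hr', hw'⟩ := h'
  have key : ∀ i j : Fin n, (i : ℝ) + 1 = (j : ℝ) + 1 → i = j := by
    intro i j hij
    exact Fin.ext (by exact_mod_cast add_right_cancel hij)
  refine ⟨key _ _ (by simpa [markedPoint] using congrArg Prod.fst (h0.symm.trans h0')), ?_⟩
  have hlen : w.length = w'.length := by
    have h1 := Nat.card_congr (Equiv.ofInjective t ht.injective)
    have h2 := Nat.card_congr (Equiv.ofInjective t' ht'.injective)
    rw [hr, ← hr'] at h1
    simpa using h1.trans h2.symm
  have htt : t = fun j => t' (Fin.cast hlen j) := by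
    refine (StrictMono.range_inj ht (ht'.comp (Fin.castOrderIso hlen).strictMono)).1 ?_
    rw [hr, ← hr', (Fin.castOrderIso hlen).surjective.range_comp]
  refine List.ext_get hlen fun j hj hj' => ?_
  have h1 := hw ⟨j, hj⟩
  rw [htt] at h1
  exact key _ _ (h1.1.symm.trans (hw' ⟨j, hj'⟩).1)

end AdmissibleCurve

/-! ### Roots associated with curves -/

section Curves

variable {V : Type*} [Quiver V] [DecidableEq V] [Fintype V] {n : ℕ}

variable (V n) in
/-- The quiver-compatible permutations, viewed as bijections `π` from the positions `1, …, n` to the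
vertices: if `a > b` then there is no arrow from `π a` to `π b`. -/
def compatiblePerms : Set (Fin n ≃ V) := {π | ∀ a b : Fin n, a > b → IsEmpty (π a ⟶ π b)}

/-- For the initial index `k` and the word `w = k₁ k₂ …`, the vector
`s_{π(k_i)} ⋯ s_{π(k_1)} α_{π(k)}`. -/
noncomputable def partialRoot (π : Fin n ≃ V) (k : Fin n) (w : List (Fin n)) (i : ℕ) : V → ℤ :=
  (w.take i).foldl (fun v j => simpleReflection (π j) v) (simpleRoot (π k))

open Classical in
/-- The associated root of a word: `s_{π(k_m)} ⋯ s_{π(k_1)} α_{π(k)}` if that is positive, and its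
negative otherwise. -/
noncomputable def wordRoot (π : Fin n ≃ V) (k : Fin n) (w : List (Fin n)) : V → ℤ :=
  if 0 < partialRoot π k w w.length then partialRoot π k w w.length
  else -partialRoot π k w w.length

/-- `β` is the associated root `α_π(γ)` of the curve `γ`. -/
def IsAssociatedRoot (π : Fin n ≃ V) (γ : AdmissibleCurve n) (β : V → ℤ) : Prop :=
  ∃ k w, γ.HasWord k w ∧ β = wordRoot π k w

/-- The non-decreasing non-self-crossing admissible curves with respect to `π`. -/
def nonDecreasingCurves (π : Fin n ≃ V) : Set (AdmissibleCurve n) :=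
  {γ | γ.NonSelfCrossing ∧ ∃ k w, γ.HasWord k w ∧
    ∀ i < w.length, partialRoot π k w i ≤ partialRoot π k w (i + 1)}

/-- The strictly increasing non-self-crossing admissible curves with respect to `π`. -/
def strictlyIncreasingCurves (π : Fin n ≃ V) : Set (AdmissibleCurve n) :=
  {γ | γ.NonSelfCrossing ∧ ∃ k w, γ.HasWord k w ∧
    ∀ i < w.length, partialRoot π k w i < partialRoot π k w (i + 1)}

end Curves

end LeeLee

namespace LeeLee

/-! ### The smooth step function -/

/-! One inclusion is formal: a curve along which the vectors never decrease starts at a simple root,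
so its last vector is a positive element of the Weyl orbit (`partialRoot_mem_positiveRoots`). The
content is that every positive root is realized by some curve, for a suitable compatible order of
the vertices.

Most of the curves are spirals. What has been drawn fits in a box around consecutive marked points,
with the end of the path at the bottom of the box. From there the path can go around and cross the
ray of the next marked point on either side ("push"), leave that point uncrossed ("add"), or cross
all rays of the enclosed points in one direction ("pass"). `Trace.extend` glues straight segments by
means of a smooth step function, so that corners do no harm; `Trace.wind` draws one turn; `Grows`
and `Reach` retain only the combinatorics. The order of the marked points is constrained by the
arrows alone, and all arrows between two given vertices point the same way. Hence a vertex adjacent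
to at most one enclosed vertex can always be placed at one of the two ends (`Reach.add_leaf`).

In types A and D the only fact used about a positive root is that its coefficients are nonnegative
and its value under the invariant form is 2. If `u` is attached to `B` at `t`, and `v'` is the part
of `v` on `B`, completing the square gives `form v v - v u ^ 2 = (form v' v' - v' t ^ 2) + (v' t - v
u) ^ 2`. With nonnegativity on `B` this drives an induction along a chain (`ChainEnd.extend`), where
for `v u = 1` the coefficient at `t` is 0, 1 or 2. Starting from one vertex, the value 2 never
occurs and every crossing is a strict increase: this is type A. Starting from the branch vertex of
type D, the value 2 leads to exactly one vector at each stage, the highest root of a subdiagram of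
type D. It is reached by passes (`reach_star`, `TopGood.extend`), which also cross rays whose
reflections fix the vector.

Types E₆ and E₇ are finite checks over all orientations and positive roots. Winding curves suffice
for E₆. For E₇ the remaining roots are obtained from explicit rectilinear curves on an integral
grid, whose validity is itself decided by computation (`exists_curve_of_draw`). -/

theorem hasDerivAt_smoothTransition {x : ℝ} (h0 : 0 < x) (h1 : x < 1) :
    ∃ c : ℝ, 0 < c ∧ HasDerivAt Real.smoothTransition c x := by
  have hx : x ≠ 0 := h0.ne'
  have hx1 : 1 - x ≠ 0 := by linarith
  have key : ∀ y : ℝ, y ≠ 0 →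
      HasDerivAt (fun y : ℝ => Real.exp (-y⁻¹)) (Real.exp (-y⁻¹) * (y ^ 2)⁻¹) y := fun y hy => by
    simpa using ((hasDerivAt_inv hy).neg).exp
  have hf := key x hx
  have hg : HasDerivAt (fun y : ℝ => Real.exp (-(1 - y)⁻¹))
      (Real.exp (-(1 - x)⁻¹) * (-((1 - x) ^ 2)⁻¹)) x := by
    have h := (key (1 - x) hx1).comp x ((hasDerivAt_id x).const_sub 1)
    simpa [Function.comp_def] using h
  have hpos : 0 < Real.exp (-x⁻¹) + Real.exp (-(1 - x)⁻¹) := by positivity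
  have hd := hf.div (hf.add hg) hpos.ne'
  refine ⟨_, ?_, hd.congr_of_eventuallyEq ?_⟩
  -- For the quotient `f / (f + g)` with `f x = exp (-1/x)` and `g x = f (1 - x)`, the numerator of
  -- the derivative is `f' g - f g'`, and `g' < 0`.
  · apply div_pos _ (by positivity)
    have h3 : 0 < (x ^ 2)⁻¹ := by positivity
    have h4 : 0 < ((1 - x) ^ 2)⁻¹ := by positivity
    have e1 := Real.exp_pos (-x⁻¹)
    have e2 := Real.exp_pos (-(1 - x)⁻¹)
    have : 0 < Real.exp (-x⁻¹) * Real.exp (-(1 - x)⁻¹) * ((x ^ 2)⁻¹ + ((1 - x) ^ 2)⁻¹) := by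
      positivity
    simp only [Pi.add_apply]
    linarith
  · filter_upwards [Ioo_mem_nhds h0 h1] with y hy
    have : ¬ (1 - y ≤ 0) := by linarith [hy.2]
    simp [Real.smoothTransition, expNegInvGlue, not_le.2 hy.1, this]

theorem strictMonoOn_smoothTransition : StrictMonoOn Real.smoothTransition (Icc 0 1) := by
  refine strictMonoOn_of_deriv_pos (convex_Icc 0 1) Real.smoothTransition.continuous.continuousOn ?_
  intro x hx
  rw [interior_Icc] at hx
  obtain ⟨c, hc, h⟩ := hasDerivAt_smoothTransition hx.1 hx.2
  rwa [h.deriv]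

theorem exists_smoothTransition_eq {s : ℝ} (h0 : 0 < s) (h1 : s < 1) :
    ∃ t, 0 < t ∧ t < 1 ∧ Real.smoothTransition t = s := by
  have h := intermediate_value_Ioo (zero_le_one (α := ℝ))
    Real.smoothTransition.continuous.continuousOn
  rw [Real.smoothTransition.zero, Real.smoothTransition.one] at h
  obtain ⟨t, ht, rfl⟩ := h ⟨h0, h1⟩
  exact ⟨t, ht.1, ht.2, rfl⟩

theorem differentiable_smoothTransition : Differentiable ℝ Real.smoothTransition :=
  (Real.smoothTransition.contDiff (n := 1)).differentiable (by norm_num)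

/-- At `0` the function is known to be constant on the left side only; as it is differentiable
there, the left derivative is the derivative. -/
theorem deriv_smoothTransition_of_nonpos {x : ℝ} (hx : x ≤ 0) :
    deriv Real.smoothTransition x = 0 := by
  have h := (differentiable_smoothTransition x).hasDerivAt.hasDerivWithinAt (s := Iic x)
  have h2 : HasDerivWithinAt Real.smoothTransition 0 (Iic x) x :=
    (hasDerivWithinAt_const x (Iic x) (0 : ℝ)).congr
      (fun y hy => Real.smoothTransition.zero_of_nonpos (le_trans hy hx))
      (Real.smoothTransition.zero_of_nonpos hx)
  exact (uniqueDiffWithinAt_Iic x).eq_deriv _ h h2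

/-! ### Traces: smooth paths with a prescribed sequence of ray crossings -/

/-- The point on which the vertical ray with index `j` stands. -/
def mark (j : ℕ) : ℝ × ℝ := ((j : ℝ) + 1, 1)

/-- The vertical ray with index `j`. -/
def vray (j : ℕ) : Set (ℝ × ℝ) := {q | q.1 = (j : ℝ) + 1 ∧ 1 ≤ q.2}

/-- `Trace k w S e`: there is a smooth injective path inside `S` from the marked point `k` to `e`
which avoids all other marked points and crosses the rays listed in `w`, in this order and
transversely. -/
def Trace (k : ℕ) (w : List ℕ) (S : Set (ℝ × ℝ)) (e : ℝ × ℝ) : Prop :=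
  ∃ (N : ℕ) (g : ℝ → ℝ × ℝ), ContDiff ℝ ∞ g ∧ g 0 = mark k ∧ (∀ t : ℝ, N ≤ t → g t = e) ∧
    InjOn g (Icc 0 (N : ℝ)) ∧ (∀ t ∈ Icc 0 (N : ℝ), g t ∈ S) ∧
    (∀ t ∈ Ioc 0 (N : ℝ), ∀ j : ℕ, g t ≠ mark j) ∧
    (∀ t ∈ Ioc 0 (N : ℝ), ∀ j : ℕ, g t ∈ vray j → (deriv g t).1 ≠ 0) ∧
    ∃ T : List ℝ, T.Pairwise (· < ·) ∧
      (∀ t, t ∈ T ↔ t ∈ Ioc 0 (N : ℝ) ∧ ∃ j : ℕ, g t ∈ vray j) ∧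
      List.Forall₂ (fun t j => g t ∈ vray j) T w

theorem Trace.mono {k : ℕ} {w : List ℕ} {S S' : Set (ℝ × ℝ)} {e : ℝ × ℝ} (h : Trace k w S e)
    (hS : S ⊆ S') : Trace k w S' e := by
  obtain ⟨N, g, h1, h2, h3, h4, h5, h6⟩ := h
  exact ⟨N, g, h1, h2, h3, h4, fun t ht => hS (h5 t ht), h6⟩

theorem Trace.start (k : ℕ) : Trace k [] {mark k} (mark k) := by
  refine ⟨0, fun _ => mark k, contDiff_const, rfl, fun _ _ => rfl, ?_, fun _ _ => rfl, ?_, ?_, [],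
    List.Pairwise.nil, ?_, .nil⟩
  · intro a ha b hb _
    simp only [Nat.cast_zero, Icc_self, mem_singleton_iff] at ha hb
    rw [ha, hb]
  all_goals simp

/-- The point of the segment from `e` to `q` at parameter `s`. -/
def along (e q : ℝ × ℝ) (s : ℝ) : ℝ × ℝ := e + s • (q - e)

/-- Appending a straight segment to a trace. -/
theorem Trace.extend {k : ℕ} {w : List ℕ} {S : Set (ℝ × ℝ)} {e : ℝ × ℝ} (h : Trace k w S e)
    {q : ℝ × ℝ} (hq : e ≠ q) (hS : ∀ s, 0 < s → s ≤ 1 → along e q s ∉ S)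
    (hm : ∀ s, 0 < s → s ≤ 1 → ∀ j, along e q s ≠ mark j)
    {T' : List ℝ} {w' : List ℕ} (hT' : T'.Pairwise (· < ·)) (hT1 : ∀ s ∈ T', s ∈ Ioo (0 : ℝ) 1)
    (hT2 : ∀ s, 0 < s → s ≤ 1 → ∀ j, along e q s ∈ vray j → s ∈ T')
    (hw' : List.Forall₂ (fun s j => along e q s ∈ vray j) T' w')
    (hx : w' ≠ [] → q.1 ≠ e.1) :
    Trace k (w ++ w') (S ∪ {p | ∃ s, 0 ≤ s ∧ s ≤ 1 ∧ p = along e q s}) q := by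
  obtain ⟨N, g, hg, g0, gN, ginj, gS, gm, gd, T, hT, hTm, hTw⟩ := h
  set σ := Real.smoothTransition with hσ
  have ae : ∀ t : ℝ, t ≤ N → σ (t - N) = 0 := fun t ht =>
    Real.smoothTransition.zero_of_nonpos (by linarith)
  -- Up to time `N` the added term vanishes, and from time `N` on the old path rests at `e`. A sum
  -- of smooth functions is therefore the concatenation, and no derivatives have to be matched.
  set g' : ℝ → ℝ × ℝ := fun t => g t + σ (t - N) • (q - e) with hg'
  have g'le : ∀ t : ℝ, t ≤ N → g' t = g t := fun t ht => by simp [hg', ae t ht]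
  have g'ge : ∀ t : ℝ, N ≤ t → g' t = along e q (σ (t - N)) := fun t ht => by
    simp [hg', gN t ht, along]
  have along_inj : ∀ s s', along e q s = along e q s' → s = s' := by
    intro s s' hss
    have : (s - s') • (q - e) = 0 := by
      rw [sub_smul, sub_eq_zero]; exact add_left_cancel hss
    rcases smul_eq_zero.1 this with h | h
    · linarith
    · exact absurd (sub_eq_zero.1 h).symm hq
  have σpos : ∀ t : ℝ, N < t → 0 < σ (t - N) := fun t ht =>
    Real.smoothTransition.pos_of_pos (by linarith)
  have σle : ∀ t : ℝ, σ (t - N) ≤ 1 := fun t => Real.smoothTransition.le_one _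
  have hmem : ∀ t ∈ Ioc (0 : ℝ) ((N + 1 : ℕ) : ℝ), t ∈ Ioc (0 : ℝ) N ∨ N < t := by
    intro t ht
    rcases le_or_gt t N with h | h
    · exact .inl ⟨ht.1, h⟩
    · exact .inr h
  have hder : ∀ t, deriv g' t = deriv g t + deriv σ (t - N) • (q - e) := by
    intro t
    have d1 : HasDerivAt g (deriv g t) t :=
      ((hg.differentiable (by simp)) t).hasDerivAt
    have d2 : HasDerivAt (fun t : ℝ => σ (t - N)) (deriv σ (t - N)) t := by
      have := (differentiable_smoothTransition (t - N)).hasDerivAt.comp t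
        ((hasDerivAt_id t).sub_const (N : ℝ))
      simpa [Function.comp_def] using this
    exact (d1.add (d2.smul_const (q - e))).deriv
  have hderN : ∀ t : ℝ, N < t → deriv g t = 0 := by
    intro t ht
    have : g =ᶠ[nhds t] fun _ => e := by
      filter_upwards [Ioi_mem_nhds ht] with y hy using gN y (le_of_lt hy)
    rw [this.deriv_eq, deriv_const]
  choose! τ hτ0 hτ1 hτ using fun s (hs : s ∈ T') =>
    exists_smoothTransition_eq (hT1 s hs).1 (hT1 s hs).2
  refine ⟨N + 1, g', ?_, ?_, ?_, ?_, ?_, ?_, ?_, T ++ T'.map (fun s => N + τ s), ?_, ?_, ?_⟩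
  · exact hg.add ((Real.smoothTransition.contDiff.comp (contDiff_id.sub contDiff_const)).smul
      contDiff_const)
  · rw [g'le 0 (by positivity), g0]
  · intro t ht
    push_cast at ht
    rw [g'ge t (by linarith), hσ, Real.smoothTransition.one_of_one_le (by linarith)]
    simp [along]
  · have key : ∀ a ∈ Icc (0 : ℝ) ((N + 1 : ℕ) : ℝ), ∀ b ∈ Icc (0 : ℝ) ((N + 1 : ℕ) : ℝ), a < b →
        g' a ≠ g' b := by
      intro a ha b hb hab heq
      push_cast at ha hb
      rcases le_or_gt b N with hbN | hbN
      · rw [g'le a (by linarith), g'le b hbN] at heq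
        exact hab.ne (ginj ⟨ha.1, by linarith⟩ ⟨hb.1, hbN⟩ heq)
      · rw [g'ge b hbN.le] at heq
        rcases le_or_gt a N with haN | haN
        · rw [g'le a haN] at heq
          exact hS _ (σpos b hbN) (σle b) (heq ▸ gS a ⟨ha.1, haN⟩)
        · rw [g'ge a haN.le] at heq
          have := strictMonoOn_smoothTransition (a := a - N) (b := b - N)
            ⟨by linarith, by linarith [ha.2]⟩ ⟨by linarith, by linarith [hb.2]⟩ (by linarith)
          exact this.ne (along_inj _ _ heq)
    intro a ha b hb hab
    by_contra hne
    rcases lt_or_gt_of_ne hne with h | h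
    · exact key a ha b hb h hab
    · exact key b hb a ha h hab.symm
  · intro t ht
    rcases le_or_gt t N with h | h
    · rw [g'le t h]; exact .inl (gS t ⟨ht.1, h⟩)
    · rw [g'ge t h.le]; exact .inr ⟨_, (σpos t h).le, σle t, rfl⟩
  · intro t ht j
    rcases hmem t ht with h | h
    · rw [g'le t h.2]; exact gm t h j
    · rw [g'ge t h.le]; exact hm _ (σpos t h) (σle t) j
  · intro t ht j hj
    rw [hder]
    rcases hmem t ht with h | h
    · rw [g'le t h.2] at hj
      rw [hσ, deriv_smoothTransition_of_nonpos (by linarith [h.2]), zero_smul, add_zero]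
      exact gd t h j hj
    · rw [g'ge t h.le] at hj
      have hs := hT2 _ (σpos t h) (σle t) j hj
      have hs1 := hT1 _ hs
      -- Crossings have parameter strictly less than 1, so they happen before the path comes to rest
      -- and at positive speed.
      have ht1 : t - N < 1 := by
        by_contra hc
        rw [hσ, Real.smoothTransition.one_of_one_le (not_lt.1 hc)] at hs1
        exact lt_irrefl _ hs1.2
      obtain ⟨c, hc, hd⟩ := hasDerivAt_smoothTransition (x := t - N) (by linarith) ht1
      -- A crossing exists, so `T'` and hence `w'` is nonempty, and the segment is not vertical.
      have hq1 : q.1 ≠ e.1 := by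
        apply hx
        rintro rfl
        cases hw'
        simp at hs
      rw [hderN t h, hσ, hd.deriv]
      simpa using ⟨hc.ne', sub_ne_zero.2 hq1⟩
  · rw [List.pairwise_append]
    refine ⟨hT, ?_, ?_⟩
    · rw [List.pairwise_map]
      refine hT'.imp_of_mem fun {a b} ha hb hab => ?_
      have : ¬ τ b ≤ τ a := fun hle => by
        have := Real.smoothTransition.monotone hle
        rw [hτ a ha, hτ b hb] at this
        linarith
      linarith
    · intro a ha b hb
      obtain ⟨s, hs, rfl⟩ := List.mem_map.1 hb
      have := ((hTm a).1 ha).1.2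
      linarith [hτ0 s hs]
  · intro t
    rw [List.mem_append, hTm, List.mem_map]
    constructor
    · rintro (⟨h1, j, hj⟩ | ⟨s, hs, rfl⟩)
      · exact ⟨⟨h1.1, by push_cast; linarith [h1.2]⟩, j, by rwa [g'le t h1.2]⟩
      · obtain ⟨j, hj⟩ : ∃ j, along e q s ∈ vray j := by
          obtain ⟨i, hi, rfl⟩ := List.getElem_of_mem hs
          exact ⟨_, (List.forall₂_iff_get.1 hw').2 i hi (hw'.length_eq ▸ hi)⟩
        have := hτ0 s hs
        have := hτ1 s hs
        refine ⟨⟨by positivity, by push_cast; linarith⟩, j, ?_⟩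
        rw [g'ge _ (by linarith)]
        simpa [hσ, hτ s hs] using hj
    · rintro ⟨h1, j, hj⟩
      rcases hmem t h1 with h | h
      · exact .inl ⟨h, j, by rwa [g'le t h.2] at hj⟩
      · right
        rw [g'ge t h.le] at hj
        have hs := hT2 _ (σpos t h) (σle t) j hj
        refine ⟨_, hs, ?_⟩
        have hs1 := hT1 _ hs
        have ht1 : t - N < 1 := by
          by_contra hc
          rw [hσ, Real.smoothTransition.one_of_one_le (not_lt.1 hc)] at hs1
          exact lt_irrefl _ hs1.2
        have := strictMonoOn_smoothTransition.injOn ⟨(hτ0 _ hs).le, (hτ1 _ hs).le⟩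
          (⟨by linarith, ht1.le⟩ : t - N ∈ Icc (0 : ℝ) 1) (hτ _ hs)
        rw [this]; ring
  · apply List.rel_append
    · refine List.forall₂_iff_get.2 ⟨hTw.length_eq, fun i hi hj => ?_⟩
      have := (List.forall₂_iff_get.1 hTw).2 i hi hj
      rwa [g'le _ ((hTm _).1 (List.get_mem _ _)).1.2]
    · rw [List.forall₂_map_left_iff]
      refine List.forall₂_iff_get.2 ⟨hw'.length_eq, fun i hi hj => ?_⟩
      have := (List.forall₂_iff_get.1 hw').2 i hi hj
      have hmem : T'.get ⟨i, hi⟩ ∈ T' := List.get_mem _ _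
      rw [g'ge _ (by linarith [hτ0 _ hmem]), add_sub_cancel_left, hσ, hτ _ hmem]
      exact this

/-- A trace which ends at the base point and whose word only involves the first `n` rays is an
admissible curve. -/
theorem Trace.exists_curve {k : ℕ} {w : List ℕ} {S : Set (ℝ × ℝ)}
    (h : Trace k w S basePoint) (hS : ∀ p ∈ S, 0 ≤ p.2) {n : ℕ} (hk : k < n) (hw : ∀ j ∈ w, j < n)
    {w' : List (Fin n)} (hww : w'.map Fin.val = w) :
    ∃ γ : AdmissibleCurve n, γ.NonSelfCrossing ∧ γ.HasWord ⟨k, hk⟩ w' := by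
  obtain ⟨N, g, hg, g0, gN, ginj, gS, gm, gd, T, hT, hTm, hTw⟩ := h
  have hN : (0 : ℝ) < N := by
    rcases Nat.eq_zero_or_pos N with rfl | h
    · have := (gN 0 (by simp)).symm.trans g0
      have := congrArg Prod.snd this
      simp [basePoint, mark] at this
    · exact_mod_cast h
  have hmarked : ∀ i : Fin n, markedPoint i = mark i := fun i => rfl
  have hray : ∀ i : Fin n, ray i = vray i := fun i => rfl
  -- A trace records the crossings of the rays with all natural indices. As `w` only has indices
  -- below `n`, the rays of index `n` and higher are never met.
  have hvray : ∀ t ∈ Ioc 0 (N : ℝ), ∀ j : ℕ, g t ∈ vray j → ∃ i : Fin n, (i : ℕ) = j := by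
    intro t ht j hj
    have htT := (hTm t).2 ⟨ht, j, hj⟩
    obtain ⟨i, hi, rfl⟩ := List.getElem_of_mem htT
    have hl := hTw.length_eq
    have h2 := (List.forall₂_iff_get.1 hTw).2 i hi (hl ▸ hi)
    have h3 : (w.get ⟨i, hl ▸ hi⟩) = j := by
      have := h2.1.symm.trans hj.1
      exact_mod_cast add_right_cancel this
    exact ⟨⟨j, h3 ▸ hw _ (List.get_mem _ _)⟩, rfl⟩
  have hsc : ∀ x ∈ Icc (0 : ℝ) 1, N * x ∈ Icc (0 : ℝ) N := fun x hx =>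
    ⟨by have := hx.1; positivity, by nlinarith [hx.2]⟩
  have hsc' : ∀ x ∈ Ioc (0 : ℝ) 1, N * x ∈ Ioc (0 : ℝ) N := fun x hx =>
    ⟨by have := hx.1; positivity, by nlinarith [hx.2]⟩
  have hsm : ContDiff ℝ ∞ (fun x : ℝ => g (N * x)) := hg.comp (contDiff_const.mul contDiff_id)
  let γ : AdmissibleCurve n :=
    { toFun := fun x => g (N * x)
      smooth := hsm.contDiffOn
      mem_halfPlane := fun x hx => hS _ (gS _ (hsc x hx))
      start := ⟨⟨k, hk⟩, by simp [g0, hmarked]⟩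
      finish := by simpa using gN N le_rfl
      eq_zero_or_one := by
        rintro x hx (h | ⟨i, h⟩)
        · right
          have := ginj (hsc x hx) (⟨hN.le, le_rfl⟩ : (N : ℝ) ∈ Icc 0 (N : ℝ))
            (h.trans (gN N le_rfl).symm)
          field_simp at this
          exact this
        · left
          rcases hx.1.eq_or_lt with h0 | h0
          · exact h0.symm
          · exact absurd h (gm _ (hsc' x ⟨h0, hx.2⟩) i)
      transverse := by
        intro x hx i hi
        have hd : HasDerivAt (fun x : ℝ => g (N * x)) ((N : ℝ) • deriv g (N * x)) x := by
          have d1 : HasDerivAt g (deriv g (N * x)) (N * x) :=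
            ((hg.differentiable (by simp)) _).hasDerivAt
          have := d1.scomp x ((hasDerivAt_id x).const_mul (N : ℝ))
          simpa [Function.comp_def] using this
        rw [hd.hasDerivWithinAt.derivWithin
          (uniqueDiffOn_Icc zero_lt_one x ⟨hx.1.le, hx.2⟩)]
        simpa using ⟨by rintro rfl; simp at hN, gd _ (hsc' x hx) i hi⟩ }
  refine ⟨γ, ?_, by simp [γ, g0, hmarked], ?_⟩
  · intro a ha b hb hab
    exact mul_left_cancel₀ hN.ne' (ginj (hsc a ha) (hsc b hb) hab)
  · have hl : w'.length = T.length := by rw [hTw.length_eq, ← hww, List.length_map]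
    refine ⟨fun i => T.get (Fin.cast hl i) / N, ?_, ?_, ?_⟩
    · intro i j hij
      have := List.pairwise_iff_get.1 hT (Fin.cast hl i) (Fin.cast hl j) hij
      show T.get _ / (N : ℝ) < _ / _
      gcongr
    · ext x
      simp only [mem_range, AdmissibleCurve.crossingTimes, mem_ofPred_eq]
      constructor
      · rintro ⟨i, rfl⟩
        obtain ⟨h1, j, hj⟩ := (hTm _).1 (List.get_mem T (Fin.cast hl i))
        obtain ⟨m, rfl⟩ := hvray _ h1 j hj
        refine ⟨⟨div_pos h1.1 hN, (div_le_one hN).2 h1.2⟩, m, ?_⟩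
        show g (N * _) ∈ ray m
        rw [mul_div_cancel₀ _ hN.ne']
        exact hj
      · rintro ⟨hx, i, hi⟩
        obtain ⟨m, hm⟩ := List.get_of_mem ((hTm (N * x)).2 ⟨hsc' x hx, i, hi⟩)
        refine ⟨Fin.cast hl.symm m, ?_⟩
        rw [Fin.cast_cast, Fin.cast_eq_self, hm]
        field_simp
    · intro i
      show g (N * _) ∈ ray _
      rw [mul_div_cancel₀ _ hN.ne']
      have := (List.forall₂_iff_get.1 hTw).2 i (hl ▸ i.2) (by rw [← hTw.length_eq, ← hl]; exact i.2)
      rw [hray]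
      subst hww
      simpa using this

/-! ### Axis-parallel segments -/

theorem along_vertical (x y y' s : ℝ) : along (x, y) (x, y') s = (x, y + s * (y' - y)) := by
  simp [along]

theorem along_horizontal (x x' y s : ℝ) : along (x, y) (x', y) s = (x + s * (x' - x), y) := by
  simp [along]

theorem add_mul_sub_mem_uIcc {y y' s : ℝ} (h0 : 0 ≤ s) (h1 : s ≤ 1) :
    y + s * (y' - y) ∈ uIcc y y' := by
  rw [mem_uIcc]
  rcases le_total y y' with h | h
  · left; constructor <;> nlinarith
  · right; constructor <;> nlinarith

theorem add_mul_sub_ne {y y' s : ℝ} (h0 : 0 < s) (hy : y' ≠ y) : y + s * (y' - y) ≠ y := by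
  have := mul_ne_zero h0.ne' (sub_ne_zero.2 hy)
  intro h
  exact this (by linarith)

/-- The initial point of the segment is exempt from the hypotheses because it already belongs to the
trace; in particular a path may leave its marked point downwards. -/
theorem Trace.vertical {k : ℕ} {w : List ℕ} {S : Set (ℝ × ℝ)} {x y : ℝ} (h : Trace k w S (x, y))
    {y' : ℝ} (hy : y' ≠ y) (hS : ∀ z ∈ uIcc y y', z ≠ y → (x, z) ∉ S)
    (hr : (∀ j : ℕ, x ≠ j + 1) ∨ ∀ z ∈ uIcc y y', z ≠ y → z < 1) :
    Trace k w (S ∪ {p | p.1 = x ∧ p.2 ∈ uIcc y y'}) (x, y') := by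
  have hv : ∀ s, 0 < s → s ≤ 1 → ∀ j, along (x, y) (x, y') s ∉ vray j := by
    rintro s h0 h1 j ⟨hj, hj'⟩
    rw [along_vertical] at hj hj'
    rcases hr with hr | hr
    · exact hr j hj
    · exact absurd (hr _ (add_mul_sub_mem_uIcc h0.le h1) (add_mul_sub_ne h0 hy)) (not_lt.2 hj')
  have := h.extend (q := (x, y')) (fun hh => hy (congrArg Prod.snd hh).symm)
    (fun s h0 h1 => by
      rw [along_vertical]
      exact hS _ (add_mul_sub_mem_uIcc h0.le h1) (add_mul_sub_ne h0 hy))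
    (fun s h0 h1 j hj => hv s h0 h1 j (by rw [hj]; exact ⟨rfl, le_rfl⟩))
    (T' := []) (w' := []) .nil (by simp) (fun s h0 h1 j hj => absurd hj (hv s h0 h1 j)) .nil
    (by simp)
  rw [List.append_nil] at this
  refine this.mono (union_subset_union_right _ ?_)
  rintro p ⟨s, h0, h1, rfl⟩
  rw [along_vertical]
  exact ⟨rfl, add_mul_sub_mem_uIcc h0 h1⟩

theorem Trace.horizontal_below {k : ℕ} {w : List ℕ} {S : Set (ℝ × ℝ)} {x y : ℝ}
    (h : Trace k w S (x, y)) {x' : ℝ} (hx : x' ≠ x) (hS : ∀ z ∈ uIcc x x', z ≠ x → (z, y) ∉ S)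
    (hy : y < 1) :
    Trace k w (S ∪ {p | p.1 ∈ uIcc x x' ∧ p.2 = y}) (x', y) := by
  have hv : ∀ s j, along (x, y) (x', y) s ∉ vray j := by
    rintro s j ⟨hj, hj'⟩
    rw [along_horizontal] at hj'
    exact absurd hy (not_lt.2 hj')
  have := h.extend (q := (x', y)) (fun hh => hx (congrArg Prod.fst hh).symm)
    (fun s h0 h1 => by
      rw [along_horizontal]
      exact hS _ (add_mul_sub_mem_uIcc h0.le h1) (add_mul_sub_ne h0 hx))
    (fun s h0 h1 j hj => hv s j (by rw [hj]; exact ⟨rfl, le_rfl⟩))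
    (T' := []) (w' := []) .nil (by simp) (fun s h0 h1 j hj => absurd hj (hv s j)) .nil
    (by simp)
  rw [List.append_nil] at this
  refine this.mono (union_subset_union_right _ ?_)
  rintro p ⟨s, h0, h1, rfl⟩
  rw [along_horizontal]
  exact ⟨add_mul_sub_mem_uIcc h0 h1, rfl⟩

/-- The ray `j` is met at the parameter `(j + 1 - x) / (x' - x)`, so sorting by these parameters
gives the order of crossing in either direction. The end point has to be off the rays: a crossing
there would have zero speed. -/
theorem Trace.horizontal_above {k : ℕ} {w : List ℕ} {S : Set (ℝ × ℝ)} {x y : ℝ}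
    (h : Trace k w S (x, y)) {x' : ℝ} (hx : x' ≠ x) (hS : ∀ z ∈ uIcc x x', z ≠ x → (z, y) ∉ S)
    (hy : 1 < y) (hx' : ∀ j : ℕ, x' ≠ j + 1) {w' : List ℕ}
    (hw : w'.Pairwise fun i j : ℕ => ((i : ℝ) + 1 - x) / (x' - x) < ((j : ℝ) + 1 - x) / (x' - x))
    (hmem : ∀ j : ℕ, j ∈ w' ↔
      0 < ((j : ℝ) + 1 - x) / (x' - x) ∧ ((j : ℝ) + 1 - x) / (x' - x) < 1) :
    Trace k (w ++ w') (S ∪ {p | p.1 ∈ uIcc x x' ∧ p.2 = y}) (x', y) := by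
  have hd : x' - x ≠ 0 := sub_ne_zero.2 hx
  have := h.extend (q := (x', y)) (fun hh => hx (congrArg Prod.fst hh).symm)
    (fun s h0 h1 => by
      rw [along_horizontal]
      exact hS _ (add_mul_sub_mem_uIcc h0.le h1) (add_mul_sub_ne h0 hx))
    (fun s h0 h1 j hj => by
      rw [along_horizontal] at hj
      exact hy.ne' (congrArg Prod.snd hj))
    (T' := w'.map fun j : ℕ => ((j : ℝ) + 1 - x) / (x' - x)) (w' := w')
    (by rwa [List.pairwise_map])
    (by
      intro s hs
      obtain ⟨j, hj, rfl⟩ := List.mem_map.1 hs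
      exact (hmem j).1 hj)
    (fun s h0 h1 j hj => by
      rw [along_horizontal] at hj
      have hs : ((j : ℝ) + 1 - x) / (x' - x) = s := by
        have := hj.1
        simp only at this
        rw [← this]; field_simp; ring
      refine List.mem_map.2 ⟨j, (hmem j).2 ?_, hs⟩
      rw [hs]
      refine ⟨h0, lt_of_le_of_ne h1 ?_⟩
      rintro rfl
      apply hx' j
      have := hj.1
      simp only at this
      linarith)
    (by
      rw [List.forall₂_map_left_iff, List.forall₂_same]
      intro j _
      rw [along_horizontal]
      refine ⟨?_, hy.le⟩
      simp only
      field_simp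
      ring)
    (fun _ => hx)
  refine this.mono (union_subset_union_right _ ?_)
  rintro p ⟨s, h0, h1, rfl⟩
  rw [along_horizontal]
  exact ⟨add_mul_sub_mem_uIcc h0 h1, rfl⟩

theorem Trace.horizontal_right {k : ℕ} {w : List ℕ} {S : Set (ℝ × ℝ)} {x y : ℝ}
    (h : Trace k w S (x, y)) {x' : ℝ} (hx : x < x') (hS : ∀ z ∈ uIcc x x', z ≠ x → (z, y) ∉ S)
    (hy : 1 < y) (hx' : ∀ j : ℕ, x' ≠ j + 1) {w' : List ℕ} (hw : w'.Pairwise (· < ·))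
    (hmem : ∀ j : ℕ, j ∈ w' ↔ x < (j : ℝ) + 1 ∧ (j : ℝ) + 1 < x') :
    Trace k (w ++ w') (S ∪ {p | p.1 ∈ uIcc x x' ∧ p.2 = y}) (x', y) := by
  have hd : 0 < x' - x := sub_pos.2 hx
  refine h.horizontal_above hx.ne' hS hy hx' (hw.imp fun {i j} hij => ?_) fun j => ?_
  · have : (i : ℝ) < j := by exact_mod_cast hij
    gcongr
  · rw [hmem, div_lt_one hd, div_pos_iff_of_pos_right hd]
    constructor <;> rintro ⟨h1, h2⟩ <;> constructor <;> linarith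

theorem Trace.horizontal_left {k : ℕ} {w : List ℕ} {S : Set (ℝ × ℝ)} {x y : ℝ}
    (h : Trace k w S (x, y)) {x' : ℝ} (hx : x' < x) (hS : ∀ z ∈ uIcc x x', z ≠ x → (z, y) ∉ S)
    (hy : 1 < y) (hx' : ∀ j : ℕ, x' ≠ j + 1) {w' : List ℕ} (hw : w'.Pairwise (· > ·))
    (hmem : ∀ j : ℕ, j ∈ w' ↔ x' < (j : ℝ) + 1 ∧ (j : ℝ) + 1 < x) :
    Trace k (w ++ w') (S ∪ {p | p.1 ∈ uIcc x x' ∧ p.2 = y}) (x', y) := by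
  have hd : 0 < x - x' := sub_pos.2 hx
  have hdiv : ∀ j : ℕ, ((j : ℝ) + 1 - x) / (x' - x) = (x - (j + 1)) / (x - x') := fun j => by
    rw [← neg_sub x, ← neg_sub x x', neg_div_neg_eq]
  refine h.horizontal_above hx.ne hS hy hx' (hw.imp fun {i j} hij => ?_) fun j => ?_
  · have : (j : ℝ) < i := by exact_mod_cast hij
    rw [hdiv, hdiv]
    gcongr
  · rw [hmem, hdiv, div_lt_one hd, div_pos_iff_of_pos_right hd]
    constructor <;> rintro ⟨h1, h2⟩ <;> constructor <;> linarith

/-- A trace whose end point lies below everything else can be closed up. -/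
theorem Trace.exists_curve_of_lowest {k : ℕ} {w : List ℕ} {S : Set (ℝ × ℝ)} {e : ℝ × ℝ}
    (h : Trace k w S e) (he0 : 0 < e.2) (he1 : e.2 < 1) (hS : ∀ p ∈ S, e.2 ≤ p.2)
    {n : ℕ} (hk : k < n) {w' : List (Fin n)} (hww : w'.map Fin.val = w) :
    ∃ γ : AdmissibleCurve n, γ.NonSelfCrossing ∧ γ.HasWord ⟨k, hk⟩ w' := by
  -- The height decreases strictly along the last segment and stays below 1, so this segment meets
  -- neither the earlier path nor a ray.
  have hy : ∀ s, 0 < s → (along e basePoint s).2 < e.2 := by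
    intro s h0
    have : (along e basePoint s).2 = e.2 - s * e.2 := by simp [along, basePoint]; ring
    rw [this]
    nlinarith
  have hy1 : ∀ s, s ≤ 1 → 0 ≤ (along e basePoint s).2 := by
    intro s h1
    have : (along e basePoint s).2 = e.2 - s * e.2 := by simp [along, basePoint]; ring
    rw [this]
    nlinarith
  have hv : ∀ s, 0 < s → ∀ j, along e basePoint s ∉ vray j := by
    rintro s h0 j ⟨-, hj⟩
    linarith [hy s h0]
  have := h.extend (q := basePoint) (by rintro rfl; simp [basePoint] at he0)
    (fun s h0 _ hs => absurd (hS _ hs) (not_le.2 (hy s h0)))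
    (fun s h0 _ j hj => hv s h0 j (by rw [hj]; exact ⟨rfl, le_rfl⟩))
    (T' := []) (w' := []) .nil (by simp) (fun s h0 _ j hj => absurd hj (hv s h0 j)) .nil
    (by simp)
  rw [List.append_nil] at this
  refine this.exists_curve ?_ hk ?_ hww
  · rintro p (hp | ⟨s, h0, h1, rfl⟩)
    · linarith [hS p hp]
    · exact hy1 s h1
  · subst hww
    intro j hj
    obtain ⟨i, -, rfl⟩ := List.mem_map.1 hj
    exact i.2

/-! ### Curves winding around an interval of marked points -/

/-- The box with horizontal extent `[a, b]` and vertical extent `(1 - d, 1 + d]`, together with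
the point `(x, 1 - d)` of its lower side. -/
def box (a b d x : ℝ) : Set (ℝ × ℝ) :=
  {q | a ≤ q.1 ∧ q.1 ≤ b ∧ q.2 ≤ 1 + d ∧ (q = (x, 1 - d) ∨ 1 - d < q.2)}

/-- One turn: down below the box, sideways to `A`, up above the box, sideways to `B` across the rays
in `w'`, and down below everything. The two vertical strands at `A` and `B` lie outside the box, and
`B ∉ uIcc x A` keeps the last strand away from the lower horizontal one. -/
theorem Trace.wind {k : ℕ} {w : List ℕ} {a b d x : ℝ} (hd0 : 0 < d) (hd1 : d < 1)
    (hax : a ≤ x) (hxb : x ≤ b) (h : Trace k w (box a b d x) (x, 1 - d)) {A B : ℝ}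
    (hA : A < a ∨ b < A) (hB : B < a ∨ b < B) (hAB : B ∉ uIcc x A)
    (hA' : ∀ j : ℕ, A ≠ j + 1) (hB' : ∀ j : ℕ, B ≠ j + 1) {w' : List ℕ}
    (hw : A < B ∧ w'.Pairwise (· < ·) ∧ (∀ j : ℕ, j ∈ w' ↔ A < (j : ℝ) + 1 ∧ (j : ℝ) + 1 < B) ∨
      B < A ∧ w'.Pairwise (· > ·) ∧ ∀ j : ℕ, j ∈ w' ↔ B < (j : ℝ) + 1 ∧ (j : ℝ) + 1 < A) :
    ∃ d', 0 < d' ∧ d' < 1 ∧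
      Trace k (w ++ w') (box (min a (min A B)) (max b (max A B)) d' B) (B, 1 - d') := by
  -- Two new levels `d < u < v < 1`: the turn runs at the heights `1 - u` and `1 + u` and ends at `1
  -- - v`, still above the base line.
  set u := d + (1 - d) / 3 with hu
  set v := d + 2 * (1 - d) / 3 with hv
  have hdu : d < u := by linarith
  have huv : u < v := by linarith
  have hv1 : v < 1 := by linarith
  clear_value u v
  have hAx : A ≠ x := by rintro rfl; rcases hA with h | h <;> linarith
  have hBx : B ≠ x := by rintro rfl; rcases hB with h | h <;> linarith
  have hBA : B ≠ A := by rintro rfl; exact hAB right_mem_uIcc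
  rw [mem_uIcc] at hAB
  have t1 := h.vertical (y' := 1 - u) (by linarith)
    (by
      rintro z hz hzy ⟨-, -, -, h4⟩
      rw [mem_uIcc] at hz
      have : z < 1 - d := lt_of_le_of_ne (by rcases hz with h | h <;> linarith) hzy
      rcases h4 with h4 | h4
      · exact hzy (congrArg Prod.snd h4)
      · simp only at h4; linarith)
    (.inr fun z hz _ => by rw [mem_uIcc] at hz; rcases hz with h | h <;> linarith)
  have t2 := t1.horizontal_below (x' := A) hAx
    (by
      rintro z - hzx (⟨-, -, -, h4⟩ | ⟨h1, -⟩)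
      · rcases h4 with h4 | h4
        · have := congrArg Prod.snd h4
          simp only at this; linarith
        · simp only at h4; linarith
      · exact hzx h1)
    (by linarith)
  have t3 := t2.vertical (y' := 1 + u) (by linarith)
    (by
      rintro z - hzy ((⟨h1, h2, -, -⟩ | ⟨h1, -⟩) | ⟨-, h1⟩)
      · simp only at h1 h2; rcases hA with h | h <;> linarith
      · exact hAx h1
      · exact hzy h1)
    (.inl hA')
  have hS4 : ∀ z ∈ uIcc A B, z ≠ A → (z, 1 + u) ∉ ((box a b d x ∪
      {p | p.1 = x ∧ p.2 ∈ uIcc (1 - d) (1 - u)}) ∪ {p | p.1 ∈ uIcc x A ∧ p.2 = 1 - u}) ∪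
      {p | p.1 = A ∧ p.2 ∈ uIcc (1 - u) (1 + u)} := by
    rintro z - hzy (((⟨-, -, h1, -⟩ | ⟨-, h1⟩) | ⟨-, h1⟩) | ⟨h1, -⟩)
    · simp only at h1; linarith
    · rw [mem_uIcc] at h1; simp only at h1; rcases h1 with h | h <;> linarith
    · simp only at h1; linarith
    · exact hzy h1
  have t4 := hw.elim
    (fun h1 => t3.horizontal_right h1.1 hS4 (by linarith) hB' h1.2.1 h1.2.2)
    (fun h1 => t3.horizontal_left h1.1 hS4 (by linarith) hB' h1.2.1 h1.2.2)
  have t5 := t4.vertical (y' := 1 - v) (by linarith)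
    (by
      rintro z - hzy ((((⟨h1, h2, -, -⟩ | ⟨h1, -⟩) | ⟨h1, -⟩) | ⟨h1, -⟩) | ⟨-, h1⟩)
      · simp only at h1 h2; rcases hB with h | h <;> linarith
      · exact hBx h1
      · exact hAB (mem_uIcc.1 h1)
      · exact hBA h1
      · exact hzy h1)
    (.inl hB')
  refine ⟨v, by linarith, hv1, t5.mono ?_⟩
  have m1 : min a (min A B) ≤ a := min_le_left _ _
  have m2 : min a (min A B) ≤ A := (min_le_right _ _).trans (min_le_left _ _)
  have m3 : min a (min A B) ≤ B := (min_le_right _ _).trans (min_le_right _ _)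
  have m4 : b ≤ max b (max A B) := le_max_left _ _
  have m5 : A ≤ max b (max A B) := (le_max_left _ _).trans (le_max_right _ _)
  have m6 : B ≤ max b (max A B) := (le_max_right _ _).trans (le_max_right _ _)
  rintro ⟨p1, p2⟩ (((((⟨h1, h2, h3, h4⟩ | ⟨h1, h2⟩) | ⟨h1, h2⟩) | ⟨h1, h2⟩) | ⟨h1, h2⟩) | ⟨h1, h2⟩)
  · refine ⟨m1.trans h1, h2.trans m4, by simp only at h3 ⊢; linarith, .inr ?_⟩
    rcases h4 with h4 | h4
    · have := congrArg Prod.snd h4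
      simp only at this ⊢; linarith
    · simp only at h4 ⊢; linarith
  · rw [mem_uIcc] at h2
    simp only at h1 h2
    subst h1
    refine ⟨m1.trans hax, hxb.trans m4, ?_, .inr ?_⟩ <;> simp only <;>
      rcases h2 with h | h <;> linarith
  · rw [mem_uIcc] at h1
    simp only at h1 h2
    subst h2
    refine ⟨?_, ?_, ?_, .inr ?_⟩ <;> simp only <;> rcases h1 with h | h <;> linarith
  · rw [mem_uIcc] at h2
    simp only at h1 h2
    subst h1
    refine ⟨m2, m5, ?_, .inr ?_⟩ <;> simp only <;> rcases h2 with h | h <;> linarith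
  · rw [mem_uIcc] at h1
    simp only at h1 h2
    subst h2
    refine ⟨?_, ?_, ?_, .inr ?_⟩ <;> simp only <;> rcases h1 with h | h <;> linarith
  · rw [mem_uIcc] at h2
    simp only at h1 h2
    subst h1
    refine ⟨m3, m6, ?_, ?_⟩
    · simp only; rcases h2 with h | h <;> linarith
    · rcases eq_or_ne p2 (1 - v) with rfl | hne
      · exact .inl rfl
      · right
        simp only
        have : 1 - v ≤ p2 := by rcases h2 with h | h <;> linarith
        exact lt_of_le_of_ne this hne.symm

/-- A trace which so far has only used the marked points with indices in `[l, r)`, and whose end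
point lies outside. -/
def Wound (l r k : ℕ) (w : List ℕ) : Prop :=
  ∃ a b d x : ℝ, l < a ∧ a ≤ x ∧ x ≤ b ∧ b < r + 1 ∧ 0 < d ∧ d < 1 ∧
    Trace k w (box a b d x) (x, 1 - d)

namespace Wound

variable {l r k : ℕ} {w : List ℕ}

theorem start (k : ℕ) : Wound k (k + 1) k [] := by
  refine ⟨k + 1, k + 1, 1 / 2, k + 1, by linarith, le_rfl, le_rfl, by push_cast; linarith,
    by norm_num, by norm_num, ?_⟩
  refine ((Trace.start k).vertical (x := (k : ℝ) + 1) (y := 1) (y' := 1 - 1 / 2) (by norm_num)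
    ?_ (.inr ?_)).mono ?_
  · intro z _ hz h
    exact hz (congrArg Prod.snd h)
  · intro z hz hz1
    rw [mem_uIcc] at hz
    exact lt_of_le_of_ne (by rcases hz with h | h <;> linarith) hz1
  · rintro ⟨p1, p2⟩ (h | ⟨h1, h2⟩)
    · obtain ⟨rfl, rfl⟩ := Prod.mk.inj h
      exact ⟨le_rfl, le_rfl, by norm_num, .inr (by norm_num)⟩
    · rw [mem_uIcc] at h2
      simp only at h1 h2
      subst h1
      refine ⟨le_rfl, le_rfl, ?_, ?_⟩
      · simp only; rcases h2 with h | h <;> linarith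
      · rcases eq_or_ne p2 (1 - 1 / 2) with rfl | hne
        · exact .inl rfl
        · right
          simp only
          have : 1 - 1 / 2 ≤ p2 := by rcases h2 with h | h <;> linarith
          exact lt_of_le_of_ne this hne.symm

theorem enlarge (h : Wound l r k w) {l' r' : ℕ} (hl : l' ≤ l) (hr : r ≤ r') : Wound l' r' k w := by
  obtain ⟨a, b, d, x, h1, h2, h3, h4, h5⟩ := h
  have : (l' : ℝ) ≤ l := by exact_mod_cast hl
  have : (r : ℝ) ≤ r' := by exact_mod_cast hr
  exact ⟨a, b, d, x, by linarith, h2, h3, by linarith, h5⟩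

theorem ne_of_between {m : ℕ} {x : ℝ} (h0 : m < x) (h1 : x < m + 1) (j : ℕ) : x ≠ j + 1 := by
  rintro rfl
  have h2 : m < j + 1 := by exact_mod_cast h0
  have h3 : j + 1 < m + 1 := by exact_mod_cast h1
  omega

/-- The abscissae depend on the sides `a`, `b` of a box that is only known to exist, hence are given
as functions. Lying strictly between consecutive integers they avoid all rays; the two alternatives
are a final run to the right and one to the left. -/
theorem wind (h : Wound l r k w) {A B : ℝ → ℝ → ℝ}
    (hAB : ∀ a b : ℝ, l < a → a ≤ b → b < r + 1 →
      (∃ m : ℕ, m < A a b ∧ A a b < m + 1) ∧ (∃ m : ℕ, m < B a b ∧ B a b < m + 1) ∧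
      ((A a b < a ∨ b < A a b) ∧ A a b < B a b ∧ b < B a b ∨
        (A a b < a ∨ b < A a b) ∧ B a b < A a b ∧ B a b < a)) {w' : List ℕ} {l' r' : ℕ}
    (hl : l' ≤ l) (hr : r ≤ r')
    (hlr : ∀ a b : ℝ, l < a → a ≤ b → b < r + 1 →
      l' < A a b ∧ l' < B a b ∧ A a b < r' + 1 ∧ B a b < r' + 1)
    (hw : ∀ a b : ℝ, l < a → a ≤ b → b < r + 1 →
      A a b < B a b ∧ w'.Pairwise (· < ·) ∧
        (∀ j : ℕ, j ∈ w' ↔ A a b < (j : ℝ) + 1 ∧ (j : ℝ) + 1 < B a b) ∨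
      B a b < A a b ∧ w'.Pairwise (· > ·) ∧
        ∀ j : ℕ, j ∈ w' ↔ B a b < (j : ℝ) + 1 ∧ (j : ℝ) + 1 < A a b) :
    Wound l' r' k (w ++ w') := by
  obtain ⟨a, b, d, x, h1, h2, h3, h4, h5, h6, t⟩ := h
  specialize hAB a b h1 (h2.trans h3) h4
  specialize hw a b h1 (h2.trans h3) h4
  specialize hlr a b h1 (h2.trans h3) h4
  generalize A a b = A at *
  generalize B a b = B at *
  obtain ⟨⟨m, hm, hm'⟩, ⟨m', hm2, hm2'⟩, hc⟩ := hAB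
  obtain ⟨d', hd0, hd1, t'⟩ := t.wind h5 h6 h2 h3 (A := A) (B := B)
    (by rcases hc with h | h <;> exact h.1)
    (by rcases hc with h | h; exacts [.inr h.2.2, .inl h.2.2])
    (by
      rw [mem_uIcc]
      rcases hc with ⟨-, h, h'⟩ | ⟨-, h, h'⟩ <;> rintro (⟨h7, h8⟩ | ⟨h7, h8⟩) <;> linarith)
    (ne_of_between hm hm') (ne_of_between hm2 hm2') hw
  have e1 : (l' : ℝ) ≤ l := by exact_mod_cast hl
  have e2 : (r : ℝ) ≤ r' := by exact_mod_cast hr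
  refine ⟨_, _, d', B, ?_, ?_, ?_, ?_, hd0, hd1, t'⟩
  · exact lt_min (by linarith) (lt_min hlr.1 hlr.2.1)
  · exact (min_le_right _ _).trans (min_le_right _ _)
  · exact (le_max_right _ _).trans (le_max_right _ _)
  · exact max_lt (by linarith) (max_lt hlr.2.2.1 hlr.2.2.2)

theorem exists_right (r : ℕ) (b : ℝ) (hb : b < r + 1) : ∃ x : ℝ, r < x ∧ b < x ∧ x < r + 1 := by
  obtain ⟨x, h1, h2⟩ := exists_between (max_lt (show (r : ℝ) < r + 1 by linarith) hb)
  exact ⟨x, (le_max_left _ _).trans_lt h1, (le_max_right _ _).trans_lt h1, h2⟩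

theorem exists_left (l : ℕ) (a : ℝ) (ha : l < a) : ∃ x : ℝ, l < x ∧ x < a ∧ x < l + 1 := by
  obtain ⟨x, h1, h2⟩ := exists_between (lt_min ha (show (l : ℝ) < l + 1 by linarith))
  exact ⟨x, h1, h2.trans_le (min_le_left _ _), h2.trans_le (min_le_right _ _)⟩

/-- Since `b < r + 1`, there is a gap between the box and the ray `r`. The path comes up in this
gap, crosses that single ray, and goes down halfway to the next one. -/
theorem pushRight (h : Wound l r k w) : Wound l (r + 1) k (w ++ [r]) := by
  choose! R hR using exists_right
  have hlr : ∀ a b : ℝ, l < a → a ≤ b → b < r + 1 → (l : ℝ) ≤ r := by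
    intro a b h1 h2 h3
    have : (l : ℝ) < (r + 1 : ℕ) := by push_cast; linarith
    exact_mod_cast Nat.lt_succ_iff.1 (by exact_mod_cast this)
  refine h.wind (A := fun a b => R r b) (B := fun a b => r + 1 + 1 / 2) ?_ le_rfl (by omega) ?_ ?_
  · intro a b h1 h2 h3
    obtain ⟨e1, e2, e3⟩ := hR r b h3
    exact ⟨⟨r, e1, e3⟩, ⟨r + 1, by push_cast; linarith, by push_cast; linarith⟩,
      .inl ⟨.inr e2, by linarith, by linarith⟩⟩
  · intro a b h1 h2 h3
    obtain ⟨e1, e2, e3⟩ := hR r b h3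
    have := hlr a b h1 h2 h3
    push_cast
    refine ⟨?_, ?_, ?_, ?_⟩ <;> linarith
  · intro a b h1 h2 h3
    obtain ⟨e1, e2, e3⟩ := hR r b h3
    refine .inl ⟨by linarith, by simp, fun j => ?_⟩
    rw [List.mem_singleton]
    constructor
    · rintro rfl; constructor <;> linarith
    · rintro ⟨h4, h5⟩
      have h6 : (r : ℝ) < (j + 1 : ℕ) := by push_cast; linarith
      have h7 : (j : ℝ) < (r + 1 : ℕ) := by push_cast; linarith
      have h6 : r < j + 1 := by exact_mod_cast h6
      have h7 : j < r + 1 := by exact_mod_cast h7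
      omega

theorem pushLeft (h : Wound (l + 1) r k w) : Wound l r k (w ++ [l]) := by
  choose! R hR using exists_left
  have hlr : ∀ a b : ℝ, (l + 1 : ℕ) < a → a ≤ b → b < r + 1 → (l : ℝ) + 1 ≤ r := by
    intro a b h1 h2 h3
    have : ((l + 1 : ℕ) : ℝ) < (r + 1 : ℕ) := by push_cast at h1 ⊢; linarith
    exact_mod_cast Nat.lt_succ_iff.1 (by exact_mod_cast this)
  refine h.wind (A := fun a b => R (l + 1) a) (B := fun a b => l + 1 / 2) ?_ (by omega) le_rfl ?_ ?_
  · intro a b h1 h2 h3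
    obtain ⟨e1, e2, e3⟩ := hR (l + 1) a h1
    have e1' := e1
    push_cast at e1'
    exact ⟨⟨l + 1, e1, e3⟩, ⟨l, by linarith, by linarith⟩,
      .inr ⟨.inl e2, by linarith, by linarith⟩⟩
  · intro a b h1 h2 h3
    obtain ⟨e1, e2, e3⟩ := hR (l + 1) a h1
    have := hlr a b h1 h2 h3
    push_cast at e1 e3
    refine ⟨?_, ?_, ?_, ?_⟩ <;> linarith
  · intro a b h1 h2 h3
    obtain ⟨e1, e2, e3⟩ := hR (l + 1) a h1
    push_cast at e1 e3
    refine .inr ⟨by linarith, by simp, fun j => ?_⟩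
    rw [List.mem_singleton]
    constructor
    · rintro rfl; constructor <;> linarith
    · rintro ⟨h4, h5⟩
      have h6 : (l : ℝ) < (j + 1 : ℕ) := by push_cast; linarith
      have h7 : (j : ℝ) < (l + 1 : ℕ) := by push_cast; linarith
      have h6 : l < j + 1 := by exact_mod_cast h6
      have h7 : j < l + 1 := by exact_mod_cast h7
      omega

theorem mem_pass {A B : ℝ} (h1 : l < A) (h2 : A < l + 1) (h3 : r < B) (h4 : B < r + 1)
    (hlr : l ≤ r) (j : ℕ) :
    j ∈ List.range' l (r - l) ↔ A < (j : ℝ) + 1 ∧ (j : ℝ) + 1 < B := by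
  rw [List.mem_range'_1]
  constructor
  · rintro ⟨h5, h6⟩
    have h7 : (l : ℝ) ≤ j := by exact_mod_cast h5
    have h8 : ((j + 1 : ℕ) : ℝ) ≤ r := by exact_mod_cast (by omega : j + 1 ≤ r)
    push_cast at h8
    constructor <;> linarith
  · rintro ⟨h5, h6⟩
    have h7 : (l : ℝ) < (j + 1 : ℕ) := by push_cast; linarith
    have h8 : ((j + 1 : ℕ) : ℝ) < (r + 1 : ℕ) := by push_cast; linarith
    have h7 : l < j + 1 := by exact_mod_cast h7
    have h8 : j + 1 < r + 1 := by exact_mod_cast h8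
    omega

theorem le_of_bounds {a b : ℝ} (h1 : (l : ℝ) < a) (h2 : a ≤ b) (h3 : b < r + 1) : l ≤ r := by
  have : (l : ℝ) < (r + 1 : ℕ) := by push_cast; linarith
  exact Nat.lt_succ_iff.1 (by exact_mod_cast this)

/-- The path comes up beside the box but within distance 1 of the position `l`, and goes down
likewise between `r` and `r + 1`, so exactly the rays of the enclosed interval lie in between. -/
theorem passRight (h : Wound l r k w) : Wound l r k (w ++ List.range' l (r - l)) := by
  choose! P hP using exists_left
  choose! R hR using exists_right
  have key : ∀ a b : ℝ, l < a → a ≤ b → b < r + 1 → (l < P l a ∧ P l a < a ∧ P l a < l + 1) ∧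
      (r < R r b ∧ b < R r b ∧ R r b < r + 1) ∧ l ≤ r := fun a b h1 h2 h3 =>
    ⟨hP l a h1, hR r b h3, le_of_bounds h1 h2 h3⟩
  refine h.wind (A := fun a b => P l a) (B := fun a b => R r b) ?_ le_rfl le_rfl ?_ ?_ <;>
    intro a b h1 h2 h3 <;> obtain ⟨⟨e1, e2, e3⟩, ⟨e4, e5, e6⟩, e7⟩ := key a b h1 h2 h3
  · exact ⟨⟨l, e1, e3⟩, ⟨r, e4, e6⟩, .inl ⟨.inl e2, by linarith, e5⟩⟩
  · have : (l : ℝ) ≤ r := by exact_mod_cast e7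
    refine ⟨?_, ?_, ?_, ?_⟩ <;> linarith
  · exact .inl ⟨by linarith, List.pairwise_lt_range', mem_pass e1 e3 e4 e6 e7⟩

theorem passLeft (h : Wound l r k w) : Wound l r k (w ++ (List.range' l (r - l)).reverse) := by
  choose! P hP using exists_left
  choose! R hR using exists_right
  have key : ∀ a b : ℝ, l < a → a ≤ b → b < r + 1 → (l < P l a ∧ P l a < a ∧ P l a < l + 1) ∧
      (r < R r b ∧ b < R r b ∧ R r b < r + 1) ∧ l ≤ r := fun a b h1 h2 h3 =>
    ⟨hP l a h1, hR r b h3, le_of_bounds h1 h2 h3⟩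
  refine h.wind (A := fun a b => R r b) (B := fun a b => P l a) ?_ le_rfl le_rfl ?_ ?_ <;>
    intro a b h1 h2 h3 <;> obtain ⟨⟨e1, e2, e3⟩, ⟨e4, e5, e6⟩, e7⟩ := key a b h1 h2 h3
  · exact ⟨⟨r, e4, e6⟩, ⟨l, e1, e3⟩, .inr ⟨.inr e5, by linarith, e2⟩⟩
  · have : (l : ℝ) ≤ r := by exact_mod_cast e7
    refine ⟨?_, ?_, ?_, ?_⟩ <;> linarith
  · refine .inr ⟨by linarith, ?_, fun j => ?_⟩
    · rw [List.pairwise_reverse]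
      exact List.pairwise_lt_range'
    · rw [List.mem_reverse]
      exact mem_pass e1 e3 e4 e6 e7 j

theorem exists_curve (h : Wound l r k w) {n : ℕ} (hk : k < n) {w' : List (Fin n)}
    (hww : w'.map Fin.val = w) :
    ∃ γ : AdmissibleCurve n, γ.NonSelfCrossing ∧ γ.HasWord ⟨k, hk⟩ w' := by
  obtain ⟨a, b, d, x, -, -, -, -, h5, h6, t⟩ := h
  refine t.exists_curve_of_lowest (by simp only; linarith) (by simp only; linarith) ?_ hk hww
  rintro p ⟨-, -, -, rfl | h⟩
  · exact le_rfl
  · exact h.le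

end Wound

/-! ### Words of vertices -/

section Words

set_option linter.unusedSectionVars false

variable {V : Type*} [Quiver V] [DecidableEq V] [Fintype V]

theorem simpleReflection_eq (i : V) (v : V → ℤ) :
    simpleReflection i v = v - coroot i v • simpleRoot i := by
  rw [simpleReflection, Module.reflection_apply]

theorem simpleReflection_of_coroot_eq_zero {i : V} {v : V → ℤ} (h : coroot i v = 0) :
    simpleReflection i v = v := by
  rw [simpleReflection_eq, h, zero_smul, sub_zero]

theorem simpleReflection_of_coroot_eq_neg_one {i : V} {v : V → ℤ} (h : coroot i v = -1) :
    simpleReflection i v = v + simpleRoot i := by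
  rw [simpleReflection_eq, h]; simp

theorem simpleRoot_pos (i : V) : (0 : V → ℤ) < simpleRoot i := by
  refine Pi.lt_def.2 ⟨fun j => ?_, i, by simp [simpleRoot]⟩
  rcases eq_or_ne j i with rfl | h <;> simp_all [simpleRoot]

theorem le_simpleReflection {i : V} {v : V → ℤ} (h : coroot i v ≤ 0) :
    v ≤ simpleReflection i v := by
  rw [simpleReflection_eq, sub_eq_add_neg, ← neg_smul]
  exact le_add_of_nonneg_right (smul_nonneg (by omega) (simpleRoot_pos i).le)

theorem lt_simpleReflection {i : V} {v : V → ℤ} (h : coroot i v < 0) :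
    v < simpleReflection i v := by
  rw [simpleReflection_eq, sub_eq_add_neg, ← neg_smul]
  exact lt_add_of_pos_right _ (smul_pos (by omega) (simpleRoot_pos i))

/-- The successive application of the simple reflections of a word. -/
noncomputable def act (v : V → ℤ) (w : List V) : V → ℤ :=
  w.foldl (fun v u => simpleReflection u v) v

@[simp] theorem act_nil (v : V → ℤ) : act v [] = v := rfl

@[simp] theorem act_cons (v : V → ℤ) (u : V) (w : List V) :
    act v (u :: w) = act (simpleReflection u v) w := rfl

theorem act_append (v : V → ℤ) (w w' : List V) : act v (w ++ w') = act (act v w) w' :=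
  List.foldl_append

/-- Consecutive vectors along a word are related by `R`. -/
def MonoAlong (R : (V → ℤ) → (V → ℤ) → Prop) : (V → ℤ) → List V → Prop
  | _, [] => True
  | v, u :: w => R v (simpleReflection u v) ∧ MonoAlong R (simpleReflection u v) w

theorem monoAlong_append {R : (V → ℤ) → (V → ℤ) → Prop} {v : V → ℤ} {w w' : List V} :
    MonoAlong R v (w ++ w') ↔ MonoAlong R v w ∧ MonoAlong R (act v w) w' := by
  induction w generalizing v with
  | nil => simp [MonoAlong]
  | cons u w ih => simp [MonoAlong, ih, and_assoc]

theorem MonoAlong.take {R : (V → ℤ) → (V → ℤ) → Prop} {v : V → ℤ} {w : List V}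
    (h : MonoAlong R v w) {i : ℕ} (hi : i < w.length) :
    R (act v (w.take i)) (act v (w.take (i + 1))) := by
  rw [← List.take_append_drop i w, monoAlong_append] at h
  have h2 := h.2
  rw [List.drop_eq_getElem_cons hi] at h2
  rw [List.take_succ_eq_append_getElem hi, act_append]
  exact h2.1

/-- Crossings of this kind are harmless for the weak order only; they are the reason why curves that
use passes need not be strictly increasing. -/
theorem fixed_along {v : V → ℤ} {w : List V} (h : ∀ x ∈ w, coroot x v = 0) :
    MonoAlong (· ≤ ·) v w ∧ act v w = v := by
  induction w with
  | nil => exact ⟨trivial, rfl⟩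
  | cons u w ih =>
    have h1 := simpleReflection_of_coroot_eq_zero (h u (by simp))
    have h2 := ih fun x hx => h x (by simp [hx])
    rw [MonoAlong, act_cons, h1]
    exact ⟨⟨le_rfl, h2.1⟩, h2.2⟩

/-- `Grows L k w`: starting at the vertex `k`, one can wind around an interval of marked points
labelled, from left to right, by the list `L` so that the rays listed in `w` are crossed. -/
inductive Grows : List V → V → List V → Prop
  | start (k : V) : Grows [k] k []
  | addRight {L k w} (u : V) : Grows L k w → Grows (L ++ [u]) k w
  | pushRight {L k w} (u : V) : Grows L k w → Grows (L ++ [u]) k (w ++ [u])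
  | addLeft {L k w} (u : V) : Grows L k w → Grows (u :: L) k w
  | pushLeft {L k w} (u : V) : Grows L k w → Grows (u :: L) k (w ++ [u])
  | passRight {L k w} : Grows L k w → Grows L k (w ++ L)
  | passLeft {L k w} : Grows L k w → Grows L k (w ++ L.reverse)

/-- If `f` numbers the vertices of `L` consecutively, the two ends of the list are the extreme
marked points of the interval, and each constructor becomes the winding move of the same kind. -/
theorem Grows.wound {L : List V} {k : V} {w : List V} (h : Grows L k w) (f : V → ℕ) (l : ℕ)
    (hf : L.map f = List.range' l L.length) : Wound l (l + L.length) (f k) (w.map f) := by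
  have snoc : ∀ {L : List V} {u : V} {l : ℕ},
      (L ++ [u]).map f = List.range' l (L ++ [u]).length →
        L.map f = List.range' l L.length ∧ f u = l + L.length := by
    intro L u l h
    rw [List.map_append, List.length_append, List.length_singleton, List.range'_1_concat,
      List.map_singleton] at h
    obtain ⟨h1, h2⟩ := List.append_inj h (by simp)
    exact ⟨h1, by simpa using h2⟩
  have cons : ∀ {L : List V} {u : V} {l : ℕ},
      (u :: L).map f = List.range' l (u :: L).length →
        L.map f = List.range' (l + 1) L.length ∧ f u = l := by
    intro L u l h
    rw [List.map_cons, List.length_cons, List.range'_succ, List.cons.injEq] at h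
    exact h.symm
  induction h generalizing l with
  | start k =>
    obtain rfl : f k = l := by simpa using hf
    exact Wound.start _
  | @addRight L k w u _ ih =>
    obtain ⟨h1, -⟩ := snoc hf
    exact (ih l h1).enlarge le_rfl (by simp)
  | @pushRight L k w u _ ih =>
    obtain ⟨h1, h2⟩ := snoc hf
    have := (ih l h1).pushRight
    rw [List.map_append, List.map_singleton, h2, List.length_append]
    exact this
  | @addLeft L k w u _ ih =>
    obtain ⟨h1, -⟩ := cons hf
    exact (ih _ h1).enlarge (by omega) (by simp only [List.length_cons]; omega)
  | @pushLeft L k w u _ ih =>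
    obtain ⟨h1, h2⟩ := cons hf
    have := (ih _ h1).pushLeft
    rw [List.map_append, List.map_singleton, h2, List.length_cons,
      show l + (L.length + 1) = l + 1 + L.length by omega]
    exact this
  | @passRight L k w _ ih =>
    have := (ih l hf).passRight
    rwa [Nat.add_sub_cancel_left, ← hf, ← List.map_append] at this
  | @passLeft L k w _ ih =>
    have := (ih l hf).passLeft
    rwa [Nat.add_sub_cancel_left, ← hf, ← List.map_reverse, ← List.map_append] at this

/-- No arrow of the quiver points from right to left in the list. -/
def Sorted (L : List V) : Prop := L.Pairwise fun x y => IsEmpty (y ⟶ x)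

/-- The vector `v` is obtained along a winding curve around the vertices in `L` whose successive
vectors are related by `R`. -/
def Reach (R : (V → ℤ) → (V → ℤ) → Prop) (L : List V) (v : V → ℤ) : Prop :=
  L.Nodup ∧ Sorted L ∧
    ∃ k w, Grows L k w ∧ MonoAlong R (simpleRoot k) w ∧ act (simpleRoot k) w = v

/-- The vector `v` is obtained from a non-self-crossing admissible curve whose successive
vectors are related by `R`. -/
def Realized (R : (V → ℤ) → (V → ℤ) → Prop) (n : ℕ) (v : V → ℤ) : Prop :=
  ∃ π ∈ compatiblePerms V n, ∃ γ : AdmissibleCurve n, γ.NonSelfCrossing ∧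
    ∃ k w, γ.HasWord k w ∧ (∀ i < w.length, R (partialRoot π k w i) (partialRoot π k w (i + 1))) ∧
      partialRoot π k w w.length = v

theorem Realized.imp {R R' : (V → ℤ) → (V → ℤ) → Prop} (hR : ∀ v v', R v v' → R' v v') {n : ℕ}
    {v : V → ℤ} (h : Realized R n v) : Realized R' n v := by
  obtain ⟨π, hπ, γ, hγ, k, w, hw, h1, h2⟩ := h
  exact ⟨π, hπ, γ, hγ, k, w, hw, fun i hi => hR _ _ (h1 i hi), h2⟩

theorem partialRoot_eq_act {n : ℕ} (π : Fin n ≃ V) (k : Fin n) (w : List (Fin n)) (i : ℕ) :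
    partialRoot π k w i = act (simpleRoot (π k)) ((w.map π).take i) := by
  rw [partialRoot, act, ← List.map_take, List.foldl_map]

theorem realized_of_word {R : (V → ℤ) → (V → ℤ) → Prop} {n : ℕ} {π : Fin n ≃ V}
    (hπ : π ∈ compatiblePerms V n) {k : V} {w : List V} {v : V → ℤ}
    (hR : MonoAlong R (simpleRoot k) w) (hv : act (simpleRoot k) w = v)
    (hγ : ∃ γ : AdmissibleCurve n, γ.NonSelfCrossing ∧ γ.HasWord (π.symm k) (w.map π.symm)) :
    Realized R n v := by
  obtain ⟨γ, h1, h2⟩ := hγ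
  have hw : (w.map π.symm).map π = w := by simp [Function.comp_def]
  refine ⟨π, hπ, γ, h1, _, _, h2, fun i hi => ?_, ?_⟩
  · rw [partialRoot_eq_act, partialRoot_eq_act, hw, Equiv.apply_symm_apply]
    exact hR.take (by simpa using hi)
  · rw [partialRoot_eq_act, hw, Equiv.apply_symm_apply, List.length_map, List.take_length, hv]

/-- The enumeration of the vertices given by a list containing each of them once. -/
def listEquiv (L : List V) (hn : L.Nodup) (hL : ∀ x, x ∈ L) : Fin L.length ≃ V :=
  List.Nodup.getEquivOfForallMemList L hn hL

theorem listEquiv_mem (L : List V) (hn : L.Nodup) (hL : ∀ x, x ∈ L) (hs : Sorted L) :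
    listEquiv L hn hL ∈ compatiblePerms V L.length := fun a b hab =>
  List.pairwise_iff_get.1 hs b a hab

theorem listEquiv_map (L : List V) (hn : L.Nodup) (hL : ∀ x, x ∈ L) :
    L.map (fun x => ((listEquiv L hn hL).symm x).val) = List.range' 0 L.length := by
  refine List.ext_getElem (by simp) fun i h1 h2 => ?_
  rw [List.getElem_map, List.getElem_range', one_mul, zero_add]
  rw [List.length_map] at h1
  have : L[i] = listEquiv L hn hL ⟨i, h1⟩ := rfl
  rw [this, Equiv.symm_apply_apply]

theorem length_eq_card {L : List V} (hn : L.Nodup) (hL : ∀ x, x ∈ L) :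
    L.length = Fintype.card V := by
  simpa using Fintype.card_congr (listEquiv L hn hL)

/-- Once all vertices are enclosed, the list is the required bijection: being sorted is precisely
compatibility with the arrows. -/
theorem Reach.realized {R : (V → ℤ) → (V → ℤ) → Prop} {L : List V} {v : V → ℤ}
    (h : Reach R L v) (hL : ∀ x, x ∈ L) {n : ℕ} (hn : Fintype.card V = n) : Realized R n v := by
  obtain ⟨h1, h2, k, w, h3, h4, h5⟩ := h
  obtain rfl : L.length = n := (length_eq_card h1 hL).trans hn
  refine realized_of_word (listEquiv_mem L h1 hL h2) h4 h5 ?_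
  have := h3.wound _ 0 (listEquiv_map L h1 hL)
  exact this.exists_curve (((listEquiv L h1 hL).symm k).2) (by simp [Function.comp_def])

/-! ### Moves -/

variable {R : (V → ℤ) → (V → ℤ) → Prop}

theorem Reach.start (k : V) : Reach R [k] (simpleRoot k) :=
  ⟨List.nodup_singleton k, List.pairwise_singleton _ _, k, [], .start k, trivial, rfl⟩

theorem Sorted.snoc {L : List V} (h : Sorted L) {u : V} (hu : ∀ x ∈ L, IsEmpty (u ⟶ x)) :
    Sorted (L ++ [u]) := by
  refine List.pairwise_append.2 ⟨h, List.pairwise_singleton _ _, fun x hx y hy => ?_⟩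
  rw [List.mem_singleton] at hy
  exact hy ▸ hu x hx

theorem Sorted.cons {L : List V} (h : Sorted L) {u : V} (hu : ∀ x ∈ L, IsEmpty (x ⟶ u)) :
    Sorted (u :: L) := List.pairwise_cons.2 ⟨hu, h⟩

theorem nodup_snoc {L : List V} (h : L.Nodup) {u : V} (hu : u ∉ L) : (L ++ [u]).Nodup :=
  List.nodup_append.2 ⟨h, List.nodup_singleton u, fun a ha b hb => by
    rw [List.mem_singleton] at hb; rintro rfl; exact hu (hb ▸ ha)⟩

theorem MonoAlong.snoc {v : V → ℤ} {w : List V} (h : MonoAlong R v w) {u : V}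
    (hR : R (act v w) (simpleReflection u (act v w))) : MonoAlong R v (w ++ [u]) :=
  monoAlong_append.2 ⟨h, hR, trivial⟩

variable {L : List V} {v : V → ℤ}

theorem Reach.addRight (h : Reach R L v) {u : V} (hu : u ∉ L) (hs : ∀ x ∈ L, IsEmpty (u ⟶ x)) :
    Reach R (L ++ [u]) v := by
  obtain ⟨h1, h2, k, w, h3, h4⟩ := h
  exact ⟨nodup_snoc h1 hu, h2.snoc hs, k, w, h3.addRight u, h4⟩

theorem Reach.addLeft (h : Reach R L v) {u : V} (hu : u ∉ L) (hs : ∀ x ∈ L, IsEmpty (x ⟶ u)) :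
    Reach R (u :: L) v := by
  obtain ⟨h1, h2, k, w, h3, h4⟩ := h
  exact ⟨List.nodup_cons.2 ⟨hu, h1⟩, h2.cons hs, k, w, h3.addLeft u, h4⟩

theorem Reach.pushRight (h : Reach R L v) {u : V} (hu : u ∉ L) (hs : ∀ x ∈ L, IsEmpty (u ⟶ x))
    (hR : R v (simpleReflection u v)) : Reach R (L ++ [u]) (simpleReflection u v) := by
  obtain ⟨h1, h2, k, w, h3, h4, rfl⟩ := h
  exact ⟨nodup_snoc h1 hu, h2.snoc hs, k, _, h3.pushRight u, h4.snoc hR, act_append _ _ _⟩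

theorem Reach.pushLeft (h : Reach R L v) {u : V} (hu : u ∉ L) (hs : ∀ x ∈ L, IsEmpty (x ⟶ u))
    (hR : R v (simpleReflection u v)) : Reach R (u :: L) (simpleReflection u v) := by
  obtain ⟨h1, h2, k, w, h3, h4, rfl⟩ := h
  exact ⟨List.nodup_cons.2 ⟨hu, h1⟩, h2.cons hs, k, _, h3.pushLeft u, h4.snoc hR,
    act_append _ _ _⟩

theorem Reach.pass (h : Reach R L v) {O : List V} (hO : O = L ∨ O = L.reverse)
    (hR : MonoAlong R v O) : Reach R L (act v O) := by
  obtain ⟨h1, h2, k, w, h3, h4, rfl⟩ := h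
  refine ⟨h1, h2, k, w ++ O, ?_, monoAlong_append.2 ⟨h4, hR⟩, act_append _ _ _⟩
  rcases hO with rfl | rfl
  · exact h3.passRight
  · exact h3.passLeft

/-! ### Arrows and the Cartan matrix -/

theorem isEmpty_or_isEmpty (hQ : IsAcyclicQuiver V) (x y : V) :
    IsEmpty (x ⟶ y) ∨ IsEmpty (y ⟶ x) := by
  by_contra! h
  obtain ⟨⟨f⟩, ⟨g⟩⟩ := h
  have := hQ x ((Quiver.Path.nil.cons f).cons g)
  simp at this

/-- The entry records a difference of numbers of arrows. Acyclicity makes one of the two numbers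
zero, so nothing can cancel; finiteness excludes that the other one is zero because `Nat.card`
vanishes on infinite types. -/
theorem isEmpty_of_cartan_eq_zero [∀ i j : V, Finite (i ⟶ j)] (hQ : IsAcyclicQuiver V) {x y : V}
    (h : cartan x y = 0) : IsEmpty (x ⟶ y) ∧ IsEmpty (y ⟶ x) := by
  have hxy : x ≠ y := by rintro rfl; simp [cartan] at h
  rw [cartan, if_neg hxy, neg_eq_zero, abs_eq_zero, exchangeMatrix, sub_eq_zero] at h
  have h : Nat.card (x ⟶ y) = Nat.card (y ⟶ x) := by exact_mod_cast h
  rcases isEmpty_or_isEmpty hQ x y with h1 | h1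
  · refine ⟨h1, ?_⟩
    rw [Nat.card_of_isEmpty, eq_comm, Nat.card_eq_zero] at h
    exact h.resolve_right (by simpa using (inferInstance : Finite (y ⟶ x)))
  · refine ⟨?_, h1⟩
    rw [Nat.card_of_isEmpty (α := (y ⟶ x)), Nat.card_eq_zero] at h
    exact h.resolve_right (by simpa using (inferInstance : Finite (x ⟶ y)))

theorem cartan_comm (x y : V) : cartan x y = cartan y x := by
  rw [cartan, cartan]
  rcases eq_or_ne x y with rfl | h
  · rfl
  · rw [if_neg h, if_neg h.symm, exchangeMatrix, exchangeMatrix, abs_sub_comm]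

theorem cartan_self (x : V) : cartan x x = 2 := by simp [cartan]

/-- Only `t` can be joined to `u`, and there are no arrows in both directions, so one end of `L` is
always open to `u`. -/
theorem side_of_leaf [∀ i j : V, Finite (i ⟶ j)] (hQ : IsAcyclicQuiver V) {u t : V}
    (h : ∀ x ∈ L, x ≠ t → cartan u x = 0) :
    (∀ x ∈ L, IsEmpty (u ⟶ x)) ∨ ∀ x ∈ L, IsEmpty (x ⟶ u) := by
  rcases isEmpty_or_isEmpty hQ u t with h1 | h1
  · left
    intro x hx
    rcases eq_or_ne x t with rfl | hxt
    · exact h1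
    · exact (isEmpty_of_cartan_eq_zero hQ (h x hx hxt)).1
  · right
    intro x hx
    rcases eq_or_ne x t with rfl | hxt
    · exact h1
    · exact (isEmpty_of_cartan_eq_zero hQ (h x hx hxt)).2

/-- A vertex which is adjacent to at most one vertex of `L` can be added on one of the two sides,
with or without crossing its ray. -/
theorem Reach.add_leaf [∀ i j : V, Finite (i ⟶ j)] (hQ : IsAcyclicQuiver V) (h : Reach R L v)
    {u t : V} (hu : u ∉ L) (ht : ∀ x ∈ L, x ≠ t → cartan u x = 0) :
    ∃ L', (L' = L ++ [u] ∨ L' = u :: L) ∧ Reach R L' v ∧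
      (R v (simpleReflection u v) → Reach R L' (simpleReflection u v)) := by
  rcases side_of_leaf hQ ht with h1 | h1
  · exact ⟨_, .inl rfl, h.addRight hu h1, h.pushRight hu h1⟩
  · exact ⟨_, .inr rfl, h.addLeft hu h1, h.pushLeft hu h1⟩

/-! ### The invariant form -/

theorem coroot_apply (i : V) (v : V → ℤ) : coroot i v = ∑ j, cartan i j * v j := rfl

/-- The invariant symmetric bilinear form on the root lattice. -/
noncomputable def form (v w : V → ℤ) : ℤ := ∑ i, v i * coroot i w

theorem form_comm (v w : V → ℤ) : form v w = form w v := by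
  simp only [form, coroot_apply, Finset.mul_sum]
  rw [Finset.sum_comm]
  refine Finset.sum_congr rfl fun i _ => Finset.sum_congr rfl fun j _ => ?_
  rw [cartan_comm]; ring

theorem form_add_right (v w w' : V → ℤ) : form v (w + w') = form v w + form v w' := by
  simp [form, mul_add, Finset.sum_add_distrib]

theorem form_smul_right (v w : V → ℤ) (c : ℤ) : form v (c • w) = c * form v w := by
  simp only [form, map_smul, smul_eq_mul, Finset.mul_sum]
  exact Finset.sum_congr rfl fun i _ => by ring

theorem form_simpleRoot_left (i : V) (v : V → ℤ) : form (simpleRoot i) v = coroot i v := by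
  simp [form, simpleRoot, Pi.single_apply]

theorem form_add_smul (v : V → ℤ) (i : V) (c : ℤ) :
    form (v + c • simpleRoot i) (v + c • simpleRoot i) =
      form v v + 2 * c * coroot i v + 2 * c ^ 2 := by
  have h1 : form v (simpleRoot i) = coroot i v := by rw [form_comm, form_simpleRoot_left]
  rw [form_add_right, form_comm (v + _) v, form_comm (v + _) (c • _), form_add_right,
    form_add_right, form_smul_right, h1, form_comm (c • _) v, form_smul_right, h1, form_smul_right,
    form_comm (c • _) (simpleRoot i), form_smul_right, form_simpleRoot_left,
    coroot_simpleRoot_self]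
  ring

theorem form_simpleReflection (i : V) (v : V → ℤ) :
    form (simpleReflection i v) (simpleReflection i v) = form v v := by
  rw [simpleReflection_eq, sub_eq_add_neg, ← neg_smul, form_add_smul]
  ring

/-- The generators of the Weyl group are involutions, so closure under simple reflections already
handles inverses. -/
theorem rootSystem_induction {P : (V → ℤ) → Prop} (h0 : ∀ i, P (simpleRoot i))
    (hs : ∀ i v, P v → P (simpleReflection i v)) {β : V → ℤ} (hβ : β ∈ rootSystem V) : P β := by
  obtain ⟨g, hg, i, rfl⟩ := hβ
  have hinv : ∀ i : V, (simpleReflection i)⁻¹ = simpleReflection i := fun i => by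
    rw [inv_eq_iff_mul_eq_one]
    ext1 v
    exact Module.involutive_reflection (coroot_simpleRoot_self i) v
  have : ∀ v, P v → P (g v) := by
    induction hg using Subgroup.closure_induction'' with
    | mem x hx => obtain ⟨j, rfl⟩ := hx; exact hs j
    | inv_mem x hx => obtain ⟨j, rfl⟩ := hx; rw [hinv]; exact hs j
    | one => exact fun v hv => hv
    | mul x y _ _ hx hy => exact fun v hv => hx _ (hy v hv)
  exact this _ (h0 i)

/-- The form is invariant under reflections. In types A and D this replaces any enumeration of the
roots. -/
theorem form_of_mem_rootSystem {β : V → ℤ} (hβ : β ∈ rootSystem V) : form β β = 2 := by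
  refine rootSystem_induction (P := fun β => form β β = 2) (fun i => ?_) (fun i v h => ?_) hβ
  · rw [form_simpleRoot_left, coroot_simpleRoot_self]
  · rw [form_simpleReflection, h]

/-! ### From realizability to the theorem -/

theorem act_mem_rootSystem (k : V) (w : List V) : act (simpleRoot k) w ∈ rootSystem V := by
  have : ∀ v ∈ rootSystem V, act v w ∈ rootSystem V := by
    induction w with
    | nil => exact fun v hv => hv
    | cons u w ih =>
      rintro v ⟨g, hg, i, rfl⟩
      exact ih _ ⟨simpleReflection u * g, mul_mem (Subgroup.subset_closure ⟨u, rfl⟩) hg, i, rfl⟩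
  exact this _ ⟨1, one_mem _, k, rfl⟩

theorem partialRoot_mem_positiveRoots {n : ℕ} {π : Fin n ≃ V} {k : Fin n} {w : List (Fin n)}
    (h : ∀ i < w.length, partialRoot π k w i ≤ partialRoot π k w (i + 1)) :
    partialRoot π k w w.length ∈ positiveRoots V := by
  refine ⟨by rw [partialRoot_eq_act]; exact act_mem_rootSystem _ _, ?_⟩
  have : ∀ i ≤ w.length, 0 < partialRoot π k w i := by
    intro i
    induction i with
    | zero => exact fun _ => by simpa [partialRoot] using simpleRoot_pos _
    | succ i ih => exact fun hi => (ih (by omega)).trans_le (h i (by omega))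
  exact this _ le_rfl

/-- Along a monotone curve the final vector is positive, so the sign normalization in `wordRoot`
never acts. A curve determines its word, which identifies the word in the monotonicity condition
with the one defining the root. -/
theorem iUnion_eq_positiveRoots {n : ℕ} {R : (V → ℤ) → (V → ℤ) → Prop}
    (hR : ∀ v v', R v v' → v ≤ v') (h : ∀ β ∈ positiveRoots V, Realized R n β) :
    (⋃ π ∈ compatiblePerms V n, {β : V → ℤ | ∃ γ : AdmissibleCurve n,
      (γ.NonSelfCrossing ∧ ∃ k w, γ.HasWord k w ∧
        ∀ i < w.length, R (partialRoot π k w i) (partialRoot π k w (i + 1))) ∧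
          IsAssociatedRoot π γ β}) = positiveRoots V := by
  ext β
  simp only [mem_iUnion, exists_prop]
  constructor
  · rintro ⟨π, -, γ, ⟨-, k, w, hw, hmono⟩, k', w', hw', rfl⟩
    obtain ⟨rfl, rfl⟩ := hw.unique hw'
    have := partialRoot_mem_positiveRoots fun i hi => hR _ _ (hmono i hi)
    rw [wordRoot, if_pos this.2]
    exact this
  · intro hβ
    obtain ⟨π, hπ, γ, h1, k, w, h2, h3, h4⟩ := h β hβ
    refine ⟨π, hπ, γ, ⟨h1, k, w, h2, h3⟩, k, w, h2, ?_⟩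
    rw [wordRoot, h4, if_pos hβ.2]

end Words

/-! ### Growing a diagram along a chain of vertices; type A -/

section Chains

set_option linter.unusedSectionVars false

variable {V : Type*} [Quiver V] [DecidableEq V] [Fintype V]

/-- The vector `v` is reached by a winding curve around exactly the vertices in `B`. -/
def ReachOn (R : (V → ℤ) → (V → ℤ) → Prop) (B : Finset V) (v : V → ℤ) : Prop :=
  ∃ L, (∀ x, x ∈ L ↔ x ∈ B) ∧ Reach R L v

/-- The vertex `u` is attached to the set `B` by a single edge, at the vertex `t`. -/
structure IsLeaf (B : Finset V) (t u : V) : Prop where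
  mem : t ∈ B
  notMem : u ∉ B
  adj : cartan u t = -1
  eq_zero : ∀ x ∈ B, x ≠ t → cartan u x = 0

theorem coroot_of_leaf {B : Finset V} {t u : V} (h : IsLeaf B t u) {v : V → ℤ}
    (hv : ∀ x ∉ B, v x = 0) : coroot u v = -v t := by
  rw [coroot_apply, Finset.sum_eq_single t, h.adj]
  · ring
  · intro x _ hx
    by_cases hxB : x ∈ B
    · rw [h.eq_zero x hxB hx, zero_mul]
    · rw [hv x hxB, mul_zero]
  · simp

theorem IsLeaf.ne {B : Finset V} {t u : V} (h : IsLeaf B t u) : t ≠ u := by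
  rintro rfl; exact h.notMem h.mem

/-- Removing the `u`-coordinate leaves a vector on `B`. Subtracting `v u ^ 2` from the last identity
produces the square `(v t - v u) ^ 2` beside `form v' v' - v' t ^ 2`. -/
theorem leaf_decomposition {B : Finset V} {t u : V} (h : IsLeaf B t u) {v : V → ℤ}
    (hv : ∀ x ∉ insert u B, v x = 0) (h0 : ∀ x, 0 ≤ v x) :
    ∃ v', (∀ x ∉ B, v' x = 0) ∧ (∀ x, 0 ≤ v' x) ∧ v' t = v t ∧ v = v' + v u • simpleRoot u ∧
      form v v = form v' v' - 2 * v u * v t + 2 * v u ^ 2 := by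
  have hval : ∀ x, (v - v u • simpleRoot u) x = if x = u then 0 else v x := by
    intro x
    rcases eq_or_ne x u with rfl | hx <;> simp_all [simpleRoot]
  have hsupp : ∀ x ∉ B, (v - v u • simpleRoot u) x = 0 := by
    intro x hx
    rw [hval]
    split_ifs with hxu
    · rfl
    · exact hv x (by simp [hx, hxu])
  have ht : (v - v u • simpleRoot u) t = v t := by rw [hval, if_neg h.ne]
  have hdec : v = (v - v u • simpleRoot u) + v u • simpleRoot u := by abel
  refine ⟨v - v u • simpleRoot u, hsupp, fun x => ?_, ht, hdec, ?_⟩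
  · rw [hval]; split_ifs; exacts [le_rfl, h0 x]
  · conv_lhs => rw [hdec]
    rw [form_add_smul, coroot_of_leaf h hsupp, ht]
    ring

/-- The properties of a set `B` of vertices with a distinguished vertex `t` from which a chain of
further vertices may emanate. The predicate `T` describes the vectors that are continued to highest
roots. -/
structure ChainEnd (R : (V → ℤ) → (V → ℤ) → Prop) (T : (V → ℤ) → Prop) (B : Finset V) (t : V) :
    Prop where
  mem : t ∈ B
  nonneg : ∀ v : V → ℤ, (∀ x ∉ B, v x = 0) → (∀ x, 0 ≤ v x) → 0 ≤ form v v - v t ^ 2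
  of_zero : ∀ v : V → ℤ, (∀ x ∉ B, v x = 0) → (∀ x, 0 ≤ v x) → form v v - v t ^ 2 = 0 →
    v t = 0 → v = 0
  of_one : ∀ v : V → ℤ, (∀ x ∉ B, v x = 0) → (∀ x, 0 ≤ v x) → form v v - v t ^ 2 = 0 → v t ≠ 1
  of_two : ∀ v : V → ℤ, (∀ x ∉ B, v x = 0) → (∀ x, 0 ≤ v x) → form v v - v t ^ 2 = 0 →
    v t = 2 → T v
  reach_one : ∀ v : V → ℤ, (∀ x ∉ B, v x = 0) → (∀ x, 0 ≤ v x) → form v v - v t ^ 2 = 1 →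
    v t = 1 → ReachOn R B v
  reach : ∀ v : V → ℤ, (∀ x ∉ B, v x = 0) → (∀ x, 0 ≤ v x) → form v v = 2 → ReachOn R B v
  complete : ∀ (L : List V) (v : V → ℤ), Reach R L v → (∀ x ∈ L, x ∉ B) →
    (∃ p, ∀ x ∈ L, x ≠ p → cartan t x = 0) →
    (∀ b ∈ B, b ≠ t → ∀ x ∈ L, cartan b x = 0) →
    ∃ L', (∀ x, x ∈ L' ↔ x ∈ L ∨ x ∈ B) ∧ Reach R L' v

variable [∀ i j : V, Finite (i ⟶ j)] (hQ : IsAcyclicQuiver V)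

include hQ in
theorem ReachOn.add_leaf {R : (V → ℤ) → (V → ℤ) → Prop} {B : Finset V} {t u : V} {v : V → ℤ}
    (h : ReachOn R B v) (hu : IsLeaf B t u) :
    ReachOn R (insert u B) v ∧
      (R v (simpleReflection u v) → ReachOn R (insert u B) (simpleReflection u v)) := by
  obtain ⟨L, hL, hr⟩ := h
  obtain ⟨L', h1, h2, h3⟩ := hr.add_leaf hQ (u := u) (t := t) (by rw [hL]; exact hu.notMem)
    (fun x hx => hu.eq_zero x ((hL x).1 hx))
  have hL' : ∀ x, x ∈ L' ↔ x ∈ insert u B := by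
    intro x
    rcases h1 with rfl | rfl <;> simp [hL, or_comm]
  exact ⟨⟨L', hL', h2⟩, fun h => ⟨L', hL', h3 h⟩⟩

include hQ in
-- All conditions pass from `t` to `u` because `form v v - v u ^ 2` is the corresponding quantity
-- for `v'` at `t` plus `(v' t - v u) ^ 2`. It vanishes only if both summands do, and it is 1 with
-- `v u = 1` in just three ways. The case `v' t = 2` is left to the hypothesis `hT`.
theorem ChainEnd.extend {R : (V → ℤ) → (V → ℤ) → Prop} (hR : ∀ v v', v < v' → R v v')
    {T T' : (V → ℤ) → Prop} {B : Finset V} {t u : V} (h : ChainEnd R T B t) (hu : IsLeaf B t u)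
    (hT : ∀ v, T v → ReachOn R (insert u B) (v + simpleRoot u))
    (hT' : ∀ v, T v → T' (v + (2 : ℤ) • simpleRoot u)) : ChainEnd R T' (insert u B) u := by
  have r1 : ∀ v : V → ℤ, (∀ x ∉ insert u B, v x = 0) → (∀ x, 0 ≤ v x) →
      form v v - v u ^ 2 = 1 → v u = 1 → ReachOn R (insert u B) v := by
    intro v hv h0 hf hvu
    obtain ⟨v', h1, h2, h3, h4, h5⟩ := leaf_decomposition hu hv h0
    have h6 := h.nonneg v' h1 h2
    rw [hvu] at h5 hf
    have hF : (form v' v' - v' t ^ 2) + (v' t - 1) ^ 2 = 1 := by rw [h3] at *; linarith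
    have ht0 := h2 t
    have ht2 : v' t ≤ 2 := by nlinarith
    rw [hvu, one_smul] at h4
    -- For 0 the vector is `α_u`, and the curve starts at `u`. For 1 the part on `B` is reached
    -- first and the ray of `u` is crossed last. For 2 the first summand is 0, so `of_two` applies.
    interval_cases hvt : v' t
    · have := h.of_zero v' h1 h2 (by rw [hvt]; linarith) hvt
      rw [h4, this, zero_add]
      obtain ⟨L', hL', hr⟩ := h.complete [u] (simpleRoot u) (.start u) (by simpa using hu.notMem)
        ⟨u, by simp⟩ (fun b hb hbt x hx => by
          rw [List.mem_singleton] at hx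
          rw [hx, cartan_comm]
          exact hu.eq_zero b hb hbt)
      exact ⟨L', fun x => by rw [hL']; simp, hr⟩
    · have hr := h.reach_one v' h1 h2 (by rw [hvt]; linarith) hvt
      have hc : coroot u v' = -1 := by rw [coroot_of_leaf hu h1, hvt]
      have := (hr.add_leaf hQ hu).2 (hR _ _ (lt_simpleReflection (by omega)))
      rwa [simpleReflection_of_coroot_eq_neg_one hc, ← h4] at this
    · rw [h4]
      exact hT v' (h.of_two v' h1 h2 (by rw [hvt]; linarith) hvt)
  have nn : ∀ v : V → ℤ, (∀ x ∉ insert u B, v x = 0) → (∀ x, 0 ≤ v x) →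
      0 ≤ form v v - v u ^ 2 := by
    intro v hv h0
    obtain ⟨v', h1, h2, h3, h4, h5⟩ := leaf_decomposition hu hv h0
    have := h.nonneg v' h1 h2
    rw [h3] at this
    nlinarith [sq_nonneg (v t - v u)]
  have zero_iff : ∀ v : V → ℤ, (∀ x ∉ insert u B, v x = 0) → (∀ x, 0 ≤ v x) →
      form v v - v u ^ 2 = 0 → ∃ v', (∀ x ∉ B, v' x = 0) ∧ (∀ x, 0 ≤ v' x) ∧
        form v' v' - v' t ^ 2 = 0 ∧ v' t = v u ∧ v = v' + v u • simpleRoot u := by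
    intro v hv h0 hf
    obtain ⟨v', h1, h2, h3, h4, h5⟩ := leaf_decomposition hu hv h0
    have h6 := h.nonneg v' h1 h2
    have hF : (form v' v' - v' t ^ 2) + (v' t - v u) ^ 2 = 0 := by rw [h3] at *; linarith
    have h7 : (v' t - v u) ^ 2 = 0 := by nlinarith [sq_nonneg (v' t - v u)]
    have h8 := pow_eq_zero_iff (two_ne_zero) |>.1 h7
    exact ⟨v', h1, h2, by linarith, by linarith, h4⟩
  refine ⟨Finset.mem_insert_self _ _, nn, ?_, ?_, ?_, r1, ?_, ?_⟩
  · intro v hv h0 hf hvu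
    obtain ⟨v', h1, h2, h3, h4, h5⟩ := zero_iff v hv h0 hf
    rw [h5, h.of_zero v' h1 h2 h3 (h4.trans hvu), hvu, zero_smul, add_zero]
  · intro v hv h0 hf hvu
    obtain ⟨v', h1, h2, h3, h4, h5⟩ := zero_iff v hv h0 hf
    exact h.of_one v' h1 h2 h3 (h4.trans hvu)
  · intro v hv h0 hf hvu
    obtain ⟨v', h1, h2, h3, h4, h5⟩ := zero_iff v hv h0 hf
    rw [h5, hvu]
    exact hT' v' (h.of_two v' h1 h2 h3 (h4.trans hvu))
  · intro v hv h0 hf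
    have h1 := nn v hv h0
    have h2 := h0 u
    -- Nonnegativity of `form v v - v u ^ 2` gives `v u ^ 2 ≤ 2`.
    have h3 : v u ≤ 1 := by nlinarith
    interval_cases hvu : v u
    · obtain ⟨v', h1, h2, h3, h4, h5⟩ := leaf_decomposition hu hv h0
      rw [hvu] at h4 h5
      rw [zero_smul, add_zero] at h4
      rw [h4]
      exact ((h.reach v' h1 h2 (by linarith)).add_leaf hQ hu).1
    · exact r1 v hv h0 (by rw [hvu]; linarith) hvu
  · rintro L v hr hL ⟨p, hp⟩ hb
    -- The vertex `u` is added next to `p`; from then on `u` is the only enclosed vertex to which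
    -- `t` can be adjacent.
    obtain ⟨L₁, h1, h2, -⟩ := hr.add_leaf hQ (u := u) (t := p)
      (fun hx => hL u hx (Finset.mem_insert_self _ _)) hp
    have hL₁ : ∀ x, x ∈ L₁ ↔ x = u ∨ x ∈ L := by
      intro x
      rcases h1 with rfl | rfl <;> simp [or_comm]
    obtain ⟨L', h3, h4⟩ := h.complete L₁ v h2
      (by
        intro x hx
        rcases (hL₁ x).1 hx with rfl | hx
        · exact hu.notMem
        · exact fun hxB => hL x hx (Finset.mem_insert_of_mem hxB))
      ⟨u, fun x hx hxu => hb t (Finset.mem_insert_of_mem h.mem) hu.ne x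
        (((hL₁ x).1 hx).resolve_left hxu)⟩
      (by
        intro b hbB hbt x hx
        rcases (hL₁ x).1 hx with rfl | hx
        · rw [cartan_comm]; exact hu.eq_zero b hbB hbt
        · refine hb b (Finset.mem_insert_of_mem hbB) ?_ x hx
          rintro rfl; exact hu.notMem hbB)
    refine ⟨L', fun x => ?_, h4⟩
    rw [h3, hL₁, Finset.mem_insert]
    tauto

include hQ in
-- Here `form v v - v t ^ 2 = v t ^ 2`, so it vanishes only for `v t = 0`. The case of coefficient 2
-- is void and remains so along the chain.
theorem chainEnd_singleton {R : (V → ℤ) → (V → ℤ) → Prop} (t : V) :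
    ChainEnd R (fun _ => False) {t} t := by
  have hform : ∀ v : V → ℤ, (∀ x ∉ ({t} : Finset V), v x = 0) →
      v = v t • simpleRoot t ∧ form v v = 2 * v t ^ 2 := by
    intro v hv
    have h1 : v = v t • simpleRoot t := by
      ext x
      rcases eq_or_ne x t with rfl | hx
      · simp [simpleRoot]
      · simpa [simpleRoot, hx] using hv x (by simpa using hx)
    refine ⟨h1, ?_⟩
    have := form_add_smul 0 t (v t)
    rw [zero_add, ← h1] at this
    rw [this]
    simp [form]
  have hreach : ∀ v : V → ℤ, (∀ x ∉ ({t} : Finset V), v x = 0) → v t = 1 →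
      ReachOn R {t} v := by
    intro v hv h1
    rw [(hform v hv).1, h1, one_smul]
    exact ⟨[t], by simp, .start t⟩
  refine ⟨by simp, ?_, ?_, ?_, ?_, ?_, ?_, ?_⟩
  · intro v hv _
    rw [(hform v hv).2]; nlinarith [sq_nonneg (v t)]
  · intro v hv _ _ h
    rw [(hform v hv).1, h, zero_smul]
  · intro v hv _ hf h
    rw [(hform v hv).2, h] at hf; norm_num at hf
  · intro v hv _ hf h
    rw [(hform v hv).2, h] at hf; norm_num at hf
  · intro v hv _ _ h
    exact hreach v hv h
  · intro v hv h0 hf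
    rw [(hform v hv).2] at hf
    have := h0 t
    exact hreach v hv (by nlinarith)
  · rintro L v hr hL ⟨p, hp⟩ -
    obtain ⟨L', h1, h2, -⟩ := hr.add_leaf hQ (u := t) (t := p) (fun hx => hL t hx (by simp)) hp
    refine ⟨L', fun x => ?_, h2⟩
    rcases h1 with rfl | rfl <;> simp [or_comm]

include hQ in
theorem realized_typeA (hA : IsTypeA V) {n : ℕ} (hn : Fintype.card V = n) {β : V → ℤ}
    (hβ : β ∈ positiveRoots V) : Realized (· < ·) n β := by
  obtain ⟨m, hm, e, he⟩ := hA
  -- The chain starts at vertex 0 of the diagram; with no vector satisfying the predicate `False`,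
  -- the hypotheses about coefficient 2 hold vacuously at each stage.
  have key : ∀ l (hl : l < m), ChainEnd (V := V) (· < ·) (fun _ => False)
      (Finset.univ.filter fun x => (e x : ℕ) ≤ l) (e.symm ⟨l, hl⟩) := by
    intro l
    induction l with
    | zero =>
      intro hl
      convert chainEnd_singleton hQ (e.symm ⟨0, hl⟩)
      ext x
      simp [Equiv.eq_symm_apply, Fin.ext_iff]
    | succ l ih =>
      intro hl
      have := (ih (by omega)).extend hQ (fun _ _ h => h) (T' := fun _ => False)
        (u := e.symm ⟨l + 1, hl⟩) ⟨by simp, by simp, by simp [he, CartanMatrix.A], ?_⟩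
        (fun _ h => h.elim) (fun _ h => h)
      · convert this using 1
        ext x
        simp [Equiv.eq_symm_apply, Fin.ext_iff]
        omega
      · intro x hx hxt
        simp only [Finset.mem_filter, Finset.mem_univ, true_and] at hx
        rw [Ne, Equiv.eq_symm_apply, Fin.ext_iff] at hxt
        simp only at hxt
        rw [he, CartanMatrix.A, Matrix.of_apply, Equiv.apply_symm_apply, if_neg, if_neg]
        · simp only; omega
        · rw [Fin.ext_iff]; simp only; omega
  obtain ⟨L, hL, hr⟩ := (key (m - 1) (by omega)).reach β
    (fun x hx => absurd (by simp; omega) hx) (fun x => hβ.2.le x)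
    (form_of_mem_rootSystem hβ.1)
  exact hr.realized (fun x => (hL x).2 (by simp; omega)) hn

end Chains

/-! ### Type D: stars, highest roots, and the branch vertex -/

section TypeD

set_option linter.unusedSectionVars false

variable {V : Type*} [Quiver V] [DecidableEq V] [Fintype V]

/-! ### Stars -/

/-- The sum of the simple roots in a list. -/
def sumRoots (l : List V) : V → ℤ := (l.map simpleRoot).sum

theorem sumRoots_cons (x : V) (l : List V) : sumRoots (x :: l) = simpleRoot x + sumRoots l := by
  simp [sumRoots]

theorem sumRoots_append (l l' : List V) : sumRoots (l ++ l') = sumRoots l + sumRoots l' := by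
  simp [sumRoots]

theorem sumRoots_perm {l l' : List V} (h : l.Perm l') : sumRoots l = sumRoots l' :=
  (h.map simpleRoot).sum_eq

theorem coroot_sumRoots {u : V} {l : List V} {a : ℤ} (h : ∀ x ∈ l, cartan u x = a) :
    coroot u (sumRoots l) = l.length * a := by
  induction l with
  | nil => simp [sumRoots]
  | cons x l ih =>
    rw [sumRoots_cons, map_add, coroot_simpleRoot, h x (by simp),
      ih fun y hy => h y (by simp [hy]), List.length_cons]
    push_cast; ring

variable [∀ i j : V, Finite (i ⟶ j)] (hQ : IsAcyclicQuiver V)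

include hQ in
/-- Leaves attached to a vertex `c` can be distributed on both sides of `c`, such that exactly those
on the left are crossed. -/
theorem exists_star (c : V) (l : List V) (hl : l.Nodup) (hc : ∀ x ∈ l, cartan x c = -1)
    (hll : ∀ x ∈ l, ∀ y ∈ l, x ≠ y → cartan x y = 0) :
    ∃ I O : List V, (I ++ O).Perm l ∧
      Reach (· ≤ ·) (I ++ c :: O) (simpleRoot c + sumRoots I) := by
  induction l with
  | nil => exact ⟨[], [], .refl _, by simpa [sumRoots] using Reach.start c⟩
  | cons z l ih =>
    have hzl : z ∉ l := (List.nodup_cons.1 hl).1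
    obtain ⟨I, O, h1, h2⟩ := ih (List.nodup_cons.1 hl).2 (fun x hx => hc x (by simp [hx]))
      (fun x hx y hy => hll x (by simp [hx]) y (by simp [hy]))
    have hmem : ∀ x, x ∈ I ++ c :: O → x = c ∨ x ∈ l := by
      intro x hx
      have := h1.mem_iff (a := x)
      simp only [List.mem_append, List.mem_cons] at hx this
      tauto
    have hzc : z ≠ c := by
      rintro rfl
      have := hc z (by simp)
      rw [cartan_self] at this
      norm_num at this
    have hzn : z ∉ I ++ c :: O := fun h => (hmem z h).elim hzc hzl
    have hz0 : ∀ x ∈ l, cartan z x = 0 := fun x hx =>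
      hll z (by simp) x (by simp [hx]) (by rintro rfl; exact hzl hx)
    have hco : coroot z (simpleRoot c + sumRoots I) = -1 := by
      rw [map_add, coroot_simpleRoot, hc z (by simp),
        coroot_sumRoots (a := 0) fun x hx => hz0 x (h1.mem_iff.1 (by simp [hx]))]
      simp
    have hside : ∀ x ∈ l, IsEmpty (z ⟶ x) ∧ IsEmpty (x ⟶ z) := fun x hx =>
      isEmpty_of_cartan_eq_zero hQ (hz0 x hx)
    -- Leaves forced to the right stay uncrossed for now. A later pass from right to left crosses
    -- them before `c`, so that every leaf is present when `c` is crossed again.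
    rcases isEmpty_or_isEmpty hQ z c with h | h
    · refine ⟨I, O ++ [z], ?_, ?_⟩
      · rw [← List.append_assoc]
        exact (List.perm_append_singleton z _).trans (h1.cons z)
      · have := h2.addRight hzn fun x hx => by
          rcases hmem x hx with rfl | hx
          exacts [h, (hside x hx).1]
        simpa using this
    · refine ⟨z :: I, O, h1.cons z, ?_⟩
      have := h2.pushLeft hzn (fun x hx => by
          rcases hmem x hx with rfl | hx
          exacts [h, (hside x hx).2]) (le_simpleReflection (by omega))
      rw [simpleReflection_of_coroot_eq_neg_one hco] at this
      rw [sumRoots_cons, add_left_comm, add_comm]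
      exact this

theorem add_along {v : V → ℤ} {w : List V} (hw : w.Nodup) (h : ∀ x ∈ w, coroot x v = -1)
    (h0 : ∀ x ∈ w, ∀ y ∈ w, x ≠ y → cartan x y = 0) :
    MonoAlong (· ≤ ·) v w ∧ act v w = v + sumRoots w := by
  induction w generalizing v with
  | nil => simp [MonoAlong, sumRoots]
  | cons u w ih =>
    have h1 := simpleReflection_of_coroot_eq_neg_one (h u (by simp))
    have h2 := ih (v := v + simpleRoot u) (List.nodup_cons.1 hw).2
      (fun x hx => by
        rw [map_add, h x (by simp [hx]), coroot_simpleRoot, h0 x (by simp [hx]) u (by simp)]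
        · rfl
        · rintro rfl; exact (List.nodup_cons.1 hw).1 hx)
      (fun x hx y hy => h0 x (by simp [hx]) y (by simp [hy]))
    refine ⟨⟨le_simpleReflection (by rw [h u (by simp)]; norm_num), ?_⟩, ?_⟩
    · rw [h1]; exact h2.1
    · rw [act_cons, h1, h2.2, sumRoots_cons, add_assoc]

include hQ in
/-- The highest root of a star with three leaves. -/
theorem reach_star {c : V} {l : List V} (hlen : l.length = 3) (hl : l.Nodup)
    (hc : ∀ x ∈ l, cartan x c = -1) (hll : ∀ x ∈ l, ∀ y ∈ l, x ≠ y → cartan x y = 0) :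
    ∃ L : List V, (∀ x, x ∈ L ↔ x = c ∨ x ∈ l) ∧
      Reach (· ≤ ·) L ((2 : ℤ) • simpleRoot c + sumRoots l) := by
  obtain ⟨I, O, h1, h2⟩ := exists_star hQ c l hl hc hll
  have hmem : ∀ x, x ∈ I ∨ x ∈ O ↔ x ∈ l := fun x => by rw [← h1.mem_iff, List.mem_append]
  have hnodup := h1.nodup_iff.2 hl
  have hdisj : ∀ x ∈ O, ∀ y ∈ I, x ≠ y := fun x hx y hy => by
    have := List.disjoint_of_nodup_append hnodup hy
    rintro rfl; exact this hx
  have a1 := add_along (v := simpleRoot c + sumRoots I) (w := O.reverse)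
    (List.nodup_reverse.2 (List.nodup_append.1 hnodup).2.1)
    (fun x hx => by
      rw [List.mem_reverse] at hx
      rw [map_add, coroot_simpleRoot, hc x ((hmem x).1 (.inr hx)), coroot_sumRoots (a := 0)]
      · simp
      · exact fun y hy => hll x ((hmem x).1 (.inr hx)) y ((hmem y).1 (.inl hy)) (hdisj x hx y hy))
    (fun x hx y hy => hll x ((hmem x).1 (.inr (List.mem_reverse.1 hx))) y
      ((hmem y).1 (.inr (List.mem_reverse.1 hy))))
  have e1 : simpleRoot c + sumRoots I + sumRoots O.reverse = simpleRoot c + sumRoots l := by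
    rw [sumRoots_perm O.reverse_perm, add_assoc, ← sumRoots_append, sumRoots_perm h1]
  rw [e1] at a1
  -- The value is `2 - 3`; this is where exactly three leaves are needed.
  have c1 : coroot c (simpleRoot c + sumRoots l) = -1 := by
    rw [map_add, coroot_simpleRoot_self, coroot_sumRoots (a := -1), hlen]
    · norm_num
    · exact fun x hx => by rw [cartan_comm, hc x hx]
  have e2 : simpleReflection c (simpleRoot c + sumRoots l) =
      (2 : ℤ) • simpleRoot c + sumRoots l := by
    rw [simpleReflection_of_coroot_eq_neg_one c1, two_smul]; abel
  -- A leaf on the left now pairs to `-2 + 2 = 0`, so the rest of the pass changes nothing.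
  have a2 := fixed_along (v := (2 : ℤ) • simpleRoot c + sumRoots l) (w := I.reverse)
    (fun x hx => by
      rw [List.mem_reverse] at hx
      have hxl := (hmem x).1 (.inl hx)
      rw [map_add, map_smul, coroot_simpleRoot, hc x hxl,
        sumRoots_perm (List.perm_cons_erase hxl), sumRoots_cons, map_add, coroot_simpleRoot_self,
        coroot_sumRoots (a := 0)]
      · simp
      · intro y hy
        exact hll x hxl y (List.mem_of_mem_erase hy)
          (by rintro rfl; exact (hl.not_mem_erase) hy))
  refine ⟨I ++ c :: O, fun x => ?_, ?_⟩
  · rw [← hmem]; simp only [List.mem_append, List.mem_cons]; tauto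
  · have hrev : (I ++ c :: O).reverse = O.reverse ++ c :: I.reverse := by simp
    have := h2.pass (O := O.reverse ++ c :: I.reverse) (.inr hrev.symm)
      (monoAlong_append.2 ⟨a1.1, by
        rw [a1.2, MonoAlong, e2]
        exact ⟨e2 ▸ le_simpleReflection (by omega), a2.1⟩⟩)
    rwa [act_append, a1.2, act_cons, e2, a2.2] at this

/-! ### Highest roots of type `D` -/

/-- For any further vertex `u` attached to `t`, the vector `top + α_u` is reached, and it pairs
like the highest root of a root system of type `D`. -/
def TopGood (B : Finset V) (t : V) (top : V → ℤ) : Prop :=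
  (∀ x ∉ B, top x = 0) ∧ ∀ u, IsLeaf B t u →
    ReachOn (· ≤ ·) (insert u B) (top + simpleRoot u) ∧
    coroot t (top + simpleRoot u) = 1 ∧ coroot u (top + simpleRoot u) = 0 ∧
    ∀ x ∈ B, x ≠ t → coroot x (top + simpleRoot u) = 0

/-- The direction of a pass can be chosen so that a given vertex is crossed before another one. -/
theorem exists_split {L : List V} (hL : L.Nodup) {a b : V} (ha : a ∈ L) (hb : b ∈ L) :
    ∃ O P Q : List V, (O = L ∨ O = L.reverse) ∧ O = P ++ a :: Q ∧ b ∉ P ∧ a ∉ P ∧ a ∉ Q := by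
  obtain ⟨P, Q, rfl⟩ := List.append_of_mem ha
  have h1 : a ∉ P ∧ a ∉ Q := by
    rw [List.nodup_append, List.nodup_cons] at hL
    exact ⟨fun h => hL.2.2 a h a (by simp) rfl, hL.2.1.1⟩
  by_cases hbP : b ∈ P
  · refine ⟨_, Q.reverse, P.reverse, .inr rfl, by simp, ?_, by simpa using h1.2, by simpa using h1.1⟩
    rw [List.mem_reverse]
    rw [List.nodup_append] at hL
    exact fun h => hL.2.2 b hbP b (by simp [h]) rfl
  · exact ⟨_, P, Q, .inl rfl, rfl, hbP, h1⟩

include hQ in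
-- The next highest root is `H' = H + α_z + α_u`. One pass over the enclosed vertices adds `α_u`,
-- while `α_z` is added either just before the pass or at its beginning, depending on the side of
-- `z`. All other crossings fix the vector.
theorem TopGood.extend {B : Finset V} {t u : V} {top : V → ℤ} (h : TopGood B t top)
    (hu : IsLeaf B t u) : TopGood (insert u B) u (top + (2 : ℤ) • simpleRoot u) := by
  have htop : ∀ x ≠ u, (simpleRoot u : V → ℤ) x = 0 := fun x hx => by simp [simpleRoot, hx]
  refine ⟨fun x hx => ?_, fun z hz => ?_⟩
  · rw [Finset.mem_insert, not_or] at hx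
    simp [h.1 x hx.2, htop x hx.1]
  obtain ⟨⟨L, hL, hr⟩, ht1, hu0, hB⟩ := h.2 u hu
  set H := top + simpleRoot u with hH
  set H' := top + (2 : ℤ) • simpleRoot u + simpleRoot z with hH'
  have eH' : H' = H + simpleRoot z + simpleRoot u := by rw [hH', hH, two_smul]; abel
  have ctz : cartan t z = 0 := by
    rw [cartan_comm]; exact hz.eq_zero t (Finset.mem_insert_of_mem hu.mem) hu.ne
  have cuz : cartan u z = -1 := by rw [cartan_comm]; exact hz.adj
  have ctu : cartan t u = -1 := by rw [cartan_comm]; exact hu.adj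
  have hzu : z ≠ u := hz.ne.symm
  have hzB : z ∉ B := fun hh => hz.notMem (Finset.mem_insert_of_mem hh)
  have cx : ∀ x ∈ B, x ≠ t → cartan x u = 0 ∧ cartan x z = 0 := fun x hx hxt => by
    refine ⟨by rw [cartan_comm]; exact hu.eq_zero x hx hxt, ?_⟩
    rw [cartan_comm]
    refine hz.eq_zero x (Finset.mem_insert_of_mem hx) ?_
    rintro rfl; exact hu.notMem hx
  have pz : coroot z H = -1 := by
    rw [coroot_of_leaf hz fun x hx => ?_]
    · simp [hH, h.1 u hu.notMem, simpleRoot]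
    · rw [Finset.mem_insert, not_or] at hx
      simp [hH, h.1 x hx.2, htop x hx.1]
  have fix1 : ∀ x ∈ insert u B, x ≠ u → x ≠ t → coroot x (H + simpleRoot z) = 0 := by
    intro x hx hxu hxt
    have hxB := (Finset.mem_insert.1 hx).resolve_left hxu
    rw [map_add, hB x hxB hxt, coroot_simpleRoot, (cx x hxB hxt).2, add_zero]
  have pu : coroot u (H + simpleRoot z) = -1 := by rw [map_add, hu0, coroot_simpleRoot, cuz]; rfl
  have pu' : coroot u H' = 1 := by rw [eH', map_add, pu, coroot_simpleRoot_self]; rfl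
  have pz' : coroot z H' = 0 := by
    rw [eH', map_add, map_add, pz, coroot_simpleRoot_self, coroot_simpleRoot, hz.adj]; rfl
  have fix2 : ∀ x ∈ insert u B, x ≠ u → coroot x H' = 0 := by
    intro x hx hxu
    have hxB := (Finset.mem_insert.1 hx).resolve_left hxu
    rcases eq_or_ne x t with rfl | hxt
    · rw [eH', map_add, map_add, ht1, coroot_simpleRoot, coroot_simpleRoot, ctz, ctu]; rfl
    · rw [eH', map_add, fix1 x hx hxu hxt, coroot_simpleRoot, (cx x hxB hxt).1, add_zero]
  refine ⟨?_, pu', pz', fix2⟩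
  -- The vertex `u` must precede `t`: before `α_u` is added, `t` pairs to 1 and its reflection would
  -- decrease the vector; afterwards it pairs to 0.
  obtain ⟨O, P, Q, hO, rfl, htP, huP, huQ⟩ := exists_split hr.1 ((hL u).2 (by simp))
    ((hL t).2 (by simp [hu.mem]))
  have hOL : ∀ x, x ∈ P ++ u :: Q ↔ x ∈ insert u B := by
    intro x
    rw [← hL]
    rcases hO with hO | hO <;> rw [hO]
    exact List.mem_reverse
  have ez := simpleReflection_of_coroot_eq_neg_one pz
  have eu := simpleReflection_of_coroot_eq_neg_one pu
  have f1 := fixed_along (v := H + simpleRoot z) (w := P) fun x hx =>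
    fix1 x ((hOL x).1 (by simp [hx])) (by rintro rfl; exact huP hx) (by rintro rfl; exact htP hx)
  have f2 := fixed_along (v := H') (w := Q) fun x hx =>
    fix2 x ((hOL x).1 (by simp [hx])) (by rintro rfl; exact huQ hx)
  have ez' := simpleReflection_of_coroot_eq_zero pz'
  have body : MonoAlong (· ≤ ·) (H + simpleRoot z) (P ++ u :: Q) ∧
      act (H + simpleRoot z) (P ++ u :: Q) = H' := by
    refine ⟨monoAlong_append.2 ⟨f1.1, ?_⟩, ?_⟩
    · rw [f1.2]
      exact ⟨le_simpleReflection (by omega), by rw [eu, ← eH']; exact f2.1⟩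
    · rw [act_append, f1.2, act_cons, eu, ← eH', f2.2]
  obtain ⟨L', hL', hr1, hr2⟩ := hr.add_leaf hQ (u := z) (t := u)
    (by rw [hL]; exact hz.notMem) (fun x hx => hz.eq_zero x ((hL x).1 hx))
  have hmem : ∀ x, x ∈ L' ↔ x ∈ insert z (insert u B) := by
    intro x
    rw [Finset.mem_insert, ← hL]
    rcases hL' with rfl | rfl <;> simp [or_comm]
  refine ⟨L', hmem, ?_⟩
  -- If `z` comes first in the direction of the pass, the pass itself adds `α_z`. If it comes last,
  -- its ray is crossed in advance, and the second crossing fixes `H'`.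
  have hcase : (z :: (P ++ u :: Q) = L' ∨ z :: (P ++ u :: Q) = L'.reverse) ∨
      (P ++ u :: Q ++ [z] = L' ∨ P ++ u :: Q ++ [z] = L'.reverse) := by
    rcases hO with hO | hO <;> rcases hL' with rfl | rfl <;> rw [hO] <;> simp
  rcases hcase with hc | hc
  · have := hr1.pass hc ⟨le_simpleReflection (by omega), by rw [ez]; exact body.1⟩
    rwa [act_cons, ez, body.2] at this
  · have hr2 := hr2 (le_simpleReflection (by omega))
    rw [ez] at hr2
    have := hr2.pass hc (monoAlong_append.2 ⟨body.1, by
      rw [body.2]; exact ⟨le_simpleReflection (by omega), trivial⟩⟩)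
    rwa [act_append, body.2, act_cons, ez', act_nil] at this

/-! ### The branch vertex of a diagram of type `D` -/

include hQ in
theorem topGood_star {c x y : V} (hxy : cartan x y = 0) (hx : cartan x c = -1)
    (hy : cartan y c = -1) :
    TopGood {y, x, c} c ((2 : ℤ) • simpleRoot c + simpleRoot x + simpleRoot y) := by
  have ne : ∀ {a b : V}, cartan a b ≠ 2 → a ≠ b := by
    rintro a b h rfl; exact h (cartan_self a)
  have nxy : x ≠ y := ne (by omega)
  have nxc : x ≠ c := ne (by omega)
  have nyc : y ≠ c := ne (by omega)
  refine ⟨fun z hz => ?_, fun u hu => ?_⟩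
  · simp only [Finset.mem_insert, Finset.mem_singleton, not_or] at hz
    simp [simpleRoot, hz]
  have hux := hu.eq_zero x (by simp) nxc
  have huy := hu.eq_zero y (by simp) nyc
  have hadj := hu.adj
  have e : (2 : ℤ) • simpleRoot c + simpleRoot x + simpleRoot y + simpleRoot u =
      (2 : ℤ) • simpleRoot c + sumRoots [x, y, u] := by
    simp [sumRoots, add_assoc]
  have hyx : cartan y x = 0 := by rw [cartan_comm]; exact hxy
  have hxu : cartan x u = 0 := by rw [cartan_comm]; exact hux
  have hyu : cartan y u = 0 := by rw [cartan_comm]; exact huy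
  have hcx : cartan c x = -1 := by rw [cartan_comm]; exact hx
  have hcy : cartan c y = -1 := by rw [cartan_comm]; exact hy
  have hcu : cartan c u = -1 := by rw [cartan_comm]; exact hadj
  have nxu : x ≠ u := ne (by omega)
  have nyu : y ≠ u := ne (by omega)
  refine ⟨?_, ?_, ?_, ?_⟩
  · rw [e]
    obtain ⟨L, h1, h2⟩ := reach_star hQ (c := c) (l := [x, y, u]) rfl
      (by simp [nxy, nxu, nyu]) (by simp [hx, hy, hadj])
      (by
        simp only [List.mem_cons, List.not_mem_nil, or_false]
        rintro a (rfl | rfl | rfl) b (rfl | rfl | rfl) hab <;> first | exact absurd rfl hab | assumption)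
    refine ⟨L, fun z => ?_, h2⟩
    rw [h1]
    simp only [List.mem_cons, List.not_mem_nil, or_false, Finset.mem_insert, Finset.mem_singleton]
    tauto
  · simp only [map_add, map_smul, coroot_simpleRoot, cartan_self, hcx, hcy, hcu, smul_eq_mul]
    norm_num
  · simp only [map_add, map_smul, coroot_simpleRoot, cartan_self, hux, huy, hadj, smul_eq_mul]
    norm_num
  · intro z hz hzc
    simp only [Finset.mem_insert, Finset.mem_singleton] at hz
    rcases hz with rfl | rfl | rfl
    · simp only [map_add, map_smul, coroot_simpleRoot, cartan_self, hyx, hy, hyu, smul_eq_mul]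
      norm_num
    · simp only [map_add, map_smul, coroot_simpleRoot, cartan_self, hxy, hx, hxu, smul_eq_mul]
      norm_num
    · exact absurd rfl hzc

include hQ in
theorem ReachOn.add_or_push {B : Finset V} {t u : V} {v : V → ℤ} (h : ReachOn (· ≤ ·) B v)
    (hu : IsLeaf B t u) (hv : ∀ x ∉ B, v x = 0) (hvt : v t = 1) {a : ℤ} (ha0 : 0 ≤ a)
    (ha1 : a ≤ 1) : ReachOn (· ≤ ·) (insert u B) (v + a • simpleRoot u) := by
  have h1 := h.add_leaf hQ hu
  have hc : coroot u v = -1 := by rw [coroot_of_leaf hu hv, hvt]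
  interval_cases a
  · simpa using h1.1
  · rw [one_smul, ← simpleReflection_of_coroot_eq_neg_one hc]
    exact h1.2 (le_simpleReflection (by omega))

theorem star_decomposition {c x y : V} (nxy : x ≠ y) (nxc : x ≠ c) (nyc : y ≠ c) {v : V → ℤ}
    (hv : ∀ z ∉ ({y, x, c} : Finset V), v z = 0) :
    v = v c • simpleRoot c + v x • simpleRoot x + v y • simpleRoot y := by
  ext z
  by_cases hz : z ∈ ({y, x, c} : Finset V)
  · simp only [Finset.mem_insert, Finset.mem_singleton] at hz
    rcases hz with rfl | rfl | rfl <;>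
      simp [simpleRoot, nxy, nxc, nyc, nxy.symm, nxc.symm, nyc.symm]
  · have := hv z hz
    simp only [Finset.mem_insert, Finset.mem_singleton, not_or] at hz
    simp [simpleRoot, hz, this]

/-- The zeros among integral vectors on the star are the multiples of `2 α_c + α_x + α_y`. Hence the
coefficient at `c` is then never 1, and the value 2 determines the vector. -/
theorem form_of_star {c x y : V} (hxy : cartan x y = 0) (hx : cartan x c = -1)
    (hy : cartan y c = -1) {v : V → ℤ}
    (hdec : v = v c • simpleRoot c + v x • simpleRoot x + v y • simpleRoot y) :
    form v v - v c ^ 2 = (v c - v x - v y) ^ 2 + (v x - v y) ^ 2 := by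
  have hyx : cartan y x = 0 := by rw [cartan_comm]; exact hxy
  have h0 := form_add_smul 0 c (v c)
  rw [zero_add, map_zero] at h0
  have e : form v v = form (v c • simpleRoot c + v x • simpleRoot x + v y • simpleRoot y)
      (v c • simpleRoot c + v x • simpleRoot x + v y • simpleRoot y) := by rw [← hdec]
  rw [e, form_add_smul, form_add_smul, h0]
  simp only [map_add, map_smul, coroot_simpleRoot, hyx, hx, hy, smul_eq_mul]
  have : form (0 : V → ℤ) 0 = 0 := by simp [form]
  rw [this]
  ring

include hQ in
-- The alternative `u ∈ L` serves curves that start at a leaf of the star: completing the star then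
-- skips that leaf.
theorem Reach.exists_insert {R : (V → ℤ) → (V → ℤ) → Prop} {L : List V} {v : V → ℤ}
    (h : Reach R L v) (u t : V)
    (hu : u ∉ L ∧ (∀ z ∈ L, z ≠ t → cartan u z = 0) ∨ u ∈ L) :
    ∃ L', (∀ z, z ∈ L' ↔ z ∈ L ∨ z = u) ∧ Reach R L' v := by
  rcases hu with ⟨hu, ht⟩ | hu
  · obtain ⟨L', h1, h2, -⟩ := h.add_leaf hQ hu ht
    exact ⟨L', fun z => by rcases h1 with rfl | rfl <;> simp [or_comm], h2⟩
  · refine ⟨L, fun z => ⟨.inl, ?_⟩, h⟩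
    rintro (h | rfl)
    exacts [h, hu]

include hQ in
theorem Reach.exists_insert_star {R : (V → ℤ) → (V → ℤ) → Prop} {c x y : V}
    (hxy : cartan x y = 0) (nxy : x ≠ y) (nxc : x ≠ c) (nyc : y ≠ c) {L : List V}
    {v : V → ℤ} (hr : Reach R L v) (hp : ∃ p, ∀ z ∈ L, z ≠ p → cartan c z = 0) (hcL : c ∉ L)
    (hxL : x ∉ L ∧ (∀ z ∈ L, cartan x z = 0) ∨ x ∈ L)
    (hyL : y ∉ L ∧ (∀ z ∈ L, cartan y z = 0) ∨ y ∈ L) :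
    ∃ L', (∀ z, z ∈ L' ↔ z ∈ L ∨ z ∈ ({y, x, c} : Finset V)) ∧ Reach R L' v := by
  obtain ⟨p, hp⟩ := hp
  obtain ⟨L1, m1, r1⟩ := hr.exists_insert hQ c p (.inl ⟨hcL, hp⟩)
  obtain ⟨L2, m2, r2⟩ := r1.exists_insert hQ x c (by
    rcases hxL with ⟨h1, h2⟩ | h1
    · exact .inl ⟨by simp [m1, h1, nxc],
        fun z hz hzc => h2 z (((m1 z).1 hz).resolve_right hzc)⟩
    · exact .inr ((m1 x).2 (.inl h1)))
  obtain ⟨L3, m3, r3⟩ := r2.exists_insert hQ y c (by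
    rcases hyL with ⟨h1, h2⟩ | h1
    · refine .inl ⟨by simp [m2, m1, h1, nyc, nxy.symm], fun z hz hzc => ?_⟩
      rcases (m2 z).1 hz with hz | rfl
      · exact h2 z (((m1 z).1 hz).resolve_right hzc)
      · rw [cartan_comm]; exact hxy
    · exact .inr ((m2 y).2 (.inl ((m1 y).2 (.inl h1)))))
  refine ⟨L3, fun z => ?_, r3⟩
  rw [m3, m2, m1, Finset.mem_insert, Finset.mem_insert, Finset.mem_singleton]
  tauto

include hQ in
theorem reachOn_simpleRoot_of_star {R : (V → ℤ) → (V → ℤ) → Prop} {c x y : V}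
    (hxy : cartan x y = 0) (nxy : x ≠ y) (nxc : x ≠ c) (nyc : y ≠ c) {u : V}
    (hu : u = x ∨ u = y) : ReachOn R {y, x, c} (simpleRoot u) := by
  have huc : u ≠ c := by rcases hu with rfl | rfl <;> assumption
  have hyx : cartan y x = 0 := by rw [cartan_comm]; exact hxy
  have hr : Reach R [u] (simpleRoot u) := .start u
  obtain ⟨L', m, r⟩ := hr.exists_insert_star hQ hxy nxy nxc nyc ⟨u, by simp⟩
    (by simpa using huc.symm)
    (by rcases hu with rfl | rfl <;> simp [nxy, hxy])
    (by rcases hu with rfl | rfl <;> simp [nxy.symm, hyx])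
  refine ⟨L', fun z => ?_, r⟩
  rw [m, List.mem_singleton, or_iff_right_iff_imp]
  rintro rfl
  rcases hu with rfl | rfl <;> simp

include hQ in
theorem reachOn_star {c x y : V} (hxy : cartan x y = 0) (hx : cartan x c = -1)
    (hy : cartan y c = -1) (nxy : x ≠ y) (nxc : x ≠ c) (nyc : y ≠ c) {a b : ℤ}
    (ha : 0 ≤ a) (ha1 : a ≤ 1) (hb : 0 ≤ b) (hb1 : b ≤ 1) :
    ReachOn (· ≤ ·) {y, x, c} (simpleRoot c + a • simpleRoot x + b • simpleRoot y) := by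
  have lx : IsLeaf {c} c x := ⟨by simp, by simpa using nxc, hx, by simp⟩
  have ly : IsLeaf {x, c} c y := ⟨by simp, by simp [nxy.symm, nyc], hy, by
    intro z hz hzc
    simp only [Finset.mem_insert, Finset.mem_singleton] at hz
    rcases hz with rfl | rfl
    exacts [by rw [cartan_comm]; exact hxy, absurd rfl hzc]⟩
  have r0 : ReachOn (· ≤ ·) {c} (simpleRoot c) := ⟨[c], by simp, .start c⟩
  have r1 := r0.add_or_push hQ lx (fun z hz => by
    simp [simpleRoot, Finset.mem_singleton.not.1 hz]) (by simp [simpleRoot]) ha ha1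
  refine r1.add_or_push hQ ly (fun z hz => ?_) (by simp [simpleRoot, nxc.symm]) hb hb1
  rw [Finset.mem_insert, Finset.mem_singleton, not_or] at hz
  simp [simpleRoot, hz]

theorem eq_zero_and_eq_zero_of_sq_add_sq {a b : ℤ} (h : a ^ 2 + b ^ 2 = 0) : a = 0 ∧ b = 0 := by
  have h1 := sq_nonneg a
  have h2 := sq_nonneg b
  exact ⟨pow_eq_zero_iff two_ne_zero |>.1 (by omega), pow_eq_zero_iff two_ne_zero |>.1 (by omega)⟩

theorem abs_le_one_of_sq_add_sq {a b : ℤ} (h : a ^ 2 + b ^ 2 = 1) :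
    (-1 ≤ a ∧ a ≤ 1) ∧ (-1 ≤ b ∧ b ≤ 1) := by
  have h1 := sq_nonneg a
  have h2 := sq_nonneg b
  exact ⟨abs_le.1 (sq_le_one_iff_abs_le_one a |>.1 (by omega)),
    abs_le.1 (sq_le_one_iff_abs_le_one b |>.1 (by omega))⟩

include hQ in
theorem chainEnd_branch {c x y : V} (hxy : cartan x y = 0) (hx : cartan x c = -1)
    (hy : cartan y c = -1) :
    ChainEnd (V := V) (· ≤ ·)
      (fun v => v = (2 : ℤ) • simpleRoot c + simpleRoot x + simpleRoot y) {y, x, c} c := by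
  have ne : ∀ {a b : V}, cartan a b ≠ 2 → a ≠ b := by
    rintro a b h rfl; exact h (cartan_self a)
  have nxy : x ≠ y := ne (by omega)
  have nxc : x ≠ c := ne (by omega)
  have nyc : y ≠ c := ne (by omega)
  have dec : ∀ {v : V → ℤ}, (∀ z ∉ ({y, x, c} : Finset V), v z = 0) →
      v = v c • simpleRoot c + v x • simpleRoot x + v y • simpleRoot y :=
    star_decomposition nxy nxc nyc
  have hsum : ∀ {v : V → ℤ}, (∀ z ∉ ({y, x, c} : Finset V), v z = 0) →
      form v v - v c ^ 2 = (v c - v x - v y) ^ 2 + (v x - v y) ^ 2 := fun hv =>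
    form_of_star hxy hx hy (dec hv)
  have hzero : ∀ {v : V → ℤ}, (∀ z ∉ ({y, x, c} : Finset V), v z = 0) →
      form v v - v c ^ 2 = 0 → v x = v y ∧ v c = v x + v y := by
    intro v hv hf
    rw [hsum hv] at hf
    obtain ⟨h1, h2⟩ := eq_zero_and_eq_zero_of_sq_add_sq hf
    constructor <;> omega
  have hone : ∀ v : V → ℤ, (∀ z ∉ ({y, x, c} : Finset V), v z = 0) → (∀ z, 0 ≤ v z) →
      form v v - v c ^ 2 = 1 → v c = 1 → ReachOn (· ≤ ·) {y, x, c} v := by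
    intro v hv h0 hf hc
    rw [hsum hv] at hf
    have h1 := h0 x
    have h2 := h0 y
    obtain ⟨h3, h4⟩ := abs_le_one_of_sq_add_sq hf
    rw [dec hv, hc, one_smul]
    exact reachOn_star hQ hxy hx hy nxy nxc nyc h1 (by omega) h2 (by omega)
  refine ⟨by simp, ?_, ?_, ?_, ?_, hone, ?_, ?_⟩
  · intro v hv _
    rw [hsum hv]; exact add_nonneg (sq_nonneg _) (sq_nonneg _)
  · intro v hv h0 hf hc
    have h1 := hzero hv hf
    have h2 := h0 x
    have h3 := h0 y
    have e : v = _ := dec hv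
    rw [hc, show v x = 0 by omega, show v y = 0 by omega] at e
    rw [e]; simp
  · intro v hv h0 hf hc
    have h1 := hzero hv hf
    omega
  · intro v hv h0 hf hc
    have h1 := hzero hv hf
    have e : v = _ := dec hv
    rw [hc, show v x = 1 by omega, show v y = 1 by omega, one_smul, one_smul] at e
    exact e
  · intro v hv h0 hf
    have h1 := h0 x
    have h2 := h0 y
    have h3 := h0 c
    have hf' := hsum hv
    rw [hf] at hf'
    -- A sum of two squares equals `2 - v c ^ 2`, so `v c ^ 2 ≤ 2`.
    have h4 : v c = 0 ∨ v c = 1 := by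
      have a1 := sq_nonneg (v c - v x - v y)
      have a2 := sq_nonneg (v x - v y)
      have : v c ≤ 1 := by nlinarith only [hf', a1, a2]
      omega
    rcases h4 with hc | hc
    · have h5 : v x ^ 2 + v y ^ 2 = 1 := by
        rw [hc] at hf'; nlinarith only [hf']
      obtain ⟨-, h6⟩ := abs_le_one_of_sq_add_sq h5
      have e : v = _ := dec hv
      rcases (show v y = 0 ∨ v y = 1 by omega) with hy' | hy'
      · have hx' : v x = 1 := by rw [hy'] at h5; nlinarith only [h5, h1]
        rw [hc, hy', hx', zero_smul, zero_smul, one_smul, zero_add, add_zero] at e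
        rw [e]
        exact reachOn_simpleRoot_of_star hQ hxy nxy nxc nyc (.inl rfl)
      · have hx' : v x = 0 := by rw [hy'] at h5; nlinarith only [h5, h1]
        rw [hc, hy', hx', zero_smul, zero_smul, one_smul, zero_add, zero_add] at e
        rw [e]
        exact reachOn_simpleRoot_of_star hQ hxy nxy nxc nyc (.inr rfl)
    · exact hone v hv h0 (by rw [hf, hc]; norm_num) hc
  · rintro L v hr hL hp hb
    refine hr.exists_insert_star hQ hxy nxy nxc nyc hp (fun h => hL c h (by simp))
      (.inl ⟨fun h => hL x h (by simp), ?_⟩) (.inl ⟨fun h => hL y h (by simp), ?_⟩)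
    · exact hb x (by simp) nxc
    · exact hb y (by simp) nyc

include hQ in
theorem realized_typeD (hD : IsTypeD V) {n : ℕ} (hn : Fintype.card V = n) {β : V → ℤ}
    (hβ : β ∈ positiveRoots V) : Realized (· ≤ ·) n β := by
  obtain ⟨m, hm, e, he⟩ := hD
  -- The branch vertex is `m - 3`, with leaves `m - 2` and `m - 1`, and the chain descends from
  -- there to 0.
  have key : ∀ l (hl : l + 3 ≤ m), ∃ top : V → ℤ,
      ChainEnd (V := V) (· ≤ ·) (fun v => v = top)
        (Finset.univ.filter fun x => m ≤ (e x : ℕ) + 3 + l) (e.symm ⟨m - 3 - l, by omega⟩) ∧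
      TopGood (Finset.univ.filter fun x => m ≤ (e x : ℕ) + 3 + l)
        (e.symm ⟨m - 3 - l, by omega⟩) top := by
    intro l
    induction l with
    | zero =>
      intro _
      have hB : (Finset.univ.filter fun x => m ≤ (e x : ℕ) + 3 + 0) =
          {e.symm ⟨m - 2, by omega⟩, e.symm ⟨m - 1, by omega⟩, e.symm ⟨m - 3, by omega⟩} := by
        ext x
        have := (e x).2
        simp only [Finset.mem_filter, Finset.mem_univ, true_and, Finset.mem_insert,
          Finset.mem_singleton, Equiv.eq_symm_apply, Fin.ext_iff]
        omega
      have c1 : cartan (e.symm ⟨m - 1, by omega⟩) (e.symm ⟨m - 2, by omega⟩) = 0 := by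
        simp only [he, CartanMatrix.D, Matrix.of_apply, Equiv.apply_symm_apply, Fin.ext_iff]
        split_ifs <;> omega
      have c2 : cartan (e.symm ⟨m - 1, by omega⟩) (e.symm ⟨m - 3, by omega⟩) = -1 := by
        simp only [he, CartanMatrix.D, Matrix.of_apply, Equiv.apply_symm_apply, Fin.ext_iff]
        split_ifs <;> omega
      have c3 : cartan (e.symm ⟨m - 2, by omega⟩) (e.symm ⟨m - 3, by omega⟩) = -1 := by
        simp only [he, CartanMatrix.D, Matrix.of_apply, Equiv.apply_symm_apply, Fin.ext_iff]
        split_ifs <;> omega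
      rw [hB]
      exact ⟨_, chainEnd_branch hQ c1 c2 c3, topGood_star hQ c1 c2 c3⟩
    | succ l ih =>
      intro hl
      obtain ⟨top, h1, h2⟩ := ih (by omega)
      have leaf : IsLeaf (Finset.univ.filter fun x => m ≤ (e x : ℕ) + 3 + l)
          (e.symm ⟨m - 3 - l, by omega⟩) (e.symm ⟨m - 3 - (l + 1), by omega⟩) := by
        refine ⟨?_, ?_, ?_, ?_⟩
        · simp; omega
        · simp; omega
        · simp only [he, CartanMatrix.D, Matrix.of_apply, Equiv.apply_symm_apply, Fin.ext_iff]
          split_ifs <;> omega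
        · intro x hx hxt
          simp only [Finset.mem_filter, Finset.mem_univ, true_and] at hx
          rw [Ne, Equiv.eq_symm_apply, Fin.ext_iff] at hxt
          simp only at hxt
          simp only [he, CartanMatrix.D, Matrix.of_apply, Equiv.apply_symm_apply, Fin.ext_iff]
          split_ifs <;> omega
      have hB : (Finset.univ.filter fun x => m ≤ (e x : ℕ) + 3 + (l + 1)) =
          insert (e.symm ⟨m - 3 - (l + 1), by omega⟩)
            (Finset.univ.filter fun x => m ≤ (e x : ℕ) + 3 + l) := by
        ext x
        simp only [Finset.mem_filter, Finset.mem_univ, true_and, Finset.mem_insert,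
          Equiv.eq_symm_apply, Fin.ext_iff]
        omega
      rw [hB]
      exact ⟨_, h1.extend hQ (fun _ _ h => h.le) leaf (by rintro v rfl; exact (h2.2 _ leaf).1)
        (by rintro v rfl; rfl), h2.extend hQ leaf⟩
  obtain ⟨top, h1, -⟩ := key (m - 3) (by omega)
  obtain ⟨L, hL, hr⟩ := h1.reach β
    (fun x hx => absurd (by simp; omega) hx) (fun x => hβ.2.le x)
    (form_of_mem_rootSystem hβ.1)
  exact hr.realized (fun x => (hL x).2 (by simp; omega)) hn

end TypeD

/-! ### Rectilinear curves with integral coordinates -/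

section Pens

/-- An axis-parallel box with integral corners. -/
structure Box where
  left : ℕ
  right : ℕ
  bottom : ℕ
  top : ℕ

/-- The points of the plane which lie in the box after scaling by `c`. -/
def Box.region (c : ℕ) (b : Box) : Set (ℝ × ℝ) :=
  {p | (b.left ≤ c * p.1 ∧ c * p.1 ≤ b.right) ∧ b.bottom ≤ c * p.2 ∧ c * p.2 ≤ b.top}

/-- The interval from `a` to `a'`, without `a`, does not meet the interval from `lo` to `hi`. -/
def avoids (a a' lo hi : ℕ) : Bool :=
  bif Nat.blt a a' then Nat.blt a' lo || Nat.ble hi a else Nat.blt hi a' || Nat.ble a lo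

/-- The state of drawing a rectilinear curve: the current point, the boxes drawn so far, and the
rays crossed so far. -/
structure Pen where
  x : ℕ
  y : ℕ
  drawn : List Box
  word : List ℕ

/-- Moving vertically to the height `y'`. -/
def Pen.vertical (c : ℕ) (s : Pen) (y' : ℕ) : Option Pen :=
  -- The weak bound on the old height and the strict one on the new height allow leaving a marked
  -- point downwards, although its abscissa is that of a ray.
  bif !(y' == s.y) && (!(s.x % c == 0) || (Nat.ble s.y c && Nat.blt y' c)) &&
      s.drawn.all fun b => Nat.blt s.x b.left || Nat.blt b.right s.x ||
        avoids s.y y' b.bottom b.top then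
    some ⟨s.x, y', ⟨s.x, s.x, min s.y y', max s.y y'⟩ :: s.drawn, s.word⟩
  else none

/-- The rays crossed by a horizontal segment from `x` to `x'`, out of `n` rays. -/
def crossed (c n x x' : ℕ) : List ℕ :=
  bif Nat.blt x x' then
    (List.range n).filter fun j => Nat.blt x (c * (j + 1)) && Nat.blt (c * (j + 1)) x'
  else ((List.range n).filter fun j => Nat.blt x' (c * (j + 1)) && Nat.blt (c * (j + 1)) x).reverse

/-- Moving horizontally to the abscissa `x'`. -/
def Pen.horizontal (c n : ℕ) (s : Pen) (x' : ℕ) : Option Pen :=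
  -- Abscissae up to `c * (n + 1)`, the position of the first missing ray, ensure that only rays of
  -- index below `n` are crossed. Height `c` itself, where the marked points lie, is excluded.
  bif !(x' == s.x) && Nat.ble s.x (c * (n + 1)) && Nat.ble x' (c * (n + 1)) &&
      (Nat.blt s.y c || (Nat.blt c s.y && !(x' % c == 0))) &&
      s.drawn.all fun b => Nat.blt s.y b.bottom || Nat.blt b.top s.y ||
        avoids s.x x' b.left b.right then
    some ⟨x', s.y, ⟨min s.x x', max s.x x', s.y, s.y⟩ :: s.drawn,
      bif Nat.blt s.y c then s.word else s.word ++ crossed c n s.x x'⟩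
  else none

/-- Drawing a rectilinear curve which consists of alternating vertical and horizontal segments, with
end point strictly between the base line and the marked points and below all other points. The
result is the list of the rays crossed. -/
def Pen.draw (c n : ℕ) : Bool → List ℕ → Pen → Option (List ℕ)
  | _, [], s => bif Nat.blt 0 s.y && Nat.blt s.y c && s.drawn.all (fun b => Nat.ble s.y b.bottom) then
      some s.word else none
  | true, y :: l, s => (s.vertical c y).bind (Pen.draw c n false l)
  | false, x :: l, s => (s.horizontal c n x).bind (Pen.draw c n true l)

/-- The union of the boxes drawn so far. -/
def Pen.region (c : ℕ) (s : Pen) : Set (ℝ × ℝ) := {p | ∃ b ∈ s.drawn, p ∈ b.region c}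

/-- The pen state is that of an actual curve. -/
def Pen.Valid (c k : ℕ) (s : Pen) : Prop :=
  Trace k s.word (s.region c) ((s.x : ℝ) / c, (s.y : ℝ) / c)

theorem not_mem_of_avoids {a a' lo hi : ℕ} (h : avoids a a' lo hi = true) (ha : a' ≠ a) {t : ℝ}
    (ht : t ∈ uIcc (a : ℝ) a') (hta : t ≠ a) : ¬(lo ≤ t ∧ t ≤ hi) := by
  rintro ⟨h1, h2⟩
  simp only [avoids, cond_eq_ite, Nat.blt_eq, Bool.ite_eq_true_distrib, Bool.or_eq_true,
    Nat.ble_eq] at h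
  rcases lt_or_gt_of_ne ha with h3 | h3
  · rw [if_neg (not_lt.2 h3.le)] at h
    rw [uIcc_of_ge (by exact_mod_cast h3.le)] at ht
    rcases h with h | h
    · have : (hi : ℝ) < a' := by exact_mod_cast h
      linarith [ht.1]
    · have : (a : ℝ) ≤ lo := by exact_mod_cast h
      exact hta (le_antisymm ht.2 (this.trans h1))
  · rw [if_pos h3] at h
    rw [uIcc_of_le (by exact_mod_cast h3.le)] at ht
    rcases h with h | h
    · have : (a' : ℝ) < lo := by exact_mod_cast h
      linarith [ht.2]
    · have : (hi : ℝ) ≤ a := by exact_mod_cast h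
      exact hta (le_antisymm (h2.trans this) ht.1)

theorem blt_eq_true {a b : ℕ} (h : a < b) : Nat.blt a b = true := by rwa [Nat.blt_eq]

theorem blt_eq_false {a b : ℕ} (h : b ≤ a) : Nat.blt a b = false := by
  rwa [Bool.eq_false_iff, ne_eq, Nat.blt_eq, not_lt]

theorem min_max_of_mem_uIcc {a a' : ℕ} {t : ℝ} (h : t ∈ uIcc (a : ℝ) a') :
    ((min a a' : ℕ) : ℝ) ≤ t ∧ t ≤ ((max a a' : ℕ) : ℝ) := by
  push_cast
  exact h

variable {c : ℕ} (hc : 0 < c)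

include hc

theorem mul_mem_uIcc {a a' : ℕ} {z : ℝ} (hz : z ∈ uIcc ((a : ℝ) / c) (a' / c)) :
    c * z ∈ uIcc (a : ℝ) a' := by
  have hc' : (0 : ℝ) < c := by exact_mod_cast hc
  rw [mem_uIcc] at hz ⊢
  rwa [div_le_iff₀' hc', le_div_iff₀' hc', div_le_iff₀' hc', le_div_iff₀' hc'] at hz

theorem mul_ne_of_ne {a : ℕ} {z : ℝ} (hz : z ≠ (a : ℝ) / c) : c * z ≠ a := by
  have hc' : (c : ℝ) ≠ 0 := by exact_mod_cast hc.ne'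
  rwa [ne_eq, eq_div_iff hc', mul_comm] at hz

theorem ne_of_mod_ne_zero {x : ℕ} (h : x % c ≠ 0) (j : ℕ) : (x : ℝ) / c ≠ j + 1 := by
  have hc' : (c : ℝ) ≠ 0 := by exact_mod_cast hc.ne'
  rw [ne_eq, div_eq_iff hc']
  intro h1
  have h2 : x = (j + 1) * c := by exact_mod_cast h1
  exact h (h2 ▸ Nat.mul_mod_left _ _)

theorem Pen.Valid.vertical {k : ℕ} {s s' : Pen} (h : s.Valid c k) {y' : ℕ}
    (hs : s.vertical c y' = some s') : s'.Valid c k := by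
  have hc' : (0 : ℝ) < c := by exact_mod_cast hc
  have hc0 := hc'.ne'
  rw [Pen.vertical, cond_eq_ite, Option.ite_none_right_eq_some, Option.some_inj] at hs
  obtain ⟨hs, rfl⟩ := hs
  simp only [Bool.and_eq_true, Bool.not_eq_true', Bool.or_eq_true, List.all_eq_true, Nat.blt_eq,
    Nat.ble_eq, beq_eq_false_iff_ne] at hs
  obtain ⟨⟨h1, h2⟩, h3⟩ := hs
  have h1' : (y' : ℝ) / c ≠ s.y / c := by
    rw [ne_eq, div_left_inj' hc0]; exact_mod_cast h1
  refine (Trace.vertical h h1' ?_ ?_).mono ?_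
  · rintro z hz hzy ⟨b, hb, hb1, hb2⟩
    rw [mul_div_cancel₀ _ hc0] at hb1
    rcases h3 b hb with (h4 | h4) | h4
    · exact absurd hb1.1 (not_le.2 (by exact_mod_cast h4))
    · exact absurd hb1.2 (not_le.2 (by exact_mod_cast h4))
    · exact not_mem_of_avoids h4 h1 (mul_mem_uIcc hc hz) (mul_ne_of_ne hc hzy) hb2
  · rcases h2 with h2 | ⟨h2, h2'⟩
    · exact .inl (ne_of_mod_ne_zero hc h2)
    · refine .inr fun z hz hzy => ?_
      have h5 := mul_mem_uIcc hc hz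
      have h6 := mul_ne_of_ne hc hzy
      have h7 : (s.y : ℝ) ≤ c := by exact_mod_cast h2
      have h8 : (y' : ℝ) < c := by exact_mod_cast h2'
      by_contra! h9
      have h10 : (c : ℝ) ≤ c * z := le_mul_of_one_le_right hc'.le h9
      rcases mem_uIcc.1 h5 with h5 | h5
      · linarith [h5.2]
      · exact h6 (le_antisymm h5.2 (h7.trans h10))
  · rintro p (⟨b, hb, hp⟩ | ⟨hp1, hp2⟩)
    · exact ⟨b, List.mem_cons_of_mem _ hb, hp⟩
    · refine ⟨_, List.mem_cons_self, ?_, min_max_of_mem_uIcc (mul_mem_uIcc hc hp2)⟩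
      rw [hp1, mul_div_cancel₀ _ hc0]
      exact ⟨le_rfl, le_rfl⟩

theorem div_lt_add_one_iff {x j : ℕ} : (x : ℝ) / c < j + 1 ↔ x < c * (j + 1) := by
  rw [div_lt_iff₀' (by exact_mod_cast hc)]
  exact_mod_cast Iff.rfl

theorem add_one_lt_div_iff {x j : ℕ} : (j : ℝ) + 1 < x / c ↔ c * (j + 1) < x := by
  rw [lt_div_iff₀' (by exact_mod_cast hc)]
  exact_mod_cast Iff.rfl

theorem mem_filter_range {n x x' : ℕ} (hx : x' ≤ c * (n + 1)) (j : ℕ) :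
    j ∈ (List.range n).filter (fun j => Nat.blt x (c * (j + 1)) && Nat.blt (c * (j + 1)) x') ↔
      (x : ℝ) / c < j + 1 ∧ (j : ℝ) + 1 < x' / c := by
  rw [List.mem_filter, List.mem_range, Bool.and_eq_true, Nat.blt_eq, Nat.blt_eq,
    div_lt_add_one_iff hc, add_one_lt_div_iff hc, and_iff_right_iff_imp]
  rintro ⟨-, h⟩
  have := Nat.lt_of_mul_lt_mul_left (h.trans_le hx)
  omega

theorem Pen.Valid.horizontal {k n : ℕ} {s s' : Pen} (h : s.Valid c k) {x' : ℕ}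
    (hs : s.horizontal c n x' = some s') : s'.Valid c k := by
  have hc' : (0 : ℝ) < c := by exact_mod_cast hc
  have hc0 := hc'.ne'
  rw [Pen.horizontal, cond_eq_ite, Option.ite_none_right_eq_some, Option.some_inj] at hs
  obtain ⟨hs, rfl⟩ := hs
  simp only [Bool.and_eq_true, Bool.not_eq_true', Bool.or_eq_true, List.all_eq_true, Nat.blt_eq,
    Nat.ble_eq, beq_eq_false_iff_ne] at hs
  obtain ⟨⟨⟨⟨h1, hn⟩, hn'⟩, h2⟩, h3⟩ := hs
  have hS : ∀ z ∈ uIcc ((s.x : ℝ) / c) (x' / c), z ≠ s.x / c →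
      (z, (s.y : ℝ) / c) ∉ s.region c := by
    rintro z hz hzy ⟨b, hb, hb1, hb2⟩
    rw [mul_div_cancel₀ _ hc0] at hb2
    rcases h3 b hb with (h4 | h4) | h4
    · exact absurd hb2.1 (not_le.2 (by exact_mod_cast h4))
    · exact absurd hb2.2 (not_le.2 (by exact_mod_cast h4))
    · exact not_mem_of_avoids h4 h1 (mul_mem_uIcc hc hz) (mul_ne_of_ne hc hzy) hb1
  have hsub : s.region c ∪ {p | p.1 ∈ uIcc ((s.x : ℝ) / c) (x' / c) ∧ p.2 = (s.y : ℝ) / c} ⊆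
      {p | ∃ b ∈ (⟨min s.x x', max s.x x', s.y, s.y⟩ : Box) :: s.drawn, p ∈ b.region c} := by
    rintro p (⟨b, hb, hp⟩ | ⟨hp1, hp2⟩)
    · exact ⟨b, List.mem_cons_of_mem _ hb, hp⟩
    · refine ⟨_, List.mem_cons_self, min_max_of_mem_uIcc (mul_mem_uIcc hc hp1), ?_⟩
      rw [hp2, mul_div_cancel₀ _ hc0]
      exact ⟨le_rfl, le_rfl⟩
  have hsort := List.pairwise_lt_range (n := n)
  rcases h2 with h2 | ⟨h2, h4⟩
  · rw [blt_eq_true h2, cond_true]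
    refine (Trace.horizontal_below h ?_ hS ?_).mono hsub
    · rw [ne_eq, div_left_inj' hc0]; exact_mod_cast h1
    · rw [div_lt_one hc']; exact_mod_cast h2
  · rw [blt_eq_false h2.le, cond_false]
    have hy : 1 < (s.y : ℝ) / c := by rw [one_lt_div hc']; exact_mod_cast h2
    rcases lt_or_gt_of_ne h1 with h5 | h5
    · refine (Trace.horizontal_left h ?_ hS hy (ne_of_mod_ne_zero hc h4)
        (w' := crossed c n s.x x') ?_ ?_).mono hsub
      · rw [div_lt_div_iff_of_pos_right hc']; exact_mod_cast h5
      · rw [crossed, blt_eq_false h5.le, cond_false, List.pairwise_reverse]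
        exact hsort.filter _
      · intro j
        rw [crossed, blt_eq_false h5.le, cond_false, List.mem_reverse,
          mem_filter_range hc hn]
    · refine (Trace.horizontal_right h ?_ hS hy (ne_of_mod_ne_zero hc h4)
        (w' := crossed c n s.x x') ?_ ?_).mono hsub
      · rw [div_lt_div_iff_of_pos_right hc']; exact_mod_cast h5
      · rw [crossed, blt_eq_true h5, cond_true]
        exact hsort.filter _
      · intro j
        rw [crossed, blt_eq_true h5, cond_true, mem_filter_range hc hn']

theorem Pen.Valid.exists_curve {k n : ℕ} (hk : k < n) {w : List (Fin n)} {d : Bool} {l : List ℕ}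
    {s : Pen} (h : s.Valid c k) (hs : Pen.draw c n d l s = some (w.map Fin.val)) :
    ∃ γ : AdmissibleCurve n, γ.NonSelfCrossing ∧ γ.HasWord ⟨k, hk⟩ w := by
  induction l generalizing d s with
  | nil =>
    have hc' : (0 : ℝ) < c := by exact_mod_cast hc
    rw [Pen.draw, cond_eq_ite, Option.ite_none_right_eq_some, Option.some_inj] at hs
    obtain ⟨hs, hw⟩ := hs
    simp only [Bool.and_eq_true, List.all_eq_true, Nat.blt_eq, Nat.ble_eq] at hs
    obtain ⟨⟨h1, h2⟩, h3⟩ := hs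
    refine Trace.exists_curve_of_lowest h ?_ ?_ ?_ hk hw.symm
    · exact div_pos (by exact_mod_cast h1) hc'
    · change (s.y : ℝ) / c < 1
      rw [div_lt_one hc']; exact_mod_cast h2
    · rintro p ⟨b, hb, -, hp⟩
      have : (s.y : ℝ) ≤ b.bottom := by exact_mod_cast h3 b hb
      exact (div_le_iff₀' hc').2 (this.trans hp.1)
  | cons a l ih =>
    cases d with
    | true =>
      rw [Pen.draw, Option.bind_eq_some_iff] at hs
      obtain ⟨s', h1, h2⟩ := hs
      exact ih (h.vertical hc h1) h2
    | false =>
      rw [Pen.draw, Option.bind_eq_some_iff] at hs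
      obtain ⟨s', h1, h2⟩ := hs
      exact ih (h.horizontal hc h1) h2

/-- The pen at the marked point `k`. -/
def Pen.start (c k : ℕ) : Pen :=
  ⟨c * (k + 1), c, [⟨c * (k + 1), c * (k + 1), c, c⟩], []⟩

theorem Pen.valid_start (k : ℕ) : (Pen.start c k).Valid c k := by
  have hc0 : (c : ℝ) ≠ 0 := by exact_mod_cast hc.ne'
  have e : (((c * (k + 1) : ℕ) : ℝ) / c, (c : ℝ) / c) = mark k := by
    rw [div_self hc0, Nat.cast_mul, mul_div_cancel_left₀ _ hc0, mark]
    push_cast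
    rfl
  rw [Pen.Valid, Pen.start, e]
  refine (Trace.start k).mono ?_
  rintro p rfl
  refine ⟨_, List.mem_cons_self, ?_⟩
  simp [Box.region, mark]

/-- A rectilinear curve with integral coordinates yields an admissible curve. -/
theorem exists_curve_of_draw {k n : ℕ} (hk : k < n) {w : List (Fin n)} {l : List ℕ}
    (h : Pen.draw c n true l (Pen.start c k) = some (w.map Fin.val)) :
    ∃ γ : AdmissibleCurve n, γ.NonSelfCrossing ∧ γ.HasWord ⟨k, hk⟩ w :=
  (Pen.valid_start hc k).exists_curve hc hk h

end Pens

/-! ### Computing with words of reflections -/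

/-- The value of `f` at `n`, where `n` is evaluated first. -/
def evalNat {α : Type} (n : ℕ) (f : ℕ → α) : α :=
  Nat.rec (f 0) (fun m _ => f m.succ) n

theorem evalNat_eq {α : Type} (n : ℕ) (f : ℕ → α) : evalNat n f = f n := by cases n <;> rfl

/-- The value of `f` at `l`, where `l` is evaluated first. -/
def evalList {α : Type} (l : List ℕ) : (List ℕ → α) → α :=
  List.rec (fun f => f []) (fun a _ ih f => evalNat a fun a' => ih fun l' => f (a' :: l')) l

theorem evalList_eq {α : Type} (l : List ℕ) (f : List ℕ → α) : evalList l f = f l := by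
  induction l generalizing f with
  | nil => rfl
  | cons a l ih =>
    change evalNat a (fun a' => evalList l fun l' => f (a' :: l')) = _
    rw [evalNat_eq, ih]

/-- The reflection at the vertex `i` of a vector with natural coefficients, when it does not
decrease the vector; `nb i` is the list of the neighbours of `i`. -/
def raise (nb : ℕ → List ℕ) (v : List ℕ) (i : ℕ) : Option (List ℕ) :=
  -- Reducing the sum and the coefficient to literals first keeps unevaluated terms from piling up
  -- when long words are evaluated.
  evalNat ((nb i).map fun j => v.getD j 0).sum fun s => evalNat (v.getD i 0) fun a =>
    bif Nat.blt i v.length && Nat.ble (2 * a) s then evalList (v.set i (s - a)) some else none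

theorem raise_eq_some {nb : ℕ → List ℕ} {v v' : List ℕ} {i : ℕ} (h : raise nb v i = some v') :
    i < v.length ∧ 2 * v.getD i 0 ≤ ((nb i).map fun j => v.getD j 0).sum ∧
      v.set i (((nb i).map fun j => v.getD j 0).sum - v.getD i 0) = v' := by
  rw [raise, evalNat_eq, evalNat_eq, evalList_eq, cond_eq_ite, Option.ite_none_right_eq_some,
    Option.some_inj, Bool.and_eq_true, Nat.blt_eq, Nat.ble_eq, and_assoc] at h
  exact h

/-- The successive reflections along a word, when they do not decrease the vector. -/
def raiseAlong (nb : ℕ → List ℕ) : List ℕ → List ℕ → Option (List ℕ)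
  | v, [] => some v
  | v, i :: w => (raise nb v i).bind fun v' => raiseAlong nb v' w

/-- The simple root `i` among `N` simple roots, as a list of coefficients. -/
def unitList (N i : ℕ) : List ℕ := (List.range N).map fun j => bif i == j then 1 else 0

/-- A step in the construction of a winding curve. -/
inductive Move
  | add (u : ℕ)
  | push (u : ℕ)
  | pass (rev : Bool)

/-- The place of a new vertex in a sorted list. -/
def insertVertex (arr : ℕ → ℕ → Bool) (L : List ℕ) (u : ℕ) : Option (List ℕ) :=
  bif L.contains u then none
  else bif L.all fun x => !arr u x then evalList (L ++ [u]) some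
  else bif L.all fun x => !arr x u then evalList (u :: L) some else none

/-- The effect of a move on the list of enclosed vertices and the vector. -/
def Move.run (nb : ℕ → List ℕ) (arr : ℕ → ℕ → Bool) (s : List ℕ × List ℕ) :
    Move → Option (List ℕ × List ℕ)
  | add u => bif Nat.blt u s.2.length then (insertVertex arr s.1 u).map fun L => (L, s.2) else none
  | push u => (insertVertex arr s.1 u).bind fun L => (raise nb s.2 u).map fun v => (L, v)
  | pass rev => (raiseAlong nb s.2 (bif rev then s.1.reverse else s.1)).map fun v => (s.1, v)

/-- The effect of a list of moves, the last one first. -/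
def runMoves (nb : ℕ → List ℕ) (arr : ℕ → ℕ → Bool) (s : List ℕ × List ℕ) :
    List Move → Option (List ℕ × List ℕ)
  | [] => some s
  | m :: l => (m.run nb arr s).bind fun s' => runMoves nb arr s' l

theorem length_of_raiseAlong {nb : ℕ → List ℕ} {v v' w : List ℕ}
    (h : raiseAlong nb v w = some v') : v'.length = v.length := by
  induction w generalizing v with
  | nil => rw [raiseAlong, Option.some_inj] at h; rw [h]
  | cons i w ih =>
    rw [raiseAlong, Option.bind_eq_some_iff] at h
    obtain ⟨v1, h1, h2⟩ := h
    rw [ih h2, ← (raise_eq_some h1).2.2, List.length_set]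

/-! ### Lists of natural coefficients represent vectors in the root lattice -/

section Soundness

variable {V : Type*} [Quiver V] [DecidableEq V] [Fintype V] {N : ℕ} (e : V ≃ Fin N)

/-- The vector with the given list of coefficients. -/
def vec (v : List ℕ) : V → ℤ := fun x => (v.getD (e x) 0 : ℕ)

/-- `nb` describes the Cartan matrix and `arr` bounds the set of pairs of vertices with an arrow. -/
structure Describes (nb : ℕ → List ℕ) (arr : ℕ → ℕ → Bool) : Prop where
  coroot_eq : ∀ (x : V) (f : ℕ → ℤ), coroot x (fun y => f (e y)) = 2 * f (e x) - ((nb (e x)).map f).sum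
  isEmpty : ∀ x y : V, arr (e x) (e y) = false → IsEmpty (x ⟶ y)

omit [Quiver V] [Fintype V] in
theorem vec_unitList (x : V) : vec e (unitList N (e x)) = simpleRoot x := by
  ext y
  rw [vec, unitList, List.getD_eq_getElem _ _ (by simp), List.getElem_map, List.getElem_range,
    simpleRoot, Pi.single_apply]
  by_cases h : y = x
  · simp [h]
  · have : (e x : ℕ) ≠ e y := fun h' => h (e.injective (Fin.ext h'.symm))
    rw [if_neg h, beq_eq_false_iff_ne.2 this, cond_false, Nat.cast_zero]

variable {e} {nb : ℕ → List ℕ} {arr : ℕ → ℕ → Bool} (hd : Describes e nb arr)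
include hd

theorem Describes.coroot_vec (x : V) (v : List ℕ) :
    coroot x (vec e v) =
      2 * (v.getD (e x) 0 : ℕ) - (((nb (e x)).map fun j => v.getD j 0).sum : ℕ) := by
  rw [Nat.cast_list_sum, List.map_map]
  exact hd.coroot_eq x fun i => ((v.getD i 0 : ℕ) : ℤ)

theorem Describes.reflection_vec (x : V) {v : List ℕ} (hx : (e x : ℕ) < v.length) {a : ℕ}
    (ha : (a : ℤ) = (((nb (e x)).map fun j => v.getD j 0).sum : ℕ) - (v.getD (e x) 0 : ℕ)) :
    simpleReflection x (vec e v) = vec e (v.set (e x) a) := by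
  rw [simpleReflection_eq, hd.coroot_vec]
  ext y
  rw [Pi.sub_apply, Pi.smul_apply, simpleRoot, Pi.single_apply, vec, vec]
  by_cases h : y = x
  · subst h
    rw [if_pos rfl, smul_eq_mul, mul_one,
      List.getD_eq_getElem (v.set (e y) a) _ (by simpa using hx), List.getElem_set_self, ha]
    ring
  · have : (e x : ℕ) ≠ e y := fun h' => h (e.injective (Fin.ext h'.symm))
    rw [if_neg h, smul_zero, sub_zero]
    simp [List.getD, List.getElem?_set_ne this]

theorem Describes.raise {x : V} {v v' : List ℕ} (h : raise nb v (e x) = some v') :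
    vec e v ≤ simpleReflection x (vec e v) ∧ simpleReflection x (vec e v) = vec e v' := by
  obtain ⟨h1, h2, rfl⟩ := raise_eq_some h
  refine ⟨le_simpleReflection ?_, hd.reflection_vec x h1 (by omega)⟩
  rw [hd.coroot_vec]
  omega

theorem Describes.raiseAlong {W : List V} {v v' : List ℕ}
    (h : raiseAlong nb v (W.map fun x => (e x : ℕ)) = some v') :
    MonoAlong (· ≤ ·) (vec e v) W ∧ act (vec e v) W = vec e v' := by
  induction W generalizing v with
  | nil =>
    rw [List.map_nil, LeeLee.raiseAlong, Option.some_inj] at h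
    exact ⟨trivial, by rw [h]; rfl⟩
  | cons x W ih =>
    rw [List.map_cons, LeeLee.raiseAlong, Option.bind_eq_some_iff] at h
    obtain ⟨v1, h1, h2⟩ := h
    obtain ⟨h3, h4⟩ := hd.raise h1
    have := ih h2
    rw [← h4] at this
    exact ⟨⟨h3, this.1⟩, this.2⟩

theorem Describes.insertVertex {x : V} {L : List V} {L' : List ℕ}
    (h : insertVertex arr (L.map fun x => (e x : ℕ)) (e x) = some L') :
    x ∉ L ∧ ((∀ y ∈ L, IsEmpty (x ⟶ y)) ∧ L' = (L ++ [x]).map (fun x => (e x : ℕ)) ∨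
      (∀ y ∈ L, IsEmpty (y ⟶ x)) ∧ L' = (x :: L).map (fun x => (e x : ℕ))) := by
  rw [LeeLee.insertVertex, cond_eq_ite, Option.ite_none_left_eq_some, cond_eq_ite,
    cond_eq_ite, evalList_eq, evalList_eq] at h
  obtain ⟨h1, h2⟩ := h
  refine ⟨fun hx => h1 ?_, ?_⟩
  · rw [List.contains_iff_mem]
    exact List.mem_map_of_mem hx
  split_ifs at h2 with h3 h4
  · rw [List.all_eq_true] at h3
    refine .inl ⟨fun y hy => hd.isEmpty _ _ ?_, ?_⟩
    · simpa using h3 _ (List.mem_map_of_mem hy)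
    · rw [List.map_append]; exact (Option.some_inj.1 h2).symm
  · rw [List.all_eq_true] at h4
    refine .inr ⟨fun y hy => hd.isEmpty _ _ ?_, ?_⟩
    · simpa using h4 _ (List.mem_map_of_mem hy)
    · exact (Option.some_inj.1 h2).symm

theorem Describes.run {L : List V} {v : List ℕ} (hv : v.length = N)
    (h : Reach (· ≤ ·) L (vec e v)) {m : Move} {s : List ℕ × List ℕ}
    (hs : m.run nb arr (L.map fun x => (e x : ℕ), v) = some s) :
    ∃ L' : List V, s.1 = L'.map (fun x => (e x : ℕ)) ∧ s.2.length = N ∧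
      Reach (· ≤ ·) L' (vec e s.2) := by
  cases m with
  | add u =>
    rw [Move.run, cond_eq_ite, Option.ite_none_right_eq_some, Nat.blt_eq,
      Option.map_eq_some_iff] at hs
    obtain ⟨hu, L', h1, rfl⟩ := hs
    obtain ⟨x, rfl⟩ : ∃ x : V, (e x : ℕ) = u := ⟨e.symm ⟨u, hv ▸ hu⟩, by simp⟩
    obtain ⟨hx, ⟨h2, h3⟩ | ⟨h2, h3⟩⟩ := hd.insertVertex h1
    exacts [⟨_, h3, hv, h.addRight hx h2⟩, ⟨_, h3, hv, h.addLeft hx h2⟩]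
  | push u =>
    rw [Move.run, Option.bind_eq_some_iff] at hs
    obtain ⟨L', h1, hs⟩ := hs
    rw [Option.map_eq_some_iff] at hs
    obtain ⟨v', h4, rfl⟩ := hs
    obtain ⟨hu, -, h5⟩ := raise_eq_some h4
    obtain ⟨x, rfl⟩ : ∃ x : V, (e x : ℕ) = u := ⟨e.symm ⟨u, hv ▸ hu⟩, by simp⟩
    have hl : v'.length = N := by rw [← h5, List.length_set, hv]
    obtain ⟨h6, h7⟩ := hd.raise h4
    obtain ⟨hx, ⟨h2, h3⟩ | ⟨h2, h3⟩⟩ := hd.insertVertex h1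
    · exact ⟨_, h3, hl, by rw [← h7]; exact h.pushRight hx h2 h6⟩
    · exact ⟨_, h3, hl, by rw [← h7]; exact h.pushLeft hx h2 h6⟩
  | pass rev =>
    rw [Move.run, Option.map_eq_some_iff] at hs
    obtain ⟨v', h1, rfl⟩ := hs
    have h2 : ∃ O : List V, (O = L ∨ O = L.reverse) ∧
        LeeLee.raiseAlong nb v (O.map fun x => (e x : ℕ)) = some v' := by
      cases rev
      · exact ⟨L, .inl rfl, h1⟩
      · exact ⟨L.reverse, .inr rfl, by rw [List.map_reverse]; exact h1⟩
    obtain ⟨O, hO, h3⟩ := h2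
    obtain ⟨h4, h5⟩ := hd.raiseAlong h3
    refine ⟨L, rfl, (length_of_raiseAlong h3).trans hv, ?_⟩
    rw [← h5]
    exact h.pass hO h4

theorem Describes.runMoves {l : List Move} {L : List V} {v : List ℕ} (hv : v.length = N)
    (h : Reach (· ≤ ·) L (vec e v)) {s : List ℕ × List ℕ}
    (hs : runMoves nb arr (L.map fun x => (e x : ℕ), v) l = some s) :
    ∃ L' : List V, s.1 = L'.map (fun x => (e x : ℕ)) ∧ Reach (· ≤ ·) L' (vec e s.2) := by
  induction l generalizing L v with
  | nil =>
    rw [LeeLee.runMoves, Option.some_inj] at hs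
    subst hs
    exact ⟨L, rfl, h⟩
  | cons m l ih =>
    rw [LeeLee.runMoves, Option.bind_eq_some_iff] at hs
    obtain ⟨⟨L1, v1⟩, h1, h2⟩ := hs
    obtain ⟨L2, rfl, h3, h4⟩ := hd.run hv h h1
    exact ih h3 h4 h2

end Soundness

/-! ### Searching for curves -/

/-- The reflection at the vertex `i`, when it does not increase the vector. -/
def lower (nb : ℕ → List ℕ) (v : List ℕ) (i : ℕ) : Option (List ℕ) :=
  evalNat ((nb i).map fun j => v.getD j 0).sum fun s => evalNat (v.getD i 0) fun a =>
    bif Nat.ble s (2 * a) && Nat.ble a s then evalList (v.set i (s - a)) some else none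

/-- The successive reflections along a word, when they do not increase the vector. -/
def lowerAlong (nb : ℕ → List ℕ) : List ℕ → List ℕ → Option (List ℕ)
  | v, [] => some v
  | v, i :: w => (lower nb v i).bind fun v' => lowerAlong nb v' w

/-- A backward search for a winding curve around the vertices in `B` which yields the vector `v`. The
result consists of its initial vertex and its moves. -/
def search (nb : ℕ → List ℕ) : ℕ → List ℕ → List ℕ → List Move → Option (ℕ × List Move)
  | 0, _, _, _ => none
  | _ + 1, [], _, _ => none
  | _ + 1, [k], _, l => some (k, l)
  | n + 1, B, v, l =>
    -- A vertex with coefficient 0 and at most one neighbour left can have been enclosed last,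
    -- without a crossing.
    match B.find? fun u => v.getD u 0 == 0 && Nat.ble ((nb u).filter B.contains).length 1 with
    | some u => evalList (B.erase u) fun B => search nb n B v (.add u :: l)
    | none =>
      -- A leaf with the coefficient of its neighbour arises by reflection from coefficient 0, so
      -- its ray can have been crossed last.
      match B.find? fun u => match (nb u).filter B.contains with
        | [t] => v.getD u 0 == v.getD t 0
        | _ => false with
      | some u => evalList (B.erase u) fun B => evalList (v.set u 0) fun v =>
        search nb n B v (.push u :: l)
      | none =>
        -- Otherwise the last move was a pass. Undoing it applies the same reflections in the
        -- opposite order, so `B` itself undoes the reversed pass; passes that change nothing are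
        -- rejected.
        ((lowerAlong nb v B).bind fun v' =>
            bif v' == v then none else search nb n B v' (.pass true :: l)).or
          ((lowerAlong nb v B.reverse).bind fun v' =>
            bif v' == v then none else search nb n B v' (.pass false :: l))

/-- The search with the vertices in `B` succeeds for the vector `v`, as confirmed by performing the
moves found. -/
def found (nb : ℕ → List ℕ) (arr : ℕ → ℕ → Bool) (N : ℕ) (B v : List ℕ) : Bool :=
  -- The bound 60 on the search is irrelevant for correctness, since the moves found are replayed
  -- forwards.
  match (search nb 60 B v []).bind fun p =>
      bif Nat.blt p.1 N then
        evalList (unitList N p.1) fun v => runMoves nb arr ([p.1], v) p.2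
      else none with
  | some (L, v') => L.length == N && v' == v
  | none => false

/-- A rectilinear curve: the vertices in the order of their marked points, the position of the
initial marked point, and the successive coordinates. -/
structure Drawing where
  order : List ℕ
  start : ℕ
  coordinates : List ℕ

/-- The list of vertices has no repetitions and no arrows in the wrong direction. -/
def sortedBy (arr : ℕ → ℕ → Bool) : List ℕ → Bool
  | [] => true
  | x :: l => l.all (fun y => !(x == y) && !arr y x) && sortedBy arr l

/-- The drawing is that of a non-self-crossing curve with non-decreasing vectors which yields
the vector `v`. -/
def Drawing.yields (nb : ℕ → List ℕ) (arr : ℕ → ℕ → Bool) (N c : ℕ) (D : Drawing) (v : List ℕ) :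
    Bool :=
  sortedBy arr D.order && D.order.length == N && D.order.all (fun x => Nat.blt x N) &&
    Nat.blt D.start N &&
    match Pen.draw c N true D.coordinates (Pen.start c D.start) with
    | some w => w.all (fun i => Nat.blt i N) &&
      raiseAlong nb (unitList N (D.order.getD D.start 0)) (w.map fun i => D.order.getD i 0) == some v
    | none => false

/-- The image of a drawing under the reflection of the half plane that reverses the order of the
marked points. -/
def Drawing.mirror (N c : ℕ) (D : Drawing) : Drawing :=
  ⟨D.order.reverse, N - 1 - D.start, flip true D.coordinates⟩
where
  /-- Replacing every second coordinate `x` by `c * (N + 1) - x`. -/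
  flip : Bool → List ℕ → List ℕ
  | _, [] => []
  | true, y :: l => y :: flip false l
  | false, x :: l => (c * (N + 1) - x) :: flip true l

/-! ### Successful searches and valid drawings realize vectors -/

section Soundness

variable {V : Type*} [Quiver V] [DecidableEq V] [Fintype V] {N : ℕ} {e : V ≃ Fin N}
  {nb : ℕ → List ℕ} {arr : ℕ → ℕ → Bool} (hd : Describes e nb arr)

include hd in
-- Nothing is assumed about the search: the replay produces the curve, and a list of `N` distinct
-- vertices contains all of them.
theorem Describes.realized_of_found {B v : List ℕ} (h : found nb arr N B v = true) :
    Realized (V := V) (· ≤ ·) N (vec e v) := by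
  rw [found] at h
  split at h
  · rename_i L v' hs
    rw [Option.bind_eq_some_iff] at hs
    obtain ⟨⟨k, l⟩, h1, h2⟩ := hs
    rw [evalList_eq, cond_eq_ite, Option.ite_none_right_eq_some, Nat.blt_eq] at h2
    obtain ⟨hk, h2⟩ := h2
    obtain ⟨x, hx⟩ : ∃ x : V, (e x : ℕ) = k := ⟨e.symm ⟨k, hk⟩, by simp⟩
    dsimp only at h2
    rw [← hx] at h2
    obtain ⟨L', h3, h4⟩ := hd.runMoves (L := [x]) (by simp [unitList])
      (by rw [vec_unitList]; exact .start x) h2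
    rw [Bool.and_eq_true, beq_iff_eq, beq_iff_eq] at h
    obtain ⟨h5, rfl⟩ := h
    dsimp only at h3 h4
    have hcard : Fintype.card V = N := by rw [Fintype.card_congr e, Fintype.card_fin]
    refine h4.realized (fun y => ?_) hcard
    have h6 : L'.toFinset = Finset.univ := by
      rw [← Finset.card_eq_iff_eq_univ, List.toFinset_card_of_nodup h4.1, hcard, ← h5, h3,
        List.length_map]
    rw [← List.mem_toFinset, h6]
    exact Finset.mem_univ y
  · cases h

omit [Quiver V] [DecidableEq V] [Fintype V] in
theorem exists_map_eq {L : List ℕ} (h : ∀ i ∈ L, i < N) (e : V ≃ Fin N) :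
    ∃ L' : List V, L'.map (fun x => (e x : ℕ)) = L := by
  induction L with
  | nil => exact ⟨[], rfl⟩
  | cons i L ih =>
    obtain ⟨L', rfl⟩ := ih fun j hj => h j (List.mem_cons_of_mem _ hj)
    exact ⟨e.symm ⟨i, h i List.mem_cons_self⟩ :: L', by simp⟩

include hd in
theorem Describes.nodup_and_sorted {L : List V}
    (h : sortedBy arr (L.map fun x => (e x : ℕ)) = true) : L.Nodup ∧ Sorted L := by
  induction L with
  | nil => exact ⟨.nil, .nil⟩
  | cons x L ih =>
    rw [List.map_cons, sortedBy, Bool.and_eq_true, List.all_eq_true] at h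
    obtain ⟨h1, h2⟩ := ih h.2
    have h3 : ∀ y ∈ L, x ≠ y ∧ arr (e y) (e x) = false := by
      intro y hy
      have := h.1 _ (List.mem_map_of_mem hy)
      rw [Bool.and_eq_true, Bool.not_eq_true', Bool.not_eq_true', beq_eq_false_iff_ne] at this
      exact ⟨fun hxy => this.1 (by rw [hxy]), this.2⟩
    exact ⟨List.nodup_cons.2 ⟨fun hx => (h3 x hx).1 rfl, h1⟩,
      List.pairwise_cons.2 ⟨fun y hy => hd.isEmpty _ _ (h3 y hy).2, h2⟩⟩

include hd in
theorem Describes.realized_of_yields {c : ℕ} (hc : 0 < c) {D : Drawing} {v : List ℕ}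
    (h : D.yields nb arr N c v = true) : Realized (V := V) (· ≤ ·) N (vec e v) := by
  rw [Drawing.yields] at h
  simp only [Bool.and_eq_true, beq_iff_eq, List.all_eq_true, Nat.blt_eq] at h
  obtain ⟨⟨⟨⟨h1, h2⟩, h3⟩, h4⟩, h5⟩ := h
  split at h5
  · rename_i w hw
    simp only [Bool.and_eq_true, beq_iff_eq, List.all_eq_true, Nat.blt_eq] at h5
    obtain ⟨h5, h6⟩ := h5
    obtain ⟨L, hL⟩ := exists_map_eq h3 e
    rw [← hL] at h1 h2 h6
    obtain ⟨h7, h8⟩ := hd.nodup_and_sorted h1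
    have hcard : Fintype.card V = N := by rw [Fintype.card_congr e, Fintype.card_fin]
    rw [List.length_map] at h2
    have h9 : ∀ x, x ∈ L := by
      have : L.toFinset = Finset.univ := by
        rw [← Finset.card_eq_iff_eq_univ, List.toFinset_card_of_nodup h7, hcard, h2]
      intro x
      rw [← List.mem_toFinset, this]
      exact Finset.mem_univ x
    subst h2
    obtain ⟨w', rfl⟩ := exists_map_eq h5 (Equiv.refl (Fin L.length))
    set π := listEquiv L h7 h9 with hπ
    have hget : ∀ i : Fin L.length,
        (L.map fun x => (e x : ℕ)).getD i 0 = e (π i) := fun i => by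
      rw [List.getD_eq_getElem _ _ (by simp), List.getElem_map]; rfl
    rw [List.map_map] at h6
    have h6' : LeeLee.raiseAlong nb (unitList L.length (e (π ⟨D.start, h4⟩)))
        ((w'.map π).map fun x => (e x : ℕ)) = some v := by
      rw [← h6, ← hget, List.map_map]
      congr 1
      exact List.map_congr_left fun i _ => (hget i).symm
    obtain ⟨h10, h11⟩ := hd.raiseAlong h6'
    rw [vec_unitList] at h10 h11
    refine realized_of_word (listEquiv_mem L h7 h9 h8) h10 h11 ?_
    have := exists_curve_of_draw hc h4 (w := w') hw
    rw [← hπ, Equiv.symm_apply_apply]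
    simpa [Function.comp_def] using this
  · cases h5

end Soundness

/-! ### Orientations and roots -/

/-- The orientation of the given edges determined by a list of Booleans. -/
def arrows (edges : List (ℕ × ℕ)) (o : List Bool) (i j : ℕ) : Bool :=
  (edges.zip o).any fun p =>
    bif p.2 then p.1.1 == i && p.1.2 == j else p.1.1 == j && p.1.2 == i

/-- All lists of Booleans of the given length. -/
def boolLists : ℕ → List (List Bool)
  | 0 => [[]]
  | n + 1 => (boolLists n).flatMap fun l => [true :: l, false :: l]

theorem mem_boolLists (l : List Bool) : l ∈ boolLists l.length := by
  induction l with
  | nil => simp [boolLists]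
  | cons b l ih =>
    rw [List.length_cons, boolLists, List.mem_flatMap]
    exact ⟨l, ih, by cases b <;> simp⟩

/-- The adjacency matrix of the oriented graph, as the binary expansion of a number. -/
def arrowCode (edges : List (ℕ × ℕ)) (o : List Bool) : ℕ :=
  -- The bit of the pair `(i, j)` has position `8 * i + j`, which separates pairs because there are
  -- fewer than 8 vertices.
  (edges.zip o).foldl (fun m p => m + 2 ^ bif p.2 then 8 * p.1.1 + p.1.2 else 8 * p.1.2 + p.1.1) 0

/-- The entry of the adjacency matrix encoded by a number. -/
def codedArrow (m i j : ℕ) : Bool := Nat.beq (Nat.land (Nat.shiftRight m (8 * i + j)) 1) 1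

/-- The adjacency matrix encoded by the number contains all arrows between the first `N` vertices. -/
def encodes (N : ℕ) (edges : List (ℕ × ℕ)) (o : List Bool) (m : ℕ) : Bool :=
  (List.range N).all fun i => (List.range N).all fun j => codedArrow m i j || !arrows edges o i j

theorem arrows_eq_false_of_encodes {N : ℕ} {edges : List (ℕ × ℕ)} {o : List Bool} {m : ℕ}
    (h : encodes N edges o m = true) {i j : ℕ} (hi : i < N) (hj : j < N)
    (hij : codedArrow m i j = false) : arrows edges o i j = false := by
  simp only [encodes, List.all_eq_true, List.mem_range] at h
  simpa [hij] using h i hi j hj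

/-- The list of vectors contains the simple roots, and up to sign it is stable under reflections. -/
def isStable (nb : ℕ → List ℕ) (N : ℕ) (S : List (List ℕ)) : Bool :=
  (List.range N).all (fun i => S.contains (unitList N i)) &&
  S.all fun v => v.length == N && (List.range N).all fun i =>
    let s := ((nb i).map fun j => v.getD j 0).sum
    -- The comparison makes the truncated subtraction exact. Only `α_i` itself may fail it, as its
    -- reflection is `-α_i`.
    (Nat.ble (v.getD i 0) s && S.contains (v.set i (s - v.getD i 0))) || v == unitList N i

section Diagrams

variable {V : Type*} [Quiver V] [DecidableEq V] [Fintype V] {N : ℕ} {e : V ≃ Fin N}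
  {nb : ℕ → List ℕ} {arr : ℕ → ℕ → Bool}

/-- The vectors of `S` and their negatives contain the simple roots and are closed under simple
reflections. That `S` consists of roots is not needed. -/
theorem Describes.rootSystem_subset (hd : Describes e nb arr) {S : List (List ℕ)}
    (hS : isStable nb N S = true) {β : V → ℤ} (hβ : β ∈ rootSystem V) :
    ∃ v ∈ S, β = vec e v ∨ β = -vec e v := by
  simp only [isStable, Bool.and_eq_true, List.all_eq_true, List.mem_range, List.contains_iff_mem,
    beq_iff_eq, Bool.or_eq_true, Nat.ble_eq] at hS
  obtain ⟨h1, h2⟩ := hS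
  have key : ∀ (x : V), ∀ v ∈ S, ∃ v' ∈ S, simpleReflection x (vec e v) = vec e v' ∨
      simpleReflection x (vec e v) = -vec e v' := by
    intro x v hv
    obtain ⟨h3, h4⟩ := h2 v hv
    rcases h4 (e x) (e x).2 with ⟨h5, h6⟩ | h5
    · exact ⟨_, h6, .inl (hd.reflection_vec x (h3 ▸ (e x).2) (by omega))⟩
    · refine ⟨v, hv, .inr ?_⟩
      rw [h5, vec_unitList, simpleReflection_simpleRoot, cartan_self]
      module
  refine rootSystem_induction (P := fun β => ∃ v ∈ S, β = vec e v ∨ β = -vec e v) (fun x => ?_) ?_ hβ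
  · exact ⟨_, h1 (e x) (e x).2, .inl (vec_unitList e x).symm⟩
  · rintro x _ ⟨v, hv, rfl | rfl⟩
    · exact key x v hv
    · obtain ⟨v', hv', h | h⟩ := key x v hv
      · exact ⟨v', hv', .inr (by rw [map_neg, h])⟩
      · exact ⟨v', hv', .inl (by rw [map_neg, h, neg_neg])⟩

theorem Describes.exists_of_mem_positiveRoots (hd : Describes e nb arr) {S : List (List ℕ)}
    (hS : isStable nb N S = true) {β : V → ℤ} (hβ : β ∈ positiveRoots V) :
    ∃ v ∈ S, β = vec e v := by
  obtain ⟨v, hv, rfl | rfl⟩ := hd.rootSystem_subset hS hβ.1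
  · exact ⟨v, hv, rfl⟩
  · refine absurd hβ.2 (not_lt_of_ge ?_)
    rw [neg_nonpos]
    exact fun x => Int.natCast_nonneg _

variable [∀ i j : V, Finite (i ⟶ j)] (hQ : IsAcyclicQuiver V)

include hQ in
-- The Boolean of an edge `(i, j)` says whether some arrow goes from `i` to `j`. By acyclicity an
-- arrow from `j` to `i` forces the value false, so every arrow is accounted for.
theorem exists_orientation (e : V ≃ Fin N) (edges : List (ℕ × ℕ))
    (h : ∀ x y : V, cartan x y = 0 ∨ x = y ∨ ((e x : ℕ), (e y : ℕ)) ∈ edges ∨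
      ((e y : ℕ), (e x : ℕ)) ∈ edges) :
    ∃ o ∈ boolLists edges.length, ∀ x y : V, arrows edges o (e x) (e y) = false →
      IsEmpty (x ⟶ y) := by
  classical
  let f : ℕ × ℕ → Bool := fun p => decide (∃ x y : V, (e x : ℕ) = p.1 ∧ (e y : ℕ) = p.2 ∧
    Nonempty (x ⟶ y))
  have hf : ∀ x y : V, f (e x, e y) = true ↔ Nonempty (x ⟶ y) := by
    intro x y
    rw [decide_eq_true_iff]
    refine ⟨?_, fun h => ⟨x, y, rfl, rfl, h⟩⟩
    rintro ⟨x', y', h1, h2, h3⟩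
    rwa [e.injective (Fin.ext h1), e.injective (Fin.ext h2)] at h3
  refine ⟨edges.map f, by simpa using mem_boolLists (edges.map f), fun x y hxy => ?_⟩
  by_contra hne
  rw [not_isEmpty_iff] at hne
  have hmem : ∀ p ∈ edges, (p, f p) ∈ edges.zip (edges.map f) := by
    intro p hp
    rw [← List.map_prod_left_eq_zip]
    exact List.mem_map_of_mem hp
  rw [arrows, List.any_eq_false] at hxy
  rcases h x y with h1 | rfl | h1 | h1
  · exact not_nonempty_iff.2 (isEmpty_of_cartan_eq_zero hQ h1).1 hne
  · rcases isEmpty_or_isEmpty hQ x x with h2 | h2 <;> exact not_nonempty_iff.2 h2 hne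
  · refine hxy _ (hmem _ h1) ?_
    rw [(hf x y).2 hne]
    simp
  · have h2 : f (e y, e x) = false := by
      rw [Bool.eq_false_iff, ne_eq, hf, not_nonempty_iff]
      exact (isEmpty_or_isEmpty hQ x y).resolve_left (not_isEmpty_iff.2 hne)
    refine hxy _ (hmem _ h1) ?_
    rw [h2]
    simp

end Diagrams

/-! ### The diagrams of type `E₆` and `E₇` -/

/-- The edges of the diagram of type `E₆`, in the numbering of its Cartan matrix. -/
def edgesE₆ : List (ℕ × ℕ) := [(0, 2), (1, 3), (2, 3), (3, 4), (4, 5)]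

/-- The neighbours of the vertices of the diagram of type `E₆`. -/
def neighborsE₆ : ℕ → List ℕ
  | 0 => [2]
  | 1 => [3]
  | 2 => [0, 3]
  | 3 => [1, 2, 4]
  | 4 => [3, 5]
  | 5 => [4]
  | _ => []

/-- The edges of the diagram of type `E₇`, in the numbering of its Cartan matrix. -/
def edgesE₇ : List (ℕ × ℕ) := [(0, 2), (1, 3), (2, 3), (3, 4), (4, 5), (5, 6)]

/-- The neighbours of the vertices of the diagram of type `E₇`. -/
def neighborsE₇ : ℕ → List ℕ
  | 0 => [2]
  | 1 => [3]
  | 2 => [0, 3]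
  | 3 => [1, 2, 4]
  | 4 => [3, 5]
  | 5 => [4, 6]
  | 6 => [5]
  | _ => []

/-- The positive roots of type `E₆`. -/
def rootsE₆ : List (List ℕ) := [
  [1, 0, 0, 0, 0, 0], [0, 1, 0, 0, 0, 0], [0, 0, 1, 0, 0, 0], [0, 0, 0, 1, 0, 0],
  [0, 0, 0, 0, 1, 0], [0, 0, 0, 0, 0, 1], [1, 0, 1, 0, 0, 0], [0, 1, 0, 1, 0, 0],
  [0, 0, 1, 1, 0, 0], [0, 0, 0, 1, 1, 0], [0, 0, 0, 0, 1, 1], [1, 0, 1, 1, 0, 0],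
  [0, 1, 1, 1, 0, 0], [0, 1, 0, 1, 1, 0], [0, 0, 1, 1, 1, 0], [0, 0, 0, 1, 1, 1],
  [1, 1, 1, 1, 0, 0], [1, 0, 1, 1, 1, 0], [0, 1, 1, 1, 1, 0], [0, 1, 0, 1, 1, 1],
  [0, 0, 1, 1, 1, 1], [1, 1, 1, 1, 1, 0], [1, 0, 1, 1, 1, 1], [0, 1, 1, 2, 1, 0],
  [0, 1, 1, 1, 1, 1], [1, 1, 1, 2, 1, 0], [1, 1, 1, 1, 1, 1], [0, 1, 1, 2, 1, 1],
  [1, 1, 2, 2, 1, 0], [1, 1, 1, 2, 1, 1], [0, 1, 1, 2, 2, 1], [1, 1, 2, 2, 1, 1],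
  [1, 1, 1, 2, 2, 1], [1, 1, 2, 2, 2, 1], [1, 1, 2, 3, 2, 1], [1, 2, 2, 3, 2, 1]]

/-- The positive roots of type `E₇`. -/
def rootsE₇ : List (List ℕ) := [
  [1, 0, 0, 0, 0, 0, 0], [0, 1, 0, 0, 0, 0, 0], [0, 0, 1, 0, 0, 0, 0], [0, 0, 0, 1, 0, 0, 0],
  [0, 0, 0, 0, 1, 0, 0], [0, 0, 0, 0, 0, 1, 0], [0, 0, 0, 0, 0, 0, 1], [1, 0, 1, 0, 0, 0, 0],
  [0, 1, 0, 1, 0, 0, 0], [0, 0, 1, 1, 0, 0, 0], [0, 0, 0, 1, 1, 0, 0], [0, 0, 0, 0, 1, 1, 0],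
  [0, 0, 0, 0, 0, 1, 1], [1, 0, 1, 1, 0, 0, 0], [0, 1, 1, 1, 0, 0, 0], [0, 1, 0, 1, 1, 0, 0],
  [0, 0, 1, 1, 1, 0, 0], [0, 0, 0, 1, 1, 1, 0], [0, 0, 0, 0, 1, 1, 1], [1, 1, 1, 1, 0, 0, 0],
  [1, 0, 1, 1, 1, 0, 0], [0, 1, 1, 1, 1, 0, 0], [0, 1, 0, 1, 1, 1, 0], [0, 0, 1, 1, 1, 1, 0],
  [0, 0, 0, 1, 1, 1, 1], [1, 1, 1, 1, 1, 0, 0], [1, 0, 1, 1, 1, 1, 0], [0, 1, 1, 2, 1, 0, 0],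
  [0, 1, 1, 1, 1, 1, 0], [0, 1, 0, 1, 1, 1, 1], [0, 0, 1, 1, 1, 1, 1], [1, 1, 1, 2, 1, 0, 0],
  [1, 1, 1, 1, 1, 1, 0], [1, 0, 1, 1, 1, 1, 1], [0, 1, 1, 2, 1, 1, 0], [0, 1, 1, 1, 1, 1, 1],
  [1, 1, 2, 2, 1, 0, 0], [1, 1, 1, 2, 1, 1, 0], [1, 1, 1, 1, 1, 1, 1], [0, 1, 1, 2, 2, 1, 0],
  [0, 1, 1, 2, 1, 1, 1], [1, 1, 2, 2, 1, 1, 0], [1, 1, 1, 2, 2, 1, 0], [1, 1, 1, 2, 1, 1, 1],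
  [0, 1, 1, 2, 2, 1, 1], [1, 1, 2, 2, 2, 1, 0], [1, 1, 2, 2, 1, 1, 1], [1, 1, 1, 2, 2, 1, 1],
  [0, 1, 1, 2, 2, 2, 1], [1, 1, 2, 3, 2, 1, 0], [1, 1, 2, 2, 2, 1, 1], [1, 1, 1, 2, 2, 2, 1],
  [1, 2, 2, 3, 2, 1, 0], [1, 1, 2, 3, 2, 1, 1], [1, 1, 2, 2, 2, 2, 1], [1, 2, 2, 3, 2, 1, 1],
  [1, 1, 2, 3, 2, 2, 1], [1, 2, 2, 3, 2, 2, 1], [1, 1, 2, 3, 3, 2, 1], [1, 2, 2, 3, 3, 2, 1],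
  [1, 2, 2, 4, 3, 2, 1], [1, 2, 3, 4, 3, 2, 1], [2, 2, 3, 4, 3, 2, 1]]

/-- A list of the vertices in which the arrows go from left to right, where each vertex of
`L` is a leaf of the diagram spanned by the preceding ones. -/
def sortVertices (arr : ℕ → ℕ → Bool) (L : List ℕ) : List ℕ :=
  L.foldl (fun B u => (insertVertex arr B u).getD B) []

theorem isStable_rootsE₆ : isStable neighborsE₆ 6 rootsE₆ = true := by decide +kernel

theorem isStable_rootsE₇ : isStable neighborsE₇ 7 rootsE₇ = true := by decide +kernel

/-- For each of the 32 orientations a single sorted list of vertices guides the search, and winding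
curves realize all 36 positive roots. -/
theorem found_typeE₆ : ((boolLists 5).all fun o =>
    evalNat (arrowCode edgesE₆ o) fun m =>
    evalList (sortVertices (codedArrow m) [0, 2, 3, 4, 5, 1]) fun B =>
    encodes 6 edgesE₆ o m && rootsE₆.all fun v => found neighborsE₆ (codedArrow m) 6 B v) = true := by decide +kernel

/-- Curves for the roots of type `E₇` which are not obtained from winding curves, for half of the
orientations; the other half is obtained by reflection. -/
def drawingsE₇ : List Drawing := [
  ⟨[0, 2, 3, 4, 5, 1, 6], 0,
    [15, 17, 21, 37, 15, 38, 20, 52, 15, 53, 19, 67, 15, 68, 18, 82, 15, 83, 17, 97, 15, 98,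
    17, 113, 8, 19, 19, 35, 13, 40, 18, 50, 13, 55, 17, 65, 10, 21, 17, 33, 11, 49, 17, 41,
    12, 34, 18, 20, 9, 81, 17, 69, 14, 66, 18, 54, 14, 51, 19, 39, 14, 36, 20, 18, 1]⟩,
  ⟨[0, 2, 3, 1, 5, 4, 6], 1,
    [14, 35, 20, 52, 14, 55, 17, 65, 12, 86, 17, 97, 11, 51, 19, 36, 13, 1, 17, 17, 15, 18, 17,
    33, 15, 34, 21, 53, 15, 54, 18, 66, 15, 67, 18, 82, 15, 83, 20, 100, 15, 101, 17, 113, 8,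
    38, 17, 49, 9, 99, 19, 84, 14, 81, 17, 68, 13, 85, 18, 98, 10, 50, 18, 37, 1]⟩,
  ⟨[5, 1, 0, 2, 3, 4, 6], 6,
    [9, 2, 17, 17, 10, 98, 18, 84, 15, 83, 19, 69, 15, 68, 20, 50, 15, 49, 17, 34, 15, 33, 17,
    19, 14, 51, 19, 67, 14, 70, 18, 82, 14, 85, 17, 97, 11, 53, 17, 65, 12, 81, 17, 71, 13,
    66, 18, 52, 13, 18, 18, 1, 1]⟩,
  ⟨[0, 2, 3, 1, 4, 6, 5], 1,
    [14, 35, 20, 52, 14, 55, 17, 65, 14, 68, 19, 83, 14, 99, 17, 113, 13, 82, 18, 69, 13, 51,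
    19, 36, 13, 1, 17, 17, 15, 18, 17, 33, 15, 34, 21, 53, 15, 54, 18, 66, 15, 67, 20, 84, 15,
    85, 17, 97, 15, 98, 18, 114, 10, 38, 17, 49, 11, 81, 17, 70, 12, 50, 18, 37, 1]⟩,
  ⟨[0, 2, 3, 1, 6, 5, 4], 3,
    [15, 51, 19, 35, 15, 34, 18, 18, 15, 17, 17, 1, 10, 114, 18, 100, 14, 97, 17, 83, 13, 49,
    17, 37, 12, 101, 17, 113, 11, 19, 17, 33, 14, 36, 18, 50, 14, 65, 17, 81, 15, 82, 18, 98,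
    15, 99, 19, 115, 1]⟩,
  ⟨[6, 5, 0, 1, 2, 3, 4], 0,
    [15, 17, 18, 34, 11, 114, 18, 101, 14, 98, 18, 84, 14, 81, 17, 68, 14, 65, 17, 51, 13, 85,
    17, 97, 13, 102, 17, 113, 12, 35, 17, 49, 15, 50, 18, 66, 15, 67, 18, 82, 15, 83, 19, 99,
    15, 100, 19, 115, 10, 33, 17, 18, 1]⟩,
  ⟨[3, 0, 2, 1, 4, 5, 6], 5,
    [14, 99, 17, 113, 13, 83, 19, 67, 8, 3, 18, 18, 11, 50, 18, 35, 14, 21, 17, 33, 15, 34, 19,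
    51, 15, 52, 17, 65, 10, 17, 17, 4, 9, 66, 20, 84, 15, 85, 17, 97, 15, 98, 18, 114, 12, 82,
    18, 68, 7, 2, 19, 19, 12, 49, 17, 36, 13, 20, 20, 1, 6, 69, 17, 81, 1]⟩,
  ⟨[5, 6, 0, 3, 1, 2, 4], 1,
    [15, 18, 18, 1, 7, 114, 18, 100, 10, 52, 18, 66, 13, 97, 17, 84, 14, 81, 17, 70, 14, 67,
    19, 51, 9, 101, 17, 113, 8, 2, 17, 17, 14, 33, 17, 49, 15, 50, 20, 68, 15, 69, 18, 82, 15,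
    83, 18, 98, 12, 65, 17, 53, 11, 99, 19, 115, 1]⟩,
  ⟨[5, 6, 0, 1, 3, 4, 2], 3,
    [15, 65, 19, 83, 15, 84, 18, 98, 15, 99, 18, 114, 12, 2, 17, 17, 14, 35, 17, 49, 13, 67,
    17, 81, 13, 113, 17, 100, 14, 97, 17, 85, 14, 82, 18, 66, 14, 50, 18, 34, 15, 33, 17, 19,
    15, 18, 18, 1, 1]⟩,
  ⟨[3, 0, 2, 1, 4, 6, 5], 6,
    [14, 83, 19, 67, 8, 3, 18, 18, 11, 50, 18, 35, 14, 21, 17, 33, 15, 34, 19, 51, 15, 52, 17,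
    65, 10, 17, 17, 4, 9, 66, 20, 84, 15, 85, 17, 97, 15, 98, 17, 113, 13, 82, 18, 68, 7, 2,
    19, 19, 12, 49, 17, 36, 13, 20, 20, 1, 6, 69, 17, 81, 1]⟩,
  ⟨[3, 0, 1, 6, 5, 2, 4], 6,
    [9, 2, 19, 19, 14, 35, 17, 49, 14, 67, 17, 81, 14, 84, 17, 97, 13, 18, 18, 3, 10, 100, 17,
    113, 8, 1, 20, 20, 15, 21, 17, 33, 15, 34, 18, 50, 15, 51, 17, 65, 15, 66, 18, 82, 15, 83,
    18, 98, 12, 17, 17, 4, 11, 99, 18, 114, 1]⟩,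
  ⟨[1, 6, 3, 0, 5, 4, 2], 2,
    [12, 114, 18, 99, 15, 98, 18, 84, 15, 83, 19, 66, 15, 65, 17, 52, 15, 51, 19, 34, 15, 33,
    17, 18, 15, 17, 17, 1, 14, 35, 18, 50, 14, 67, 18, 82, 14, 85, 17, 97, 14, 100, 17, 113,
    13, 81, 17, 68, 13, 49, 17, 36, 1]⟩,
  ⟨[2, 3, 1, 4, 5, 6, 0], 6,
    [6, 1, 21, 21, 15, 22, 20, 36, 15, 37, 17, 49, 15, 50, 19, 67, 15, 68, 18, 82, 15, 83, 17,
    97, 8, 3, 19, 19, 13, 24, 18, 34, 13, 52, 17, 65, 10, 5, 17, 17, 11, 33, 17, 25, 12, 18,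
    18, 4, 9, 81, 17, 69, 14, 66, 18, 51, 14, 35, 19, 23, 14, 20, 20, 2, 7, 98, 17, 113, 1]⟩,
  ⟨[2, 3, 0, 1, 5, 6, 4], 1,
    [12, 99, 18, 114, 9, 1, 18, 18, 15, 19, 19, 35, 15, 36, 17, 49, 15, 50, 17, 65, 15, 66, 19,
    83, 15, 84, 17, 97, 14, 82, 18, 67, 14, 34, 18, 20, 14, 17, 17, 2, 10, 113, 17, 100, 11,
    21, 17, 33, 13, 68, 17, 81, 13, 98, 19, 115, 1]⟩,
  ⟨[1, 2, 0, 3, 5, 6, 4], 4,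
    [14, 99, 17, 113, 13, 67, 19, 51, 14, 33, 17, 20, 14, 17, 17, 2, 13, 52, 18, 66, 12, 114,
    18, 98, 15, 97, 17, 82, 15, 81, 17, 69, 15, 68, 20, 50, 15, 49, 17, 35, 15, 34, 18, 19,
    15, 18, 18, 1, 12, 53, 17, 65, 1]⟩,
  ⟨[2, 0, 6, 3, 1, 4, 5], 3,
    [12, 83, 19, 99, 14, 102, 18, 114, 7, 1, 18, 18, 15, 19, 17, 33, 15, 34, 17, 49, 15, 50,
    19, 67, 15, 68, 17, 81, 14, 66, 18, 51, 10, 85, 17, 97, 9, 17, 17, 2, 8, 113, 17, 103, 13,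
    98, 18, 84, 11, 52, 17, 65, 13, 82, 20, 100, 15, 101, 19, 115, 1]⟩,
  ⟨[2, 3, 1, 0, 6, 5, 4], 2,
    [15, 35, 19, 19, 15, 18, 18, 1, 10, 114, 18, 100, 14, 97, 17, 83, 14, 65, 17, 50, 13, 33,
    17, 21, 12, 101, 17, 113, 11, 2, 17, 17, 14, 20, 18, 34, 14, 49, 18, 66, 15, 67, 17, 81,
    15, 82, 18, 98, 15, 99, 19, 115, 1]⟩,
  ⟨[1, 2, 3, 0, 6, 5, 4], 4,
    [15, 81, 18, 98, 15, 99, 18, 114, 12, 50, 18, 37, 13, 2, 17, 17, 14, 20, 17, 33, 14, 36,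
    19, 51, 13, 113, 17, 100, 14, 97, 17, 82, 14, 65, 17, 53, 15, 52, 20, 35, 15, 34, 18, 19,
    15, 18, 18, 1, 12, 38, 17, 49, 1]⟩,
  ⟨[3, 2, 1, 4, 0, 5, 6], 5,
    [14, 67, 19, 52, 12, 3, 17, 17, 13, 49, 17, 36, 14, 33, 17, 21, 14, 18, 18, 2, 11, 53, 18,
    66, 13, 113, 17, 98, 15, 97, 17, 82, 15, 81, 17, 69, 15, 68, 20, 51, 15, 50, 18, 35, 15,
    34, 18, 20, 15, 19, 19, 1, 10, 54, 17, 65, 1]⟩,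
  ⟨[3, 2, 1, 0, 5, 6, 4], 5,
    [15, 82, 18, 66, 12, 99, 18, 114, 9, 2, 18, 18, 14, 21, 17, 33, 14, 36, 17, 49, 13, 17, 17,
    3, 10, 113, 17, 100, 11, 65, 17, 51, 15, 50, 18, 35, 15, 34, 18, 20, 15, 19, 19, 1, 8,
    115, 19, 98, 13, 67, 17, 81, 14, 97, 20, 116, 1]⟩,
  ⟨[5, 6, 1, 3, 2, 0, 4], 2,
    [15, 49, 19, 67, 15, 68, 18, 82, 15, 83, 17, 97, 15, 98, 18, 114, 12, 2, 17, 17, 13, 51,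
    17, 65, 13, 113, 17, 99, 14, 81, 17, 69, 14, 66, 18, 50, 14, 33, 17, 19, 15, 18, 18, 1, 1]⟩,
  ⟨[3, 2, 1, 0, 4, 6, 5], 5,
    [15, 97, 18, 114, 12, 82, 18, 68, 11, 2, 18, 18, 14, 21, 17, 33, 14, 36, 17, 49, 13, 17,
    17, 3, 12, 67, 19, 83, 13, 113, 17, 98, 14, 84, 20, 66, 15, 65, 17, 51, 15, 50, 18, 35,
    15, 34, 18, 20, 15, 19, 19, 1, 10, 69, 17, 81, 1]⟩,
  ⟨[3, 2, 6, 0, 1, 5, 4], 5,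
    [14, 99, 20, 116, 7, 1, 19, 19, 15, 20, 18, 34, 15, 35, 17, 49, 15, 50, 17, 65, 15, 66, 17,
    81, 12, 101, 18, 114, 9, 3, 17, 17, 10, 113, 17, 102, 11, 33, 17, 21, 14, 18, 18, 2, 8,
    115, 19, 100, 13, 82, 17, 97, 15, 98, 21, 117, 1]⟩,
  ⟨[6, 5, 1, 3, 4, 2, 0], 2,
    [15, 49, 19, 67, 15, 68, 18, 82, 15, 83, 18, 98, 15, 99, 17, 113, 10, 2, 18, 18, 14, 21,
    17, 33, 13, 51, 17, 65, 12, 17, 17, 3, 11, 97, 17, 84, 14, 81, 17, 69, 14, 66, 18, 50, 14,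
    34, 18, 20, 15, 19, 19, 1, 1]⟩]

set_option maxHeartbeats 8000000 in
-- For some of the 64 orientations and 63 roots the search does not supply a winding curve, and a
-- drawing takes over. On the grid, consecutive marked points are 16 units apart, which leaves room
-- for many nested strands. Mirrored drawings are checked in full like the others, so no symmetry
-- argument is required.
theorem found_or_yields_typeE₇ : ((boolLists 6).all fun o =>
    evalNat (arrowCode edgesE₇ o) fun m =>
    evalList (sortVertices (codedArrow m) [0, 2, 3, 4, 5, 6, 1]) fun B =>
    encodes 7 edgesE₇ o m && rootsE₇.all fun v => found neighborsE₇ (codedArrow m) 7 B v ||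
      drawingsE₇.any fun D => D.yields neighborsE₇ (codedArrow m) 7 16 v ||
        (D.mirror 7 16).yields neighborsE₇ (codedArrow m) 7 16 v) = true := by
  decide +kernel

section TypeE

variable {V : Type*} [Quiver V] [DecidableEq V] [Fintype V]
  [∀ i j : V, Finite (i ⟶ j)] (hQ : IsAcyclicQuiver V)

omit [∀ i j : V, Finite (i ⟶ j)] in
theorem coroot_eq_sum {N : ℕ} (e : V ≃ Fin N) {A : Matrix (Fin N) (Fin N) ℤ}
    (h : ∀ i j : V, cartan i j = A (e i) (e j)) (x : V) (f : ℕ → ℤ) :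
    coroot x (fun y => f (e y)) = ∑ j, A (e x) j * f j := by
  rw [coroot_apply, ← e.sum_comp]
  exact Finset.sum_congr rfl fun y _ => by rw [h]

include hQ in
theorem realized_typeE₆ (hE : IsTypeE6 V) {n : ℕ} (hn : Fintype.card V = n) {β : V → ℤ}
    (hβ : β ∈ positiveRoots V) : Realized (· ≤ ·) n β := by
  obtain ⟨e, he⟩ := hE
  obtain rfl : n = 6 := by rw [← hn, Fintype.card_congr e, Fintype.card_fin]
  have hedge : ∀ i j : Fin 6, CartanMatrix.E₆ i j = 0 ∨ i = j ∨ ((i : ℕ), (j : ℕ)) ∈ edgesE₆ ∨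
      ((j : ℕ), (i : ℕ)) ∈ edgesE₆ := by
    intro i j
    fin_cases i <;> fin_cases j <;> decide
  have hsum : ∀ (i : Fin 6) (f : ℕ → ℤ), ∑ j, CartanMatrix.E₆ i j * f j =
      2 * f i - ((neighborsE₆ i).map f).sum := by
    intro i f
    fin_cases i <;> simp [Fin.sum_univ_succ, CartanMatrix.E₆, neighborsE₆] <;> ring
  obtain ⟨o, ho, harr⟩ := exists_orientation hQ e edgesE₆ fun x y => by
    have := hedge (e x) (e y)
    rwa [← he, e.apply_eq_iff_eq] at this
  have hfound := List.all_eq_true.1 found_typeE₆ o ho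
  rw [evalNat_eq, evalList_eq, Bool.and_eq_true] at hfound
  have hd : Describes e neighborsE₆ (codedArrow (arrowCode edgesE₆ o)) :=
    ⟨fun x f => (coroot_eq_sum e he x f).trans (hsum _ f), fun x y h =>
      harr x y (arrows_eq_false_of_encodes hfound.1 (e x).2 (e y).2 h)⟩
  obtain ⟨v, hv, rfl⟩ := hd.exists_of_mem_positiveRoots isStable_rootsE₆ hβ
  exact hd.realized_of_found (List.all_eq_true.1 hfound.2 v hv)

include hQ in
theorem realized_typeE₇ (hE : IsTypeE7 V) {n : ℕ} (hn : Fintype.card V = n) {β : V → ℤ}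
    (hβ : β ∈ positiveRoots V) : Realized (· ≤ ·) n β := by
  obtain ⟨e, he⟩ := hE
  obtain rfl : n = 7 := by rw [← hn, Fintype.card_congr e, Fintype.card_fin]
  have hedge : ∀ i j : Fin 7, CartanMatrix.E₇ i j = 0 ∨ i = j ∨ ((i : ℕ), (j : ℕ)) ∈ edgesE₇ ∨
      ((j : ℕ), (i : ℕ)) ∈ edgesE₇ := by
    intro i j
    fin_cases i <;> fin_cases j <;> decide
  have hsum : ∀ (i : Fin 7) (f : ℕ → ℤ), ∑ j, CartanMatrix.E₇ i j * f j =
      2 * f i - ((neighborsE₇ i).map f).sum := by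
    intro i f
    fin_cases i <;> simp [Fin.sum_univ_succ, CartanMatrix.E₇, neighborsE₇] <;> ring
  obtain ⟨o, ho, harr⟩ := exists_orientation hQ e edgesE₇ fun x y => by
    have := hedge (e x) (e y)
    rwa [← he, e.apply_eq_iff_eq] at this
  have hfound := List.all_eq_true.1 found_or_yields_typeE₇ o ho
  rw [evalNat_eq, evalList_eq, Bool.and_eq_true] at hfound
  have hd : Describes e neighborsE₇ (codedArrow (arrowCode edgesE₇ o)) :=
    ⟨fun x f => (coroot_eq_sum e he x f).trans (hsum _ f), fun x y h =>
      harr x y (arrows_eq_false_of_encodes hfound.1 (e x).2 (e y).2 h)⟩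
  obtain ⟨v, hv, rfl⟩ := hd.exists_of_mem_positiveRoots isStable_rootsE₇ hβ
  have := List.all_eq_true.1 hfound.2 v hv
  rw [Bool.or_eq_true, List.any_eq_true] at this
  rcases this with h | ⟨D, -, h⟩
  · exact hd.realized_of_found h
  · rw [Bool.or_eq_true] at h
    rcases h with h | h <;> exact hd.realized_of_yields (by norm_num) h

end TypeE

end LeeLee

/-- The revised Lee-Lee conjecture for acyclic quivers of type `A`, `D`, `E_6` and `E_7`. -/
theorem theorem3p4 (V : Type*) [Fintype V] [DecidableEq V] [Quiver V]
    [∀ i j : V, Finite (i ⟶ j)] (hQ : LeeLee.IsAcyclicQuiver V)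
    (n : ℕ) (hn : Fintype.card V = n) :
    (LeeLee.IsTypeA V ∨ LeeLee.IsTypeD V ∨ LeeLee.IsTypeE6 V ∨ LeeLee.IsTypeE7 V →
      (⋃ π ∈ LeeLee.compatiblePerms V n,
        {β : V → ℤ | ∃ γ ∈ LeeLee.nonDecreasingCurves π, LeeLee.IsAssociatedRoot π γ β}) =
          LeeLee.positiveRoots V) ∧
    (LeeLee.IsTypeA V →
      (⋃ π ∈ LeeLee.compatiblePerms V n,
        {β : V → ℤ | ∃ γ ∈ LeeLee.strictlyIncreasingCurves π, LeeLee.IsAssociatedRoot π γ β}) =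
          LeeLee.positiveRoots V) := by
  have hstrict : ∀ v v' : V → ℤ, v < v' → v ≤ v' := fun _ _ h => h.le
  constructor
  · intro hT
    refine LeeLee.iUnion_eq_positiveRoots (R := (· ≤ ·)) (fun _ _ h => h) fun β hβ => ?_
    rcases hT with hA | hD | hE | hE
    · exact (LeeLee.realized_typeA hQ hA hn hβ).imp hstrict
    · exact LeeLee.realized_typeD hQ hD hn hβ
    · exact LeeLee.realized_typeE₆ hQ hE hn hβ
    · exact LeeLee.realized_typeE₇ hQ hE hn hβ
  · intro hA
    exact LeeLee.iUnion_eq_positiveRoots (R := (· < ·)) hstrict fun β hβ =>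
      LeeLee.realized_typeA hQ hA hn hβ
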